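/- Let $n\ge 2$, $G=\mathrm{Spin}(2n,1)$, $\mathfrak g=\mathfrak{so}(2n,1)$ (for the form $x_1^2+\dots+x_{2n}^2-x_0^2$, coordinates ordered $x_1,\dots,x_{2n},x_0$), and let $P=MAN$ be the standard minimal parabolic subgroup of $G$: the preimage of $P_1=M_1AN\subset \mathrm{SO}_e(2n,1)$, where $M_1=\{\mathrm{diag}(W,1,1):W\in \mathrm{SO}(2n-1)\}$, $A=\exp(\mathbb R H_0)$ with $H_0=E_{2n,0}+E_{0,2n}$, and $N=\exp\mathfrak n$, $$\mathfrak n=\left\{\begin{pmatrix}0&-\alpha^t&\alpha^t\\ \alpha&0&0\\ \alpha&0&0\end{pmatrix}:\alpha\in\mathbb R^{2n-1}\right\}.$$ Let $\mathfrak p=\mathfrak m+\mathfrak a+\mathfrak n$ be its Lie algebra and $\mathfrak l^*\subset\mathfrak p^*$ the space of functionals vanishing on $\mathfrak n$. A coadjoint $P$-orbit in $\mathfrak p^*$ has depth zero if it is contained in $\mathfrak l^*$, and depth one otherwise. For $X\in\mathfrak g$ let $\iota(X)\in\mathfrak g^*$ be $Z\mapsto\frac12\mathrm{tr}(XZ)$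 and $\mathrm{pr}(X)=\iota(X)|_{\mathfrak p}$. Every depth-one orbit contains some $\mathrm{pr}(X_{Y,\beta})$ with $$X_{Y,\beta}=\begin{pmatrix}Y&\beta^t&\beta^t\\-\beta&0&0\\ \beta&0&0\end{pmatrix},\qquad Y\in\mathfrak{so}(2n-1),\ 0\ne\beta\in\mathbb R^{2n-1},\ Y\beta^t=0;$$ its singular values are the numbers $x_1\ge\dots\ge x_{n-1}\ge0$ such that the singular values of $Y$, with multiplicity, are $x_1,x_1,\dots,x_{n-1},x_{n-1},0$. Let $a_1>a_2>\dots>a_{n-1}>0$ and $a_n>0$, let $f=\iota(\mathrm{diag}(a_1H',\dots,a_{n-1}H',0,a_nH))$ with $H'=\begin{pmatrix}0&1\\-1&0\end{pmatrix}$ and $H=\begin{pmatrix}0&1\\1&0\end{pmatrix}$, so that $\mathcal O_f=G\cdot f$ is a regular non-elliptic semisimple coadjoint orbit, and let $q:\mathcal O_f\to\mathfrak p^*$ be the moment map, i.e. restriction of functionals to $\mathfrak p$. Let $g'_\infty\in G$ be a preimage of $\mathrm{diag}(I_{2n-2},-1,-1,1)$ (such preimages exist). Then: 1. $P\cdot q(f)$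 and $P\cdot q(g'_\infty\cdot f)$ are two distinct depth-zero orbits, and $q(\mathcal O_f)$ is the union of these two orbits and of all depth-one coadjoint $P$-orbits whose singular values satisfy $$a_1\ge x_1\ge a_2\ge x_2\ge\dots\ge a_{n-1}\ge x_{n-1}\ge 0.$$ 2. $q$ maps different $P$-orbits in $\mathcal O_f$ to different $P$-orbits in $\mathfrak p^*$. 3. For every $g\in G$ the reduced space $q^{-1}(q(g\cdot f))/\mathrm{Stab}_P(q(g\cdot f))$ is a singleton. 4. $q$ is weakly proper: the preimage in $\mathcal O_f$ of every compact set of strongly regular elements of $\mathfrak p^*$ contained in $q(\mathcal O_f)$ is compact. Here $\mu\in\mathfrak p^*$ is regular if its coadjoint orbit has maximal dimension, and strongly regular if it is regular and the dimension of $\{X\in\mathfrak p(\mu):\mathrm{ad}\,X\text{ is semisimple}\}$ is maximal among regular elements, where $\mathfrak p(\mu)$ is the Lie algebra of the stabilizer of $\mu$ in $P$. 5. $q$ is not proper. -/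

import Mathlib

open Matrix Polynomial

noncomputable section

namespace SpinMoment

attribute [local instance] LieRing.ofAssociativeRing

/-! ### The group `Spin(2n,1)`

Coordinates of `ℝ^{2n+1}` are ordered as `x₁, …, x_{2n-1} | x_{2n} | x₀`.  The first `2n - 1` of
them are indexed by `Tr n`: the pairs `(x_{2i-1}, x_{2i})`, `1 ≤ i ≤ n - 1`, followed by
`x_{2n-1}`. -/

abbrev Tr (n : ℕ) : Type := (Fin 2 × Fin (n - 1)) ⊕ Unit

abbrev Sp (n : ℕ) : Type := Tr n ⊕ Unit

abbrev Ix (n : ℕ) : Type := Sp n ⊕ Unit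

abbrev Mat (n : ℕ) : Type := Matrix (Ix n) (Ix n) ℝ

/-- The form `x₁² + ⋯ + x_{2n}² - x₀²`. -/
def Qf (n : ℕ) : QuadraticForm ℝ (Ix n → ℝ) :=
  QuadraticMap.weightedSumSquares ℝ
    (Sum.elim (fun _ : Sp n => (1 : ℝ)) (fun _ : Unit => (-1 : ℝ)))

/-- `G = Spin(2n,1)`, inside the even Clifford algebra.  Its elements satisfy `x * star x = 1`,
so that this is the connected double cover of the identity component of `SO(2n,1)`. -/
abbrev SpinG (n : ℕ) : Type := spinGroup (Qf n)

/-- The left inverse of the embedding of vectors into the Clifford algebra. -/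
def vec (n : ℕ) : CliffordAlgebra (Qf n) →ₗ[ℝ] (Ix n → ℝ) :=
  ExteriorAlgebra.ιInv ∘ₗ (CliffordAlgebra.equivExterior (Qf n)).toLinearMap

theorem vec_ι (n : ℕ) (v : Ix n → ℝ) : vec n (CliffordAlgebra.ι (Qf n) v) = v := by
  have h : CliffordAlgebra.equivExterior (Qf n) (CliffordAlgebra.ι (Qf n) v)
      = ExteriorAlgebra.ι ℝ v := CliffordAlgebra.changeForm_ι CliffordAlgebra.changeForm.associated_neg_proof _
  rw [vec, LinearMap.comp_apply, LinearEquiv.coe_coe, h]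
  exact ExteriorAlgebra.ι_leftInverse v

/-- The vector representation `v ↦ x v x⁻¹` of `Spin(2n,1)`, as linear maps. -/
def vecAct (n : ℕ) (x : SpinG n) : (Ix n → ℝ) →ₗ[ℝ] (Ix n → ℝ) where
  toFun v := vec n ((x : CliffordAlgebra (Qf n)) * CliffordAlgebra.ι (Qf n) v *
    ((x⁻¹ : SpinG n) : CliffordAlgebra (Qf n)))
  map_add' v w := by simp [mul_add, add_mul]
  map_smul' c v := by simp

theorem ι_vecAct (n : ℕ) (x : SpinG n) (v : Ix n → ℝ) :
    CliffordAlgebra.ι (Qf n) (vecAct n x v) =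
      (x : CliffordAlgebra (Qf n)) * CliffordAlgebra.ι (Qf n) v *
        ((x⁻¹ : SpinG n) : CliffordAlgebra (Qf n)) := by
  have h := spinGroup.conjAct_smul_ι_mem_range_ι (Q := Qf n) (x := spinGroup.toUnits x) x.2 v
  rw [ConjAct.units_smul_def, ConjAct.ofConjAct_toConjAct] at h
  obtain ⟨w, hw⟩ := h
  have hw' : CliffordAlgebra.ι (Qf n) w = (x : CliffordAlgebra (Qf n)) * CliffordAlgebra.ι (Qf n) v *
        ((x⁻¹ : SpinG n) : CliffordAlgebra (Qf n)) := hw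
  change CliffordAlgebra.ι (Qf n) (vec n _) = _
  rw [← hw', vec_ι]

theorem algebraMap_inj' (n : ℕ) :
    Function.Injective (algebraMap ℝ (CliffordAlgebra (Qf n))) := by
  have : Nontrivial (CliffordAlgebra (Qf n)) :=
    (CliffordAlgebra.equivExterior (Qf n)).toEquiv.nontrivial
  exact FaithfulSMul.algebraMap_injective ℝ _

theorem ι_inj (n : ℕ) : Function.Injective (CliffordAlgebra.ι (Qf n)) :=
  Function.LeftInverse.injective (vec_ι n)

/-- The covering homomorphism from `Spin(2n,1)` onto the identity component of `SO(2n,1)`. -/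
def rho (n : ℕ) : SpinG n →* Mat n where
  toFun x := LinearMap.toMatrix' (vecAct n x)
  map_one' := by
    have : vecAct n 1 = LinearMap.id := by
      ext1 v; apply LinearMap.ext; intro c; simp [vecAct, vec_ι]
    rw [this, LinearMap.toMatrix'_id]
  map_mul' x y := by
    rw [← LinearMap.toMatrix'_mul]
    congr 1
    refine LinearMap.ext fun v => ι_inj n ?_
    rw [Module.End.mul_apply, ι_vecAct, ι_vecAct, ι_vecAct]
    simp only [_root_.mul_inv_rev, Submonoid.coe_mul, mul_assoc]

theorem Qf_vecAct (n : ℕ) (x : SpinG n) (v : Ix n → ℝ) : Qf n (vecAct n x v) = Qf n v := by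
  have hx : ((x⁻¹ : SpinG n) : CliffordAlgebra (Qf n)) * (x : CliffordAlgebra (Qf n)) = 1 := by
    rw [← Submonoid.coe_mul, inv_mul_cancel]; rfl
  have hx' : (x : CliffordAlgebra (Qf n)) * ((x⁻¹ : SpinG n) : CliffordAlgebra (Qf n)) = 1 := by
    rw [← Submonoid.coe_mul, mul_inv_cancel]; rfl
  have h : algebraMap ℝ (CliffordAlgebra (Qf n)) (Qf n (vecAct n x v)) =
      algebraMap ℝ (CliffordAlgebra (Qf n)) (Qf n v) := by
    rw [← CliffordAlgebra.ι_sq_scalar, ι_vecAct]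
    calc _ = (x : CliffordAlgebra (Qf n)) * CliffordAlgebra.ι (Qf n) v *
          (((x⁻¹ : SpinG n) : CliffordAlgebra (Qf n)) * (x : CliffordAlgebra (Qf n))) *
          (CliffordAlgebra.ι (Qf n) v * ((x⁻¹ : SpinG n) : CliffordAlgebra (Qf n))) := by
            simp only [mul_assoc]
      _ = (x : CliffordAlgebra (Qf n)) * (CliffordAlgebra.ι (Qf n) v * CliffordAlgebra.ι (Qf n) v) *
          ((x⁻¹ : SpinG n) : CliffordAlgebra (Qf n)) := by
            rw [hx, mul_one]; simp only [mul_assoc]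
      _ = _ := by
            rw [CliffordAlgebra.ι_sq_scalar, ← Algebra.commutes, mul_assoc, hx', mul_one]
  exact algebraMap_inj' n h

abbrev Jm (n : ℕ) : Mat n := LieAlgebra.Orthogonal.indefiniteDiagonal (Sp n) Unit ℝ

theorem Qf_apply (n : ℕ) (v : Ix n → ℝ) : Qf n v = v ⬝ᵥ (Jm n *ᵥ v) := by
  simp [Qf, QuadraticMap.weightedSumSquares_apply, LieAlgebra.Orthogonal.indefiniteDiagonal,
    dotProduct, Matrix.mulVec_diagonal]

theorem rho_mulVec (n : ℕ) (x : SpinG n) (v : Ix n → ℝ) : rho n x *ᵥ v = vecAct n x v :=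
  LinearMap.toMatrix'_mulVec _ _

theorem rho_Jm (n : ℕ) (x : SpinG n) : (rho n x)ᵀ * Jm n * rho n x = Jm n := by
  set B : Mat n := (rho n x)ᵀ * Jm n * rho n x with hB
  have hJ : (Jm n)ᵀ = Jm n := by simp [LieAlgebra.Orthogonal.indefiniteDiagonal]
  have hBt : Bᵀ = B := by simp [hB, Matrix.transpose_mul, hJ, Matrix.mul_assoc]
  have h : ∀ v, v ⬝ᵥ (B *ᵥ v) = v ⬝ᵥ (Jm n *ᵥ v) := by
    intro v
    have := Qf_vecAct n x v
    rw [Qf_apply, Qf_apply, ← rho_mulVec] at this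
    rw [← this, hB, ← Matrix.mulVec_mulVec, ← Matrix.mulVec_mulVec, Matrix.dotProduct_mulVec,
      Matrix.vecMul_transpose]
  have key : ∀ (C : Mat n), Cᵀ = C → (∀ v, v ⬝ᵥ (C *ᵥ v) = 0) → C = 0 := by
    intro C hC h0
    ext i j
    have h1 := h0 (Pi.single i 1)
    have h2 := h0 (Pi.single j 1)
    have h3 := h0 (Pi.single i 1 + Pi.single j 1)
    have h4 : C j i = C i j := congrFun (congrFun hC i) j
    simp [Matrix.mulVec_add] at h1 h2 h3
    simp
    linarith
  refine sub_eq_zero.1 (key _ (by rw [Matrix.transpose_sub, hBt, hJ]) fun v => ?_)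
  rw [Matrix.sub_mulVec, dotProduct_sub, h, sub_self]

/-! ### The Lie algebra and its coadjoint representation -/

/-- `𝔤 = 𝔰𝔬(2n,1)`. -/
abbrev gLie (n : ℕ) : LieSubalgebra ℝ (Mat n) := LieAlgebra.Orthogonal.so' (Sp n) Unit ℝ

theorem mem_gLie {n : ℕ} {X : Mat n} : X ∈ gLie n ↔ Xᵀ * Jm n = -(Jm n * X) := by
  refine (mem_skewAdjointMatricesSubmodule (J := Jm n) (A₁ := X)).trans ?_
  rw [Matrix.IsSkewAdjoint, Matrix.IsAdjointPair, Matrix.mul_neg]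

theorem conj_mem_gLie (n : ℕ) (x : SpinG n) {X : Mat n} (hX : X ∈ gLie n) :
    rho n x * X * rho n x⁻¹ ∈ gLie n := by
  rw [mem_gLie] at hX ⊢
  have h1 : rho n x * rho n x⁻¹ = 1 := by rw [← map_mul, mul_inv_cancel, map_one]
  have h1' : (rho n x⁻¹)ᵀ * (rho n x)ᵀ = 1 := by rw [← Matrix.transpose_mul, h1, transpose_one]
  have h2 := rho_Jm n x
  have h3 : (rho n x)ᵀ * Jm n = Jm n * rho n x⁻¹ := by
    rw [← h2, Matrix.mul_assoc _ _ (rho n x⁻¹), h1, Matrix.mul_one, h2]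
  have h4 : (rho n x⁻¹)ᵀ * Jm n = Jm n * rho n x := by
    have := rho_Jm n x⁻¹
    have h1i : rho n x⁻¹ * rho n x = 1 := by rw [← map_mul, inv_mul_cancel, map_one]
    rw [← this, Matrix.mul_assoc _ _ (rho n x), h1i, Matrix.mul_one, this]
  calc _ = (rho n x⁻¹)ᵀ * Xᵀ * ((rho n x)ᵀ * Jm n) := by
        simp only [Matrix.transpose_mul, Matrix.mul_assoc]
    _ = (rho n x⁻¹)ᵀ * (Xᵀ * Jm n) * rho n x⁻¹ := by rw [h3]; simp only [Matrix.mul_assoc]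
    _ = -(((rho n x⁻¹)ᵀ * Jm n) * X * rho n x⁻¹) := by
        rw [hX]; simp only [Matrix.mul_neg, Matrix.neg_mul, Matrix.mul_assoc]
    _ = _ := by rw [h4]; simp only [Matrix.mul_assoc]

/-- The adjoint representation of `G` on `𝔤`. -/
def Ad (n : ℕ) : Representation ℝ (SpinG n) (gLie n) where
  toFun x :=
    { toFun := fun X => ⟨rho n x * (X : Mat n) * rho n x⁻¹, conj_mem_gLie n x X.2⟩
      map_add' := fun X Y => Subtype.ext (by simp [mul_add, add_mul])
      map_smul' := fun c X => Subtype.ext (by simp) }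
  map_one' := LinearMap.ext fun X => Subtype.ext (by simp)
  map_mul' x y := LinearMap.ext fun X => Subtype.ext (by simp [mul_assoc])

/-- The coadjoint representation of `G` on `𝔤*`. -/
abbrev coad (n : ℕ) : Representation ℝ (SpinG n) (Module.Dual ℝ (gLie n)) := (Ad n).dual

/-- The isomorphism `ι : 𝔤 → 𝔤*` given by the invariant form `½ tr(XY)`. -/
def iota {n : ℕ} (X : gLie n) : Module.Dual ℝ (gLie n) where
  toFun Y := (1 / 2) * ((X : Mat n) * (Y : Mat n)).trace
  map_add' Y Z := by simp [mul_add]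
  map_smul' c Y := by simp; ring

/-! ### The parabolic subalgebra and the parabolic subgroup -/

/-- The matrix with block rows `(Y, uᵗ, vᵗ)`, `(w, a, b)`, `(z, c, d)`. -/
def blk {n : ℕ} (Y : Matrix (Tr n) (Tr n) ℝ) (u v w z : Tr n → ℝ) (a b c d : ℝ) : Mat n :=
  Matrix.of fun i j => match i, j with
    | .inl (.inl i), .inl (.inl j) => Y i j
    | .inl (.inl i), .inl (.inr _) => u i
    | .inl (.inl i), .inr _ => v i
    | .inl (.inr _), .inl (.inl j) => w j
    | .inl (.inr _), .inl (.inr _) => a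
    | .inl (.inr _), .inr _ => b
    | .inr _, .inl (.inl j) => z j
    | .inr _, .inl (.inr _) => c
    | .inr _, .inr _ => d

section blk
variable {n : ℕ} (Y Y' : Matrix (Tr n) (Tr n) ℝ) (u v w z u' v' w' z' : Tr n → ℝ)
  (a b c d a' b' c' d' : ℝ)

theorem blk_mul : blk Y u v w z a b c d * blk Y' u' v' w' z' a' b' c' d' =
    blk (Y * Y' + vecMulVec u w' + vecMulVec v z')
      (Y *ᵥ u' + a' • u + c' • v) (Y *ᵥ v' + b' • u + d' • v)
      (w ᵥ* Y' + a • w' + b • z') (z ᵥ* Y' + c • w' + d • z')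
      (w ⬝ᵥ u' + a * a' + b * c') (w ⬝ᵥ v' + a * b' + b * d')
      (z ⬝ᵥ u' + c * a' + d * c') (z ⬝ᵥ v' + c * b' + d * d') := by
  ext i j
  rcases i with (i | i) | i <;> rcases j with (j | j) | j <;>
    simp only [Matrix.mul_apply, Fintype.sum_sum_type, blk, Matrix.of_apply, Matrix.add_apply,
      vecMulVec_apply, Pi.add_apply, Pi.smul_apply, Matrix.mulVec, Matrix.vecMul, dotProduct,
      smul_eq_mul, Finset.univ_unique, Finset.sum_singleton] <;> ring

theorem blk_add : blk Y u v w z a b c d + blk Y' u' v' w' z' a' b' c' d' =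
    blk (Y + Y') (u + u') (v + v') (w + w') (z + z') (a + a') (b + b') (c + c') (d + d') := by
  ext i j
  rcases i with (i | i) | i <;> rcases j with (j | j) | j <;> simp [blk]

theorem blk_sub : blk Y u v w z a b c d - blk Y' u' v' w' z' a' b' c' d' =
    blk (Y - Y') (u - u') (v - v') (w - w') (z - z') (a - a') (b - b') (c - c') (d - d') := by
  ext i j
  rcases i with (i | i) | i <;> rcases j with (j | j) | j <;> simp [blk]

theorem blk_smul (r : ℝ) : r • blk Y u v w z a b c d =
    blk (r • Y) (r • u) (r • v) (r • w) (r • z) (r * a) (r * b) (r * c) (r * d) := by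
  ext i j
  rcases i with (i | i) | i <;> rcases j with (j | j) | j <;> simp [blk]

theorem blk_zero : (0 : Mat n) = blk 0 0 0 0 0 0 0 0 0 := by
  ext i j
  rcases i with (i | i) | i <;> rcases j with (j | j) | j <;> simp [blk]

theorem blk_one : (1 : Mat n) = blk 1 0 0 0 0 1 0 0 1 := by
  ext i j
  rcases i with (i | i) | i <;> rcases j with (j | j) | j <;> simp [blk, Matrix.one_apply]

theorem exists_blk (X : Mat n) : ∃ (Y : Matrix (Tr n) (Tr n) ℝ) (u v w z : Tr n → ℝ)
    (a b c d : ℝ), X = blk Y u v w z a b c d := by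
  refine ⟨Matrix.of fun i j => X (.inl (.inl i)) (.inl (.inl j)),
    fun i => X (.inl (.inl i)) (.inl (.inr ())), fun i => X (.inl (.inl i)) (.inr ()),
    fun j => X (.inl (.inr ())) (.inl (.inl j)), fun j => X (.inr ()) (.inl (.inl j)),
    X (.inl (.inr ())) (.inl (.inr ())), X (.inl (.inr ())) (.inr ()),
    X (.inr ()) (.inl (.inr ())), X (.inr ()) (.inr ()), ?_⟩
  ext i j
  rcases i with (i | i) | i <;> rcases j with (j | j) | j <;> rfl

theorem blk_mem_gLie : blk Y u v w z a b c d ∈ gLie n ↔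
    Yᵀ = -Y ∧ w = -u ∧ z = v ∧ a = 0 ∧ c = b ∧ d = 0 := by
  rw [mem_gLie]
  constructor
  · intro h
    have H : ∀ i j, ((blk Y u v w z a b c d)ᵀ * Jm n) i j =
      (-(Jm n * blk Y u v w z a b c d)) i j := fun i j => by rw [h]
    simp only [LieAlgebra.Orthogonal.indefiniteDiagonal, Matrix.mul_diagonal, Matrix.neg_apply,
      Matrix.diagonal_mul, Matrix.transpose_apply] at H
    refine ⟨?_, ?_, ?_, ?_, ?_, ?_⟩
    · ext i j
      simpa [blk] using H (.inl (.inl i)) (.inl (.inl j))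
    · ext i
      simpa [blk] using H (.inl (.inl i)) (.inl (.inr ()))
    · ext i
      simpa [blk] using H (.inl (.inl i)) (.inr ())
    · have := H (.inl (.inr ())) (.inl (.inr ()))
      simp [blk] at this
      linarith
    · simpa [blk] using H (.inl (.inr ())) (.inr ())
    · have := H (.inr ()) (.inr ())
      simp [blk] at this
      linarith
  · rintro ⟨h, rfl, rfl, rfl, rfl, rfl⟩
    have h' : ∀ i j, Y j i = -Y i j := fun i j => congrFun (congrFun h i) j
    ext i j
    simp only [LieAlgebra.Orthogonal.indefiniteDiagonal, Matrix.mul_diagonal, Matrix.neg_apply,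
      Matrix.diagonal_mul, Matrix.transpose_apply]
    rcases i with (i | i) | i <;> rcases j with (j | j) | j <;> simp [blk]
    exact h' i j

theorem blk_mulVec (x : Tr n → ℝ) (s t : ℝ) :
    blk Y u v w z a b c d *ᵥ (Sum.elim (Sum.elim x fun _ => s) fun _ => t) =
      Sum.elim (Sum.elim (Y *ᵥ x + s • u + t • v) fun _ => w ⬝ᵥ x + a * s + b * t)
        fun _ => z ⬝ᵥ x + c * s + d * t := by
  ext i
  rcases i with (i | i) | i <;>
    simp [Matrix.mulVec, blk, dotProduct, Fintype.sum_sum_type] <;> ring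

end blk

/-- `𝔭 = 𝔪 + 𝔞 + 𝔫`. -/
def pLie (n : ℕ) : LieSubalgebra ℝ (gLie n) where
  carrier := {X | ∃ (Y : Matrix (Tr n) (Tr n) ℝ) (α : Tr n → ℝ) (a : ℝ),
    (X : Mat n) = blk Y (-α) α α α 0 a a 0}
  add_mem' := by
    rintro X X' ⟨Y, α, a, h⟩ ⟨Y', α', a', h'⟩
    refine ⟨Y + Y', α + α', a + a', ?_⟩
    change (X : Mat n) + (X' : Mat n) = _
    rw [h, h', blk_add]
    congr 1 <;> simp [add_comm]
  zero_mem' := ⟨0, 0, 0, by simpa using blk_zero⟩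
  smul_mem' := by
    rintro c X ⟨Y, α, a, h⟩
    refine ⟨c • Y, c • α, c * a, ?_⟩
    change c • (X : Mat n) = _
    rw [h, blk_smul]
    congr 1 <;> simp
  lie_mem' := by
    rintro X X' ⟨Y, α, a, h⟩ ⟨Y', α', a', h'⟩
    have hY := ((blk_mem_gLie _ _ _ _ _ _ _ _ _).1 (h ▸ X.2)).1
    have hY' := ((blk_mem_gLie _ _ _ _ _ _ _ _ _).1 (h' ▸ X'.2)).1
    refine ⟨Y * Y' - Y' * Y, α ᵥ* Y' + a • α' - (α' ᵥ* Y + a' • α), 0, ?_⟩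
    rw [LieSubalgebra.coe_bracket, h, h', LieRing.of_associative_ring_bracket, blk_mul, blk_mul,
      blk_sub]
    have e1 : Y *ᵥ α' = -(α' ᵥ* Y) := by rw [← Matrix.mulVec_transpose, hY, neg_mulVec, neg_neg]
    have e2 : Y' *ᵥ α = -(α ᵥ* Y') := by rw [← Matrix.mulVec_transpose, hY', neg_mulVec, neg_neg]
    congr 1 <;> simp [e1, e2, Matrix.mulVec_neg, neg_vecMulVec, dotProduct_comm α' α]
    all_goals ring

/-- `𝔫`, as a subspace of `𝔭`. -/
def nLie (n : ℕ) : Submodule ℝ (pLie n) where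
  carrier := {X | ∃ α : Tr n → ℝ, ((X : gLie n) : Mat n) = blk 0 (-α) α α α 0 0 0 0}
  add_mem' := by
    rintro X X' ⟨α, h⟩ ⟨α', h'⟩
    refine ⟨α + α', ?_⟩
    change ((X : gLie n) : Mat n) + ((X' : gLie n) : Mat n) = _
    rw [h, h', blk_add]
    congr 1 <;> simp [add_comm]
  zero_mem' := ⟨0, by simpa using blk_zero⟩
  smul_mem' := by
    rintro c X ⟨α, h⟩
    refine ⟨c • α, ?_⟩
    change c • ((X : gLie n) : Mat n) = _
    rw [h, blk_smul]
    congr 1 <;> simp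

/-- An element `diag(W, 1, 1)` of `M₁ = SO(2n-1)`. -/
def mMat {n : ℕ} (W : Matrix.specialOrthogonalGroup (Tr n) ℝ) : Mat n :=
  blk (W : Matrix (Tr n) (Tr n) ℝ) 0 0 0 0 1 0 0 1

/-- The element `exp(t H₀)` of `A`. -/
def aMat {n : ℕ} (t : ℝ) : Mat n :=
  blk 1 0 0 0 0 (Real.cosh t) (Real.sinh t) (Real.sinh t) (Real.cosh t)

/-- The element `n_α = exp(X_α)` of `N`. -/
def nMat {n : ℕ} (α : Tr n → ℝ) : Mat n :=
  blk 1 (-α) α α α (1 - (α ⬝ᵥ α) / 2) ((α ⬝ᵥ α) / 2) (-((α ⬝ᵥ α) / 2)) (1 + (α ⬝ᵥ α) / 2)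

theorem aMat_mul {n : ℕ} (s t : ℝ) : (aMat s : Mat n) * aMat t = aMat (s + t) := by
  simp only [aMat, blk_mul, Real.cosh_add, Real.sinh_add]
  congr 1 <;> simp <;> ring

theorem nMat_mul {n : ℕ} (α β : Tr n → ℝ) : (nMat α : Mat n) * nMat β = nMat (α + β) := by
  simp only [nMat, blk_mul]
  congr 1 <;> simp [neg_vecMulVec, dotProduct_comm β α]
  all_goals first | module | ring

theorem mMat_mul {n : ℕ} (V W : Matrix.specialOrthogonalGroup (Tr n) ℝ) :
    mMat V * mMat W = mMat (V * W) := by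
  simp only [mMat, blk_mul]
  congr 1 <;> simp

theorem aMat_mMat {n : ℕ} (t : ℝ) (W : Matrix.specialOrthogonalGroup (Tr n) ℝ) :
    aMat t * mMat W = mMat W * aMat t := by
  simp only [mMat, aMat, blk_mul]
  congr 1 <;> simp

theorem nMat_mMat {n : ℕ} (α : Tr n → ℝ) (W : Matrix.specialOrthogonalGroup (Tr n) ℝ) :
    nMat α * mMat W = mMat W * nMat (α ᵥ* (W : Matrix (Tr n) (Tr n) ℝ)) := by
  have hW : (W : Matrix (Tr n) (Tr n) ℝ) * (W : Matrix (Tr n) (Tr n) ℝ)ᵀ = 1 :=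
    (Matrix.mem_orthogonalGroup_iff _ _).1 (Matrix.mem_specialOrthogonalGroup_iff.1 W.2).1
  have h1 : (W : Matrix (Tr n) (Tr n) ℝ) *ᵥ (α ᵥ* (W : Matrix (Tr n) (Tr n) ℝ)) = α := by
    rw [← Matrix.vecMul_transpose, Matrix.vecMul_vecMul, hW, Matrix.vecMul_one]
  have h2 : (α ᵥ* (W : Matrix (Tr n) (Tr n) ℝ)) ⬝ᵥ (α ᵥ* (W : Matrix (Tr n) (Tr n) ℝ))
      = α ⬝ᵥ α := by
    rw [← Matrix.dotProduct_mulVec, h1]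
  simp only [nMat, mMat, blk_mul]
  congr 1 <;> simp [h1, h2, Matrix.mulVec_neg]

theorem nMat_aMat {n : ℕ} (α : Tr n → ℝ) (t : ℝ) :
    (nMat α : Mat n) * aMat t = aMat t * nMat (Real.exp (-t) • α) := by
  have h1 : Real.exp (-t) = Real.cosh t - Real.sinh t := by rw [Real.cosh_sub_sinh]
  have h2 := Real.cosh_sq t
  simp only [nMat, aMat, blk_mul]
  generalize Real.cosh t = C at *
  generalize Real.sinh t = S at *
  rw [h1]
  have h3 : (C - S) * (C + S) = 1 := by linear_combination h2
  have h4 : C • (C - S) • α + S • (C - S) • α = α := by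
    rw [← add_smul, smul_smul, mul_comm, h3, one_smul]
  have h5 : S • (C - S) • α + C • (C - S) • α = α := by rw [add_comm, h4]
  congr 1 <;> simp [h4, h5]
  · module
  · module
  · linear_combination ((α ⬝ᵥ α) / 2 * (C - S)) * h3
  · linear_combination (-(α ⬝ᵥ α) / 2 * (C - S)) * h3
  · linear_combination ((α ⬝ᵥ α) / 2 * (C - S)) * h3
  · linear_combination (-(α ⬝ᵥ α) / 2 * (C - S)) * h3

/-- `P = MAN`: the preimage in `G` of `P₁ = M₁AN`. -/
def ParP (n : ℕ) : Subgroup (SpinG n) where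
  carrier := {x | ∃ (W : Matrix.specialOrthogonalGroup (Tr n) ℝ) (t : ℝ) (α : Tr n → ℝ),
    rho n x = mMat W * aMat t * nMat α}
  one_mem' := by
    refine ⟨1, 0, 0, ?_⟩
    simp [mMat, aMat, nMat, ← blk_one]
  mul_mem' := by
    rintro x y ⟨W, t, α, hx⟩ ⟨W', t', α', hy⟩
    refine ⟨W * W', t + t',
      Real.exp (-t') • (α ᵥ* (W' : Matrix (Tr n) (Tr n) ℝ)) + α', ?_⟩
    rw [map_mul, hx, hy, ← mMat_mul, ← aMat_mul, ← nMat_mul]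
    calc _ = mMat W * aMat t * (nMat α * mMat W') * aMat t' * nMat α' := by
          simp only [Matrix.mul_assoc]
      _ = mMat W * (aMat t * mMat W') * (nMat (α ᵥ* (W' : Matrix (Tr n) (Tr n) ℝ)) * aMat t') *
          nMat α' := by rw [nMat_mMat]; simp only [Matrix.mul_assoc]
      _ = _ := by rw [aMat_mMat, nMat_aMat]; simp only [Matrix.mul_assoc]
  inv_mem' := by
    rintro x ⟨W, t, α, hx⟩
    have hW : mMat W⁻¹ * mMat W = (1 : Mat n) := by
      rw [mMat_mul, inv_mul_cancel]; simp [mMat, ← blk_one]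
    have ha : (aMat (-t) : Mat n) * aMat t = 1 := by
      rw [aMat_mul, neg_add_cancel]; simp [aMat, ← blk_one]
    have hn : (nMat (-α) : Mat n) * nMat α = 1 := by
      rw [nMat_mul, neg_add_cancel]; simp [nMat, ← blk_one]
    have hinv : rho n x⁻¹ = nMat (-α) * aMat (-t) * mMat W⁻¹ := by
      have h1 : rho n x * rho n x⁻¹ = 1 := by rw [← map_mul, mul_inv_cancel, map_one]
      have h2 : (nMat (-α) * aMat (-t) * mMat W⁻¹) * rho n x = 1 := by
        rw [hx]
        calc _ = nMat (-α) * (aMat (-t) * (mMat W⁻¹ * mMat W) * aMat t) * nMat α := by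
              simp only [Matrix.mul_assoc]
          _ = 1 := by rw [hW, Matrix.mul_one, ha, Matrix.mul_one, hn]
      exact (left_inv_eq_right_inv h2 h1).symm
    refine ⟨W⁻¹, -t, (Real.exp t • (-α)) ᵥ* ((W⁻¹ : Matrix.specialOrthogonalGroup (Tr n) ℝ) :
      Matrix (Tr n) (Tr n) ℝ), ?_⟩
    have e := nMat_aMat (n := n) (-α) (-t)
    rw [neg_neg] at e
    rw [hinv, e, Matrix.mul_assoc, nMat_mMat, ← Matrix.mul_assoc, aMat_mMat]

/-- The vector `(0, …, 0, 1, 1)`. -/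
def v₀ (n : ℕ) : Ix n → ℝ := Sum.elim (Sum.elim 0 fun _ => 1) fun _ => 1

theorem mem_pLie_iff {n : ℕ} (X : gLie n) :
    X ∈ pLie n ↔ ∃ c : ℝ, (X : Mat n) *ᵥ v₀ n = c • v₀ n := by
  constructor
  · rintro ⟨Y, α, a, h⟩
    refine ⟨a, ?_⟩
    rw [h, v₀, blk_mulVec]
    ext i
    rcases i with (i | i) | i <;> simp
  · rintro ⟨c, h⟩
    obtain ⟨Y, u, v, w, z, a, b, c', d, hX⟩ := exists_blk (X : Mat n)
    obtain ⟨-, rfl, rfl, rfl, rfl, rfl⟩ := (blk_mem_gLie _ _ _ _ _ _ _ _ _).1 (hX ▸ X.2)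
    rw [hX, v₀, blk_mulVec] at h
    have hu : u = -z := by
      ext i
      have := congrFun h (.inl (.inl i))
      simp at this
      simp; linarith
    exact ⟨Y, z, c', by rw [hX, hu, neg_neg]⟩

theorem rho_v₀ {n : ℕ} (x : ParP n) : ∃ c : ℝ, rho n x *ᵥ v₀ n = c • v₀ n := by
  obtain ⟨x, W, t, α, hx⟩ := x
  refine ⟨Real.cosh t + Real.sinh t, ?_⟩
  change rho n x *ᵥ v₀ n = _
  rw [hx, v₀, ← Matrix.mulVec_mulVec, ← Matrix.mulVec_mulVec, nMat, aMat, mMat, blk_mulVec,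
    blk_mulVec, blk_mulVec]
  ext i
  rcases i with (i | i) | i <;> simp [add_comm]

theorem Ad_mem_pLie {n : ℕ} (x : ParP n) {X : gLie n} (hX : X ∈ pLie n) :
    Ad n x X ∈ pLie n := by
  rw [mem_pLie_iff] at hX ⊢
  obtain ⟨c, hc⟩ := hX
  obtain ⟨d, hd⟩ := rho_v₀ x
  obtain ⟨e, he⟩ := rho_v₀ x⁻¹
  refine ⟨e * c * d, ?_⟩
  change (rho n x * (X : Mat n) * rho n ((x⁻¹ : ParP n) : SpinG n)) *ᵥ v₀ n = _
  rw [← Matrix.mulVec_mulVec, he, Matrix.mulVec_smul, ← Matrix.mulVec_mulVec, hc,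
    Matrix.mulVec_smul, hd, smul_smul, smul_smul]

/-- The adjoint representation of `P` on `𝔭`. -/
def AdP (n : ℕ) : Representation ℝ (ParP n) (pLie n) where
  toFun x :=
    { toFun := fun X => ⟨Ad n x X, Ad_mem_pLie x X.2⟩
      map_add' := fun X Y => Subtype.ext (map_add (Ad n x) (X : gLie n) Y)
      map_smul' := fun c X => Subtype.ext (map_smul (Ad n x) c (X : gLie n)) }
  map_one' := LinearMap.ext fun X => Subtype.ext (by simp)
  map_mul' x y := LinearMap.ext fun X => Subtype.ext (by simp)

/-- The coadjoint representation of `P` on `𝔭*`. -/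
abbrev coadP (n : ℕ) : Representation ℝ (ParP n) (Module.Dual ℝ (pLie n)) := (AdP n).dual

/-- The action of `P` on `𝔤*`, by restriction of the coadjoint action of `G`. -/
abbrev coadGP (n : ℕ) : Representation ℝ (ParP n) (Module.Dual ℝ (gLie n)) :=
  MonoidHom.comp (coad n) (ParP n).subtype

/-- The orbit of a vector under a representation. -/
def orbit {H V : Type*} [Group H] [AddCommGroup V] [Module ℝ V] (ρ : Representation ℝ H V)
    (v : V) : Set V :=
  Set.range fun h => ρ h v

/-! ### The moment map -/

/-- Restriction of functionals `𝔤* → 𝔭*`; its restriction to a coadjoint orbit of `G` is the moment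
map of that orbit for the action of `P`. -/
def q (n : ℕ) : Module.Dual ℝ (gLie n) →ₗ[ℝ] Module.Dual ℝ (pLie n) :=
  LinearMap.dualMap ((pLie n).incl : pLie n →ₗ[ℝ] gLie n)

/-- `𝔩* ⊆ 𝔭*`, the kernel of the restriction map `𝔭* → 𝔫*`. -/
def lStar (n : ℕ) : Submodule ℝ (Module.Dual ℝ (pLie n)) := (nLie n).dualAnnihilator

/-- A `P`-orbit in `𝔭*` has depth zero if it lies in `𝔩*`; otherwise it has depth one. -/
def DepthZero {n : ℕ} (O : Set (Module.Dual ℝ (pLie n))) : Prop := O ⊆ lStar n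

/-- The `P`-orbit `O` contains `pr(X_{Y,β,0})` with `β ≠ 0`, `Y βᵗ = 0`, where the singular values
of `Y` (the square roots of the eigenvalues of `YᵗY`) are `x₁, x₁, …, x_{n-1}, x_{n-1}, 0`, and
`x₁ ≥ ⋯ ≥ x_{n-1} ≥ 0`. -/
def HasSingularValues {n : ℕ} (O : Set (Module.Dual ℝ (pLie n))) (x : Fin (n - 1) → ℝ) : Prop :=
  Antitone x ∧ (∀ i, 0 ≤ x i) ∧
    ∃ (Z : gLie n) (Y : Matrix (Tr n) (Tr n) ℝ) (β : Tr n → ℝ),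
      (Z : Mat n) = blk Y β β (-β) β 0 0 0 0 ∧ β ≠ 0 ∧ Y *ᵥ β = 0 ∧ q n (iota Z) ∈ O ∧
      (Yᵀ * Y).charpoly = (X : ℝ[X]) * ∏ i, (X - C (x i ^ 2)) ^ 2

theorem q_equivariant {n : ℕ} (x : ParP n) (φ : Module.Dual ℝ (gLie n)) :
    q n (coadGP n x φ) = coadP n x (q n φ) := rfl

/-- On the fibre of `q : O → 𝔭*` over `μ`, being in the same orbit of `Stab_P(μ)`. -/
def fibreSetoid {n : ℕ} (O : Set (Module.Dual ℝ (gLie n))) (μ : Module.Dual ℝ (pLie n)) :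
    Setoid {φ : Module.Dual ℝ (gLie n) // φ ∈ O ∧ q n φ = μ} where
  r φ ψ := ∃ x : ParP n, coadP n x μ = μ ∧ coadGP n x φ = ψ
  iseqv :=
    { refl := fun φ => ⟨1, by rw [map_one]; rfl, by rw [map_one]; rfl⟩
      symm := by
        rintro φ ψ ⟨x, hx, h⟩
        refine ⟨x⁻¹, ?_, ?_⟩
        · conv_lhs => rw [← hx]
          rw [← Module.End.mul_apply, ← map_mul, inv_mul_cancel, map_one, Module.End.one_apply]
        · rw [← h, ← Module.End.mul_apply, ← map_mul, inv_mul_cancel, map_one,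
            Module.End.one_apply]
      trans := by
        rintro φ ψ χ ⟨x, hx, h⟩ ⟨y, hy, h'⟩
        refine ⟨y * x, ?_, ?_⟩
        · rw [map_mul, Module.End.mul_apply, hx, hy]
        · rw [map_mul, Module.End.mul_apply, h, h'] }

/-- The reduced space `q⁻¹(μ) / Stab_P(μ)` of `O`. -/
def ReducedSpace {n : ℕ} (O : Set (Module.Dual ℝ (gLie n))) (μ : Module.Dual ℝ (pLie n)) : Type :=
  Quotient (fibreSetoid O μ)

/-! ### Strong regularity and weak properness -/

section regular
variable {L : Type*} [LieRing L] [LieAlgebra ℝ L]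

/-- `L(f) = {X | f([X, Y]) = 0 for all Y}`, the Lie algebra of the stabilizer of `f ∈ L*`. -/
def stab (f : Module.Dual ℝ L) : Submodule ℝ L where
  carrier := {X | ∀ Y, f ⁅X, Y⁆ = 0}
  add_mem' := fun {X X'} hX hX' Y => by rw [add_lie, map_add, hX, hX', add_zero]
  zero_mem' := fun Y => by rw [zero_lie, map_zero]
  smul_mem' := fun c X hX Y => by rw [smul_lie, map_smul, hX, smul_zero]

/-- `f` is regular if its coadjoint orbit has maximal dimension, i.e. if `L(f)` has minimal
dimension. -/
def IsRegular (f : Module.Dual ℝ L) : Prop :=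
  ∀ f' : Module.Dual ℝ L, Module.finrank ℝ (stab f) ≤ Module.finrank ℝ (stab f')

/-- The reductive factor `{X ∈ L(f) | ad X semisimple}`.  It is a subspace if `f` is regular,
because `L(f)` is then commutative; in general its span is taken. -/
def reductiveFactor (f : Module.Dual ℝ L) : Submodule ℝ L :=
  Submodule.span ℝ {X | X ∈ stab f ∧ (LieAlgebra.ad ℝ L X : Module.End ℝ L).IsSemisimple}

/-- `f` is strongly regular if it is regular and its reductive factor has maximal dimension among
those of the regular elements. -/
def IsStronglyRegular (f : Module.Dual ℝ L) : Prop :=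
  IsRegular f ∧ ∀ f' : Module.Dual ℝ L, IsRegular f' →
    Module.finrank ℝ (reductiveFactor f') ≤ Module.finrank ℝ (reductiveFactor f)

end regular

/-- The topology of pointwise convergence on a dual space; for a finite-dimensional space it is the
usual topology of the dual. -/
instance dualTopology {W : Type*} [AddCommGroup W] [Module ℝ W] :
    TopologicalSpace (Module.Dual ℝ W) :=
  TopologicalSpace.induced (fun f w => f w) inferInstance

/-- The moment map of `O` is weakly proper: the preimage in `O` of every compact set of strongly
regular elements of `q(O)` is compact. -/
def WeaklyProper {n : ℕ} (O : Set (Module.Dual ℝ (gLie n))) : Prop :=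
  ∀ Ω : Set (Module.Dual ℝ (pLie n)), IsCompact Ω →
    Ω ⊆ (q n '' O) ∩ {μ | IsStronglyRegular μ} → IsCompact {φ : O | q n φ ∈ Ω}

/-! ### The base points -/

/-- The matrix `diag(a₁H', …, a_{n-1}H', 0)`, where `H'` has rows `(0, 1)`, `(-1, 0)`. -/
def skewDiag {n : ℕ} (a : Fin (n - 1) → ℝ) : Matrix (Tr n) (Tr n) ℝ :=
  Matrix.fromBlocks (Matrix.blockDiagonal fun i => a i • !![0, 1; -1, 0]) 0 0 0

theorem skewDiag_transpose {n : ℕ} (a : Fin (n - 1) → ℝ) : (skewDiag a)ᵀ = -skewDiag a := by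
  rw [skewDiag, Matrix.fromBlocks_transpose, Matrix.fromBlocks_neg, Matrix.blockDiagonal_transpose,
    ← Matrix.blockDiagonal_neg]
  simp only [transpose_zero, neg_zero]
  congr 2
  funext i
  ext j k
  fin_cases j <;> fin_cases k <;> simp

/-- The matrix `t'_a = diag(a₁H', …, a_{n-1}H', 0, cH)`, where `H` has rows `(0, 1)`, `(1, 0)`. -/
def tPrime {n : ℕ} (a : Fin (n - 1) → ℝ) (c : ℝ) : gLie n :=
  ⟨blk (skewDiag a) 0 0 0 0 0 c c 0, by
    rw [blk_mem_gLie]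
    exact ⟨skewDiag_transpose a, by simp, rfl, rfl, rfl, rfl⟩⟩

/-- The matrix `diag(I_{2n-2}, -1, -1, 1)`. -/
def gInfMat (n : ℕ) : Mat n :=
  Matrix.diagonal (Sum.elim (Sum.elim (Sum.elim (fun _ => 1) fun _ => -1) fun _ => -1) fun _ => 1)

end SpinMoment

end

open Matrix Polynomial

noncomputable section

namespace SpinMoment

attribute [local instance] LieRing.ofAssociativeRing

/-! Write an element of the orbit as `X = Ad g T`, with `T = tPrime a c` the base point. `P` is the
stabilizer of the line through the null vector `v₀`, so the `P`-class of `X` is the class of the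
null line of `w = g⁻¹ v₀ = (ζ, p, r)` under the centralizer of `T`: rotations in the `n - 1` planes
and boosts in the last plane.

Restriction to `𝔭` forgets exactly `𝔫` (`q_iota_eq_iff`), and `𝔫` consists of the rank-two matrices
built from `v₀` and one further vector (`nX_eq`). Bordering `x - X` by `v₀` and its dual row
therefore gives a determinant `bdet` that ignores `𝔫` and is invariant under simultaneous Lorentz
conjugation of `X` and the border. It can be computed at two places. At `T` with border `w`, the
null condition removes `p` and `r`, and with `t = x²` the result is `∑ mᵢ t ∏_{j≠i} (t + aⱼ²) + m₀ ∏
(t + aⱼ²)`, where `mᵢ = (aᵢ² + c²) |ζᵢ|²` and `m₀ = c² ζ_last²` (`bdet_tPrime`). At the normal form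
`X_{Y,β}` it is `4 |β|² det (x - Y) / x`, that is `4 |β|² ∏ (t + xᵢ²)` (`bdet_gM`,
`exists_normal_form`).

Image: nonnegative weights correspond to interlacing roots. One direction is the intermediate value
theorem and a limit (`exists_interlace`); the other is interpolation at `-aᵢ²` and `0`
(`Interlace.exists_weights`). Given interlacing `x`, the weights give a null vector, hence a point
of the orbit with the prescribed `|β|` and characteristic polynomial of `Y`. Skew matrices with
these data are orthogonally conjugate (`exists_orthogonal_of_charpoly_eq`), and an improper
conjugation is harmless because `sRefl` centralizes `T`. Depth zero means that `v₀` is an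
eigenvector of `X`; the eigenvalue is `c` or `-c`, which gives the two orbits.

Injectivity: equal restrictions give equal weights (`interPoly_unique`), hence the same `|ζᵢ|` and
the same `ζ_last` up to sign. The sign is a Pfaffian-type invariant. If it differed, a Lorentz
matrix of determinant `-1` fixing `v₀` would carry `X` to `X` plus an element of `𝔫`. Up to a
unipotent factor it would then preserve the skew form `J X` bordered by `J v₀`, on a space of even
dimension. This form is nondegenerate when `ζ_last ≠ 0`, and isometries of a symplectic form have
determinant one (`det_eq_one_of_conj_add_nX`). Hence elements with the same restriction are
`P`-conjugate (`exists_ParP_conj`), which also settles the reduced spaces.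

Weak properness: a regular functional has `β ≠ 0` (`add_ne_zero_of_isRegular`). On the orbit `tr X⁴`
is constant, and for fixed restriction it is a quadratic polynomial in the `𝔫`-coordinate with
leading part at least `16 |β|² |δ|²` (`trace_gM_sub_add_pow_four`), so that coordinate is bounded.
The orbit is closed, being cut out by determinants (`isClosed_orbit_tPrime`). Over `q(f)` the fibre
contains a line `T + ℝ ν` with `ν ∈ 𝔫`, so `q` is not proper. -/

/-! ### Lorentz matrices -/

/-- The Lorentz form. -/
def lor {n : ℕ} (v w : Ix n → ℝ) : ℝ := v ⬝ᵥ (Jm n *ᵥ w)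

theorem lor_eq {n : ℕ} (v w : Ix n → ℝ) :
    lor v w = (∑ i : Sp n, v (.inl i) * w (.inl i)) - v (.inr ()) * w (.inr ()) := by
  simp [lor, LieAlgebra.Orthogonal.indefiniteDiagonal, dotProduct, Matrix.mulVec_diagonal,
    sub_eq_add_neg]

theorem lor_comm {n : ℕ} (v w : Ix n → ℝ) : lor v w = lor w v := by
  simp only [lor_eq, mul_comm]

theorem lor_add {n : ℕ} (u v w : Ix n → ℝ) : lor u (v + w) = lor u v + lor u w := by
  simp [lor, Matrix.mulVec_add]

theorem add_lor {n : ℕ} (u v w : Ix n → ℝ) : lor (u + v) w = lor u w + lor v w := by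
  simp [lor]

theorem lor_sub {n : ℕ} (u v w : Ix n → ℝ) : lor u (v - w) = lor u v - lor u w := by
  simp [lor, Matrix.mulVec_sub]

theorem sub_lor {n : ℕ} (u v w : Ix n → ℝ) : lor (u - v) w = lor u w - lor v w := by
  simp [lor]

theorem lor_smul {n : ℕ} (c : ℝ) (u v : Ix n → ℝ) : lor u (c • v) = c * lor u v := by
  simp [lor, Matrix.mulVec_smul]

theorem smul_lor {n : ℕ} (c : ℝ) (u v : Ix n → ℝ) : lor (c • u) v = c * lor u v := by
  simp [lor]

theorem lor_neg {n : ℕ} (u v : Ix n → ℝ) : lor u (-v) = -lor u v := by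
  simp [lor, Matrix.mulVec_neg]

theorem Qf_eq_lor {n : ℕ} (v : Ix n → ℝ) : Qf n v = lor v v := Qf_apply n v

theorem Jm_eq (n : ℕ) :
    Jm n = Matrix.diagonal (Sum.elim (fun _ => (1 : ℝ)) fun _ => (-1 : ℝ)) := rfl

theorem Jm_mul_Jm (n : ℕ) : Jm n * Jm n = 1 := by
  rw [Jm_eq, Matrix.diagonal_mul_diagonal, ← Matrix.diagonal_one]
  congr 1
  funext i
  rcases i with i | i <;> simp

theorem Jm_transpose (n : ℕ) : (Jm n)ᵀ = Jm n := by
  simp [LieAlgebra.Orthogonal.indefiniteDiagonal]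

theorem lor_mulVec {n : ℕ} (k : Mat n) (v w : Ix n → ℝ) :
    lor (k *ᵥ v) w = lor v ((Jm n * kᵀ * Jm n) *ᵥ w) := by
  rw [lor, lor, Matrix.mulVec_mulVec, ← Matrix.mul_assoc, ← Matrix.mul_assoc, Jm_mul_Jm,
    Matrix.one_mul, ← Matrix.mulVec_mulVec, Matrix.dotProduct_mulVec v, Matrix.vecMul_transpose]

/-- Nondegeneracy of the Lorentz form. -/
theorem eq_of_lor {n : ℕ} {v w : Ix n → ℝ} (h : ∀ u, lor u v = lor u w) : v = w := by
  have h1 : Jm n *ᵥ v = Jm n *ᵥ w := by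
    ext i
    simpa [lor] using h (Pi.single i 1)
  have h2 := congrArg (Jm n *ᵥ ·) h1
  simpa [Matrix.mulVec_mulVec, Jm_mul_Jm] using h2

/-- Lorentz matrices. -/
def IsLor {n : ℕ} (k : Mat n) : Prop := kᵀ * Jm n * k = Jm n

namespace IsLor
variable {n : ℕ} {k l : Mat n}

theorem one : IsLor (1 : Mat n) := by simp [IsLor]

theorem mul (hk : IsLor k) (hl : IsLor l) : IsLor (k * l) := by
  unfold IsLor at *
  calc _ = lᵀ * (kᵀ * Jm n * k) * l := by simp only [Matrix.transpose_mul, Matrix.mul_assoc]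
    _ = _ := by rw [hk, hl]

theorem inv_mul (hk : IsLor k) : (Jm n * kᵀ * Jm n) * k = 1 := by
  rw [Matrix.mul_assoc, Matrix.mul_assoc, ← Matrix.mul_assoc kᵀ, hk, Jm_mul_Jm]

theorem mul_inv (hk : IsLor k) : k * (Jm n * kᵀ * Jm n) = 1 := mul_eq_one_comm.1 hk.inv_mul

theorem transpose (hk : IsLor k) : k * Jm n * kᵀ = Jm n := by
  have h := congrArg (· * Jm n) hk.mul_inv
  simp only [Matrix.mul_assoc, Jm_mul_Jm, Matrix.mul_one, Matrix.one_mul] at h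
  rw [Matrix.mul_assoc, h]

theorem inv (hk : IsLor k) : IsLor (Jm n * kᵀ * Jm n) := by
  unfold IsLor
  simp only [Matrix.transpose_mul, Matrix.transpose_transpose, Jm_transpose]
  calc _ = Jm n * (k * (Jm n * Jm n) * Jm n * kᵀ) * Jm n := by simp only [Matrix.mul_assoc]
    _ = Jm n := by rw [Jm_mul_Jm, Matrix.mul_one, hk.transpose, Jm_mul_Jm, Matrix.one_mul]

theorem lor_map (hk : IsLor k) (v w : Ix n → ℝ) : lor (k *ᵥ v) (k *ᵥ w) = lor v w := by
  rw [lor_mulVec, Matrix.mulVec_mulVec, hk.inv_mul, Matrix.one_mulVec]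

theorem of_lor (h : ∀ v w, lor (k *ᵥ v) (k *ᵥ w) = lor v w) : IsLor k := by
  have h1 : (Jm n * kᵀ * Jm n) * k = 1 := by
    refine Matrix.ext_of_mulVec_single fun i => eq_of_lor fun u => ?_
    rw [← Matrix.mulVec_mulVec, ← lor_mulVec, h, Matrix.one_mulVec]
  have h2 := congrArg (Jm n * ·) h1
  simp only [← Matrix.mul_assoc, Jm_mul_Jm, Matrix.mul_one, Matrix.one_mul] at h2
  exact h2

theorem det_sq (hk : IsLor k) : k.det * k.det = 1 := by
  have h := congrArg Matrix.det hk.inv_mul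
  have hJ := congrArg Matrix.det (Jm_mul_Jm n)
  simp only [Matrix.det_mul, Matrix.det_transpose, Matrix.det_one] at h hJ
  linear_combination h - k.det * k.det * hJ

theorem row_zero (hk : IsLor k) : k (.inr ()) (.inr ()) ^ 2 =
    1 + ∑ i : Sp n, k (.inr ()) (.inl i) ^ 2 := by
  have h := congrFun (congrFun hk.transpose (.inr ())) (.inr ())
  rw [Matrix.mul_apply, Fintype.sum_sum_type, Jm_eq] at h
  simp only [Matrix.mul_diagonal, Sum.elim_inl, Sum.elim_inr, Matrix.transpose_apply, mul_one,
    Matrix.diagonal_apply_eq, Finset.univ_unique, Finset.sum_singleton, PUnit.default_eq_unit,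
    ← sq] at h
  linarith

theorem col_zero (hk : IsLor k) : k (.inr ()) (.inr ()) ^ 2 =
    1 + ∑ i : Sp n, k (.inl i) (.inr ()) ^ 2 := by
  have := hk.inv.row_zero
  simpa only [Jm_eq, Matrix.mul_diagonal, Matrix.diagonal_mul, Matrix.transpose_apply,
    Sum.elim_inl, Sum.elim_inr, mul_one, mul_neg, neg_mul, one_mul, neg_neg, neg_sq] using this

/-- By Cauchy–Schwarz the spatial part of the row of `k` and of the column of `l` contributes
strictly less than the product of the time entries. This makes the time orientation multiplicative.
-/
theorem mul_zero_zero (hk : IsLor k) (hl : IsLor l) :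
    0 < (k (.inr ()) (.inr ()) * l (.inr ()) (.inr ())) * (k * l) (.inr ()) (.inr ()) := by
  have h0 : (k * l) (.inr ()) (.inr ()) = ∑ i : Sp n, k (.inr ()) (.inl i) * l (.inl i) (.inr ()) +
      k (.inr ()) (.inr ()) * l (.inr ()) (.inr ()) := by
    rw [Matrix.mul_apply, Fintype.sum_sum_type]
    simp
  rw [h0]
  have h1 := hk.row_zero
  have h2 := hl.col_zero
  have h3 := Finset.sum_mul_sq_le_sq_mul_sq Finset.univ (fun i : Sp n => k (.inr ()) (.inl i))
    (fun i : Sp n => l (.inl i) (.inr ()))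
  have h4 : 0 ≤ ∑ i : Sp n, k (.inr ()) (.inl i) ^ 2 := Finset.sum_nonneg fun i _ => sq_nonneg _
  have h5 : 0 ≤ ∑ i : Sp n, l (.inl i) (.inr ()) ^ 2 := Finset.sum_nonneg fun i _ => sq_nonneg _
  generalize ∑ i : Sp n, k (.inr ()) (.inl i) ^ 2 = A at *
  generalize ∑ i : Sp n, l (.inl i) (.inr ()) ^ 2 = B at *
  generalize ∑ i : Sp n, k (.inr ()) (.inl i) * l (.inl i) (.inr ()) = S at *
  generalize k (.inr ()) (.inr ()) = x at *
  generalize l (.inr ()) (.inr ()) = y at *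
  have h6 : S ^ 2 < (x * y) ^ 2 := by rw [mul_pow, h1, h2]; nlinarith
  have h7 : |S| < |x * y| := sq_lt_sq.1 h6
  have h8 : -(|S| * |x * y|) ≤ S * (x * y) := by rw [← abs_mul]; exact neg_abs_le _
  have h9 : 0 < |x * y| := (abs_nonneg S).trans_lt h7
  have h10 : |x * y| * |x * y| = (x * y) * (x * y) := abs_mul_abs_self _
  nlinarith

end IsLor

/-! ### Reflections -/

/-- The reflection in the hyperplane orthogonal to `u`. -/
def refl {n : ℕ} (u : Ix n → ℝ) : Mat n := 1 - (2 / lor u u) • vecMulVec u (Jm n *ᵥ u)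

theorem refl_mulVec {n : ℕ} (u v : Ix n → ℝ) :
    refl u *ᵥ v = v - (2 / lor u u * lor u v) • u := by
  rw [refl, Matrix.sub_mulVec, Matrix.one_mulVec, Matrix.smul_mulVec, Matrix.vecMulVec_mulVec,
    lor_comm u v]
  congr 1
  ext i
  simp [lor, dotProduct_comm v]
  ring

theorem isLor_refl {n : ℕ} {u : Ix n → ℝ} (hu : lor u u ≠ 0) : IsLor (refl u) := by
  refine IsLor.of_lor fun v w => ?_
  simp only [refl_mulVec, lor_sub, sub_lor, smul_lor, lor_smul, lor_comm v u]
  field_simp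
  ring

theorem refl_mul_self {n : ℕ} {u : Ix n → ℝ} (hu : lor u u ≠ 0) : refl u * refl u = 1 := by
  refine Matrix.ext_of_mulVec_single fun i => ?_
  rw [← Matrix.mulVec_mulVec, refl_mulVec, refl_mulVec, Matrix.one_mulVec]
  simp only [lor_sub, lor_smul]
  rw [sub_sub, ← add_smul]
  have : 2 / lor u u * lor u (Pi.single i 1) + 2 / lor u u * (lor u (Pi.single i 1) -
    2 / lor u u * lor u (Pi.single i 1) * lor u u) = 0 := by
      field_simp
      ring
  rw [this, zero_smul, sub_zero]

theorem det_refl {n : ℕ} {u : Ix n → ℝ} (hu : lor u u ≠ 0) : (refl u).det = -1 := by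
  have h : refl u = 1 + replicateCol Unit (-(2 / lor u u) • u) *
      replicateRow Unit (Jm n *ᵥ u) := by
    rw [refl, sub_eq_add_neg]
    congr 1
    ext i j
    simp [Matrix.mul_apply, vecMulVec_apply]
    ring
  rw [h, Matrix.det_one_add_replicateCol_mul_replicateRow, dotProduct_comm, smul_dotProduct]
  change 1 + -(2 / lor u u) * lor u u = -1
  field_simp
  ring

theorem refl_smul {n : ℕ} {u : Ix n → ℝ} {c : ℝ} (hc : c ≠ 0) : refl (c • u) = refl u := by
  refine Matrix.ext_of_mulVec_single fun i => ?_
  simp only [refl_mulVec, lor_smul, smul_lor, smul_smul]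
  by_cases hu : lor u u = 0
  · simp [hu]
  congr 2
  field_simp

/-- A reflection moves `v` to `w` if both have the same norm. -/
theorem refl_sub {n : ℕ} {v w : Ix n → ℝ} (h : lor v v = lor w w)
    (h' : lor (w - v) (w - v) ≠ 0) : refl (w - v) *ᵥ v = w := by
  rw [refl_mulVec]
  have h1 : lor (w - v) (w - v) = -2 * lor (w - v) v := by
    simp only [lor_sub, sub_lor, lor_comm v w, h]
    ring
  have h2 : 2 / lor (w - v) (w - v) * lor (w - v) v = -1 := by
    rw [h1] at h' ⊢
    have : lor (w - v) v ≠ 0 := fun h0 => h' (by rw [h0, mul_zero])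
    field_simp
  rw [h2]
  simp

theorem refl_of_lor_eq_zero {n : ℕ} {u v : Ix n → ℝ} (h : lor u v = 0) : refl u *ᵥ v = v := by
  rw [refl_mulVec, h]; simp


/-! ### The image of `Spin(2n,1)` in the Lorentz group -/

theorem Qf_polar {n : ℕ} (u v : Ix n → ℝ) : QuadraticMap.polar (Qf n) u v = 2 * lor u v := by
  rw [QuadraticMap.polar, Qf_eq_lor, Qf_eq_lor, Qf_eq_lor, lor_add, add_lor, add_lor, lor_comm v u]
  ring

theorem ι_conj {n : ℕ} (u v : Ix n → ℝ) :
    CliffordAlgebra.ι (Qf n) u * CliffordAlgebra.ι (Qf n) v * CliffordAlgebra.ι (Qf n) u =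
      CliffordAlgebra.ι (Qf n) ((2 * lor u v) • u - lor u u • v) := by
  rw [CliffordAlgebra.ι_mul_ι_mul_ι, Qf_polar, Qf_eq_lor]

theorem ι_sq {n : ℕ} (u : Ix n → ℝ) : CliffordAlgebra.ι (Qf n) u * CliffordAlgebra.ι (Qf n) u =
    algebraMap ℝ _ (lor u u) := by
  rw [CliffordAlgebra.ι_sq_scalar, Qf_eq_lor]

/-- Odd dimension makes `-refl u` a matrix of determinant one, and makes the spectrum of elements of
`𝔤` symmetric with a zero eigenvalue. -/
theorem card_Ix_odd (n : ℕ) : Odd (Fintype.card (Ix n)) := by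
  refine ⟨(n - 1) + 1, ?_⟩
  simp [Fintype.card_sum]
  ring

theorem inv_zero_zero {n : ℕ} (k : Mat n) :
    (Jm n * kᵀ * Jm n) (.inr ()) (.inr ()) = k (.inr ()) (.inr ()) := by
  simp [Jm_eq, Matrix.mul_diagonal, Matrix.diagonal_mul]

/-- A Clifford element `y` of the Lipschitz group acts on vectors by a Lorentz matrix of determinant
one, which preserves the time orientation if and only if the spinor norm `y * star y` is positive. -/
theorem exists_isLor_of_mem_lipschitzGroup {n : ℕ} (y : (CliffordAlgebra (Qf n))ˣ)
    (hy : y ∈ lipschitzGroup (Qf n)) :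
    ∃ k : Mat n, IsLor k ∧ k.det = 1 ∧
      (∀ v, CliffordAlgebra.ι (Qf n) (k *ᵥ v) =
        (y : CliffordAlgebra (Qf n)) * CliffordAlgebra.ι (Qf n) v *
          ((y⁻¹ : (CliffordAlgebra (Qf n))ˣ) : CliffordAlgebra (Qf n))) ∧
      ∃ N : ℝ, (y : CliffordAlgebra (Qf n)) * star (y : CliffordAlgebra (Qf n)) =
          algebraMap ℝ _ N ∧ 0 < N * k (.inr ()) (.inr ()) := by
  induction hy using Subgroup.closure_induction with
  | mem y hy =>
    obtain ⟨u, hu⟩ := hy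
    have hq : lor u u ≠ 0 := by
      intro h0
      have h1 := ι_sq u
      rw [h0, map_zero, hu] at h1
      have : IsUnit (0 : CliffordAlgebra (Qf n)) := h1 ▸ (y.isUnit.mul y.isUnit)
      have hnt : Nontrivial (CliffordAlgebra (Qf n)) :=
        (CliffordAlgebra.equivExterior (Qf n)).toEquiv.nontrivial
      exact not_isUnit_zero this
    have hinv : ((y⁻¹ : (CliffordAlgebra (Qf n))ˣ) : CliffordAlgebra (Qf n)) =
        (lor u u)⁻¹ • (y : CliffordAlgebra (Qf n)) := by
      refine y.inv_eq_of_mul_eq_one_right ?_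
      rw [← hu, mul_smul_comm, ι_sq, Algebra.smul_def, ← map_mul, inv_mul_cancel₀ hq, map_one]
    -- Untwisted conjugation by `ι u` is minus the reflection, and `star (ι u) = -ι u` gives the
    -- spinor norm `-lor u u`. The product whose positivity is needed is then the Euclidean square
    -- norm of `u`.
    refine ⟨-refl u, ?_, ?_, fun v => ?_, -lor u u, ?_, ?_⟩
    · have := isLor_refl hq
      simpa [IsLor] using this
    · rw [Matrix.det_neg, det_refl hq, (card_Ix_odd n).neg_one_pow]
      norm_num
    · rw [hinv, mul_smul_comm, ← hu, ι_conj, ← map_smul, Matrix.neg_mulVec, refl_mulVec]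
      congr 1
      rw [smul_sub, smul_smul, smul_smul, inv_mul_cancel₀ hq, one_smul, neg_sub]
      congr 2
      ring
    · rw [← hu, CliffordAlgebra.star_ι, mul_neg, ι_sq, map_neg]
    · have h1 : (refl u) (.inr ()) (.inr ()) = 1 + 2 / lor u u * (u (.inr ()) * u (.inr ())) := by
        simp [refl, vecMulVec_apply, Jm_eq, Matrix.mulVec_diagonal]
      have h2 : -lor u u * -(refl u) (.inr ()) (.inr ()) =
          lor u u + 2 * (u (.inr ()) * u (.inr ())) := by
        rw [h1]; field_simp
      rw [Matrix.neg_apply, h2]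
      have h3 := lor_eq u u
      have h4 : 0 ≤ ∑ i : Sp n, u (.inl i) * u (.inl i) :=
        Finset.sum_nonneg fun i _ => mul_self_nonneg _
      have h5 : lor u u + 2 * (u (.inr ()) * u (.inr ())) =
        (∑ i : Sp n, u (.inl i) * u (.inl i)) + u (.inr ()) * u (.inr ()) := by rw [h3]; ring
      have h6 := mul_self_nonneg (u (.inr ()))
      rw [h5]
      refine lt_of_le_of_ne (by positivity) fun h7 => hq ?_
      have h8 : ∑ i : Sp n, u (.inl i) * u (.inl i) = 0 := by linarith
      rw [h3]
      linarith
  | one =>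
    refine ⟨1, IsLor.one, Matrix.det_one, fun v => by simp, 1, by simp, by simp⟩
  | mul y z hy hz ihy ihz =>
    obtain ⟨k, hk, hkd, hka, N, hN, hNk⟩ := ihy
    obtain ⟨l, hl, hld, hla, M, hM, hMl⟩ := ihz
    refine ⟨k * l, hk.mul hl, by rw [Matrix.det_mul, hkd, hld, one_mul], fun v => ?_, N * M, ?_, ?_⟩
    · rw [← Matrix.mulVec_mulVec, hka, hla]
      simp only [_root_.mul_inv_rev, Units.val_mul, mul_assoc]
    · calc _ = (y : CliffordAlgebra (Qf n)) * ((z : CliffordAlgebra (Qf n)) *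
            star (z : CliffordAlgebra (Qf n))) * star (y : CliffordAlgebra (Qf n)) := by
            simp only [Units.val_mul, star_mul, mul_assoc]
        _ = _ := by rw [hM, ← Algebra.commutes, mul_assoc, hN, map_mul, ← map_mul, mul_comm M,
                      map_mul]
    · have h1 := hk.mul_zero_zero hl
      have h2 := mul_pos hNk hMl
      have h3 : 0 < (N * M * (k * l) (.inr ()) (.inr ())) *
          (k (.inr ()) (.inr ()) * l (.inr ()) (.inr ())) ^ 2 := by
        nlinarith [mul_pos h1 h2]
      exact pos_of_mul_pos_left h3 (sq_nonneg _)
  | inv y hy ih =>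
    obtain ⟨k, hk, hkd, hka, N, hN, hNk⟩ := ih
    have hN0 : N ≠ 0 := by rintro rfl; simp at hNk
    refine ⟨Jm n * kᵀ * Jm n, hk.inv, ?_, fun v => ?_, N⁻¹, ?_, ?_⟩
    · have h := congrArg Matrix.det hk.inv_mul
      rw [Matrix.det_mul, hkd, mul_one, Matrix.det_one] at h
      exact h
    · rw [inv_inv]
      have h := hka ((Jm n * kᵀ * Jm n) *ᵥ v)
      rw [Matrix.mulVec_mulVec, hk.mul_inv, Matrix.one_mulVec] at h
      rw [h]
      simp only [mul_assoc, Units.inv_mul, mul_one, Units.inv_mul_cancel_left]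
    · have h1 : star (y : CliffordAlgebra (Qf n)) = N •
          ((y⁻¹ : (CliffordAlgebra (Qf n))ˣ) : CliffordAlgebra (Qf n)) := by
        have h2 := congrArg
          (((y⁻¹ : (CliffordAlgebra (Qf n))ˣ) : CliffordAlgebra (Qf n)) * ·) hN
        simp only [← mul_assoc, Units.inv_mul, one_mul] at h2
        rw [h2, Algebra.smul_def, ← Algebra.commutes]
      have h3 : star (y : CliffordAlgebra (Qf n)) *
          star ((y⁻¹ : (CliffordAlgebra (Qf n))ˣ) : CliffordAlgebra (Qf n)) = 1 := by
        rw [← star_mul, Units.inv_mul, star_one]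
      rw [h1, smul_mul_assoc] at h3
      rw [Algebra.algebraMap_eq_smul_one, ← h3, smul_smul, inv_mul_cancel₀ hN0, one_smul]
    · rw [inv_zero_zero]
      have : N⁻¹ * k (.inr ()) (.inr ()) = (N⁻¹) ^ 2 * (N * k (.inr ()) (.inr ())) := by
        field_simp
      rw [this]
      exact mul_pos (sq_pos_of_ne_zero (inv_ne_zero hN0)) hNk

/-- The spinor norm of an element of the spin group is one, so the sign condition of the Lipschitz
group becomes positivity of the time entry. -/
theorem rho_spec {n : ℕ} (x : SpinG n) :
    IsLor (rho n x) ∧ (rho n x).det = 1 ∧ 0 < rho n x (.inr ()) (.inr ()) := by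
  obtain ⟨k, hk, hkd, hka, N, hN, hNk⟩ := exists_isLor_of_mem_lipschitzGroup
    (spinGroup.toUnits x) (spinGroup.units_mem_lipschitzGroup x.2)
  have h1 : rho n x = k := by
    refine Matrix.ext_of_mulVec_single fun i => ι_inj n ?_
    rw [rho_mulVec, ι_vecAct, hka]
    rfl
  have h2 : N = 1 := by
    have h3 : (x : CliffordAlgebra (Qf n)) * star (x : CliffordAlgebra (Qf n)) = 1 :=
      spinGroup.mul_star_self_of_mem x.2
    have h4 : (x : CliffordAlgebra (Qf n)) * star (x : CliffordAlgebra (Qf n)) =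
      algebraMap ℝ _ N := hN
    refine algebraMap_inj' n ?_
    rw [← h4, h3, map_one]
  rw [h1]
  rw [h2, one_mul] at hNk
  exact ⟨hk, hkd, hNk⟩

theorem isLor_rho {n : ℕ} (x : SpinG n) : IsLor (rho n x) := (rho_spec x).1

theorem det_rho {n : ℕ} (x : SpinG n) : (rho n x).det = 1 := (rho_spec x).2.1

theorem rho_zero_zero_pos {n : ℕ} (x : SpinG n) : 0 < rho n x (.inr ()) (.inr ()) :=
  (rho_spec x).2.2

theorem rho_inv_mul {n : ℕ} (x : SpinG n) : rho n x⁻¹ * rho n x = 1 := by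
  rw [← map_mul, inv_mul_cancel, map_one]

theorem rho_mul_inv {n : ℕ} (x : SpinG n) : rho n x * rho n x⁻¹ = 1 := by
  rw [← map_mul, mul_inv_cancel, map_one]

/-- The lift is the Clifford product `u v`: the signs of the two untwisted conjugations cancel, and
`star (u v) = v u` is its inverse because `u² = v² = 1`. -/
theorem exists_rho_eq_refl_mul_refl_of_unit {n : ℕ} {u v : Ix n → ℝ} (hu : lor u u = 1)
    (hv : lor v v = 1) : ∃ x : SpinG n, rho n x = refl u * refl v := by
  have hu' : CliffordAlgebra.ι (Qf n) u * CliffordAlgebra.ι (Qf n) u = 1 := by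
    rw [ι_sq, hu, map_one]
  have hv' : CliffordAlgebra.ι (Qf n) v * CliffordAlgebra.ι (Qf n) v = 1 := by
    rw [ι_sq, hv, map_one]
  let U : (CliffordAlgebra (Qf n))ˣ := ⟨_, _, hu', hu'⟩
  let V : (CliffordAlgebra (Qf n))ˣ := ⟨_, _, hv', hv'⟩
  have hmem : CliffordAlgebra.ι (Qf n) u * CliffordAlgebra.ι (Qf n) v ∈ spinGroup (Qf n) := by
    refine ⟨?_, CliffordAlgebra.ι_mul_ι_mem_evenOdd_zero (Qf n) u v⟩
    change ((U * V : (CliffordAlgebra (Qf n))ˣ) : CliffordAlgebra (Qf n)) ∈ pinGroup (Qf n)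
    rw [pinGroup.units_mem_iff]
    refine ⟨mul_mem (Subgroup.subset_closure ⟨u, rfl⟩) (Subgroup.subset_closure ⟨v, rfl⟩), ?_⟩
    change CliffordAlgebra.ι (Qf n) u * CliffordAlgebra.ι (Qf n) v ∈ _
    rw [Unitary.mem_iff, star_mul, CliffordAlgebra.star_ι, CliffordAlgebra.star_ι, neg_mul_neg]
    constructor
    · rw [mul_assoc, ← mul_assoc (CliffordAlgebra.ι (Qf n) u), hu', one_mul, hv']
    · rw [mul_assoc, ← mul_assoc (CliffordAlgebra.ι (Qf n) v), hv', one_mul, hu']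
  refine ⟨⟨_, hmem⟩, Matrix.ext_of_mulVec_single fun i => ι_inj n ?_⟩
  rw [rho_mulVec, ι_vecAct]
  generalize (Pi.single i 1 : Ix n → ℝ) = y
  have hst : (((⟨_, hmem⟩ : SpinG n)⁻¹ : SpinG n) : CliffordAlgebra (Qf n)) =
      CliffordAlgebra.ι (Qf n) v * CliffordAlgebra.ι (Qf n) u := by
    change star (CliffordAlgebra.ι (Qf n) u * CliffordAlgebra.ι (Qf n) v) = _
    rw [star_mul, CliffordAlgebra.star_ι, CliffordAlgebra.star_ι, neg_mul_neg]
  rw [hst]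
  calc _ = CliffordAlgebra.ι (Qf n) u * (CliffordAlgebra.ι (Qf n) v * CliffordAlgebra.ι (Qf n) y *
        CliffordAlgebra.ι (Qf n) v) * CliffordAlgebra.ι (Qf n) u := by simp only [mul_assoc]
    _ = _ := by
      rw [ι_conj, ι_conj, hv, ← Matrix.mulVec_mulVec, refl_mulVec, refl_mulVec, hu, hv]
      congr 1
      simp only [lor_sub, lor_smul]
      module

theorem exists_rho_eq_refl_mul_refl {n : ℕ} {u v : Ix n → ℝ} (hu : 0 < lor u u)
    (hv : 0 < lor v v) : ∃ x : SpinG n, rho n x = refl u * refl v := by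
  have key : ∀ u : Ix n → ℝ, 0 < lor u u → ∃ u', lor u' u' = 1 ∧ refl u' = refl u := by
    intro u hu
    refine ⟨(Real.sqrt (lor u u))⁻¹ • u, ?_, refl_smul (by positivity)⟩
    rw [lor_smul, smul_lor, ← mul_assoc, ← mul_inv, Real.mul_self_sqrt hu.le, inv_mul_cancel₀ hu.ne']
  obtain ⟨u', hu', hu''⟩ := key u hu
  obtain ⟨v', hv', hv''⟩ := key v hv
  rw [← hu'', ← hv'']
  exact exists_rho_eq_refl_mul_refl_of_unit hu' hv'

/-! ### Generation of the time-preserving Lorentz group by spacelike reflections -/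

/-- The products of reflections in spacelike vectors. -/
def reflMonoid (n : ℕ) : Submonoid (Mat n) :=
  Submonoid.closure {k | ∃ u : Ix n → ℝ, 0 < lor u u ∧ k = refl u}

theorem refl_mem {n : ℕ} {u : Ix n → ℝ} (hu : 0 < lor u u) : refl u ∈ reflMonoid n :=
  Submonoid.subset_closure ⟨u, hu, rfl⟩

/-- Reflections are absorbed in pairs, so at most one is left over; the determinant tells later
which case occurs. -/
theorem exists_rho_of_mem_reflMonoid {n : ℕ} {k : Mat n} (hk : k ∈ reflMonoid n) :
    (∃ x, rho n x = k) ∨ ∃ x u, 0 < lor u u ∧ k = rho n x * refl u := by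
  induction hk using Submonoid.closure_induction_right with
  | one => exact Or.inl ⟨1, map_one _⟩
  | mul_right k _ l hl ih =>
    obtain ⟨u, hu, rfl⟩ := hl
    rcases ih with ⟨x, rfl⟩ | ⟨x, v, hv, rfl⟩
    · exact Or.inr ⟨x, u, hu, rfl⟩
    · obtain ⟨y, hy⟩ := exists_rho_eq_refl_mul_refl hv hu
      exact Or.inl ⟨x * y, by rw [map_mul, hy, Matrix.mul_assoc]⟩

theorem lor_single_inr {n : ℕ} (u : Ix n → ℝ) : lor u (Pi.single (.inr ()) 1) = -u (.inr ()) := by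
  simp [lor, Jm_eq]

theorem lor_self_pos {n : ℕ} {u : Ix n → ℝ} (h : u (.inr ()) = 0) (hu : u ≠ 0) : 0 < lor u u := by
  rw [lor_eq, h, mul_zero, sub_zero]
  refine lt_of_le_of_ne (Finset.sum_nonneg fun i _ => mul_self_nonneg _) fun h0 => hu ?_
  have := (Finset.sum_eq_zero_iff_of_nonneg fun i _ => mul_self_nonneg (u (.inl i))).1 h0.symm
  ext i
  rcases i with i | i
  · simpa using this i (Finset.mem_univ _)
  · exact h

/-- Cartan–Dieudonné by induction on the set of spatial basis vectors that may move. The vector `k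
eᵢ - eᵢ` is orthogonal to every other basis vector already fixed, in particular to the time axis; so
it is spacelike and its reflection disturbs none of them. -/
theorem mem_reflMonoid_of_fix {n : ℕ} (S : Finset (Sp n)) : ∀ k : Mat n, IsLor k →
    k *ᵥ Pi.single (.inr ()) 1 = Pi.single (.inr ()) 1 →
    (∀ i ∉ S, k *ᵥ Pi.single (.inl i) 1 = Pi.single (.inl i) 1) → k ∈ reflMonoid n := by
  induction S using Finset.induction_on with
  | empty =>
    intro k _ h0 h
    have : k = 1 := by
      refine Matrix.ext_of_mulVec_single fun i => ?_
      rw [Matrix.one_mulVec]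
      rcases i with i | i
      · exact h i (Finset.notMem_empty i)
      · exact h0
    rw [this]
    exact one_mem _
  | insert i S hi ih =>
    intro k hk h0 h
    by_cases hf : k *ᵥ Pi.single (.inl i) 1 = Pi.single (.inl i) 1
    · refine ih k hk h0 fun j hj => ?_
      by_cases hji : j = i
      · rw [hji, hf]
      · exact h j (by simp [hji, hj])
    set u : Ix n → ℝ := k *ᵥ Pi.single (.inl i) 1 - Pi.single (.inl i) 1 with hu
    have horth : ∀ j : Ix n, j ≠ .inl i → k *ᵥ Pi.single j 1 = Pi.single j 1 →
        lor u (Pi.single j 1) = 0 := by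
      intro j hj hkj
      rw [hu, sub_lor]
      conv_lhs => rw [← hkj]
      rw [hk.lor_map, hkj, sub_self]
    have hu0 : u (.inr ()) = 0 := by
      have := horth (.inr ()) (by simp) h0
      rwa [lor_single_inr, neg_eq_zero] at this
    have hpos : 0 < lor u u := lor_self_pos hu0 (sub_ne_zero.2 hf)
    have hfix : refl u *ᵥ Pi.single (.inl i) 1 = k *ᵥ Pi.single (.inl i) 1 :=
      refl_sub (hk.lor_map _ _).symm hpos.ne'
    have hk' : refl u * k ∈ reflMonoid n := by
      refine ih _ ((isLor_refl hpos.ne').mul hk) ?_ fun j hj => ?_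
      · rw [← Matrix.mulVec_mulVec, h0]
        exact refl_of_lor_eq_zero (horth _ (by simp) h0)
      · by_cases hji : j = i
        · rw [hji, ← Matrix.mulVec_mulVec, ← hfix, Matrix.mulVec_mulVec, refl_mul_self hpos.ne',
            Matrix.one_mulVec]
        · have hkj := h j (by simp [hji, hj])
          rw [← Matrix.mulVec_mulVec, hkj]
          exact refl_of_lor_eq_zero (horth _ (by simpa using hji) hkj)
    have : k = refl u * (refl u * k) := by
      rw [← Matrix.mul_assoc, refl_mul_self hpos.ne', Matrix.one_mul]
    rw [this]
    exact mul_mem (refl_mem hpos) hk'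

/-- Every Lorentz matrix that preserves the time orientation is a product of reflections in spacelike
vectors. -/
theorem IsLor.mem_reflMonoid {n : ℕ} {k : Mat n} (hk : IsLor k) (h : 0 < k (.inr ()) (.inr ())) :
    k ∈ reflMonoid n := by
  by_cases hf : k *ᵥ Pi.single (.inr ()) 1 = Pi.single (.inr ()) 1
  · exact mem_reflMonoid_of_fix Finset.univ k hk hf fun i hi => absurd (Finset.mem_univ i) hi
  set u : Ix n → ℝ := k *ᵥ Pi.single (.inr ()) 1 - Pi.single (.inr ()) 1 with hu
  -- The displacement of the time axis has norm `2 (k₀₀ - 1)`; the column relation gives `k₀₀ ≥ 1`,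
  -- with equality only if the axis is fixed.
  have hpos : 0 < lor u u := by
    have h1 : lor u u = 2 * (k (.inr ()) (.inr ()) - 1) := by
      have h2 : lor (k *ᵥ Pi.single (.inr ()) 1) (Pi.single (.inr ()) 1) =
          -k (.inr ()) (.inr ()) := by rw [lor_single_inr]; simp
      have h3 : lor (Pi.single (.inr ()) 1 : Ix n → ℝ) (Pi.single (.inr ()) 1) = -1 := by
        rw [lor_single_inr]; simp
      rw [hu, lor_sub, sub_lor, sub_lor, hk.lor_map, lor_comm (Pi.single _ _) (k *ᵥ _), h2, h3]
      ring
    have h2 := hk.col_zero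
    have h3 : 0 ≤ ∑ i : Sp n, k (.inl i) (.inr ()) ^ 2 := Finset.sum_nonneg fun i _ => sq_nonneg _
    have h4 : k (.inr ()) (.inr ()) ≠ 1 := by
      intro h5
      refine hf ?_
      have h6 : ∑ i : Sp n, k (.inl i) (.inr ()) ^ 2 = 0 := by rw [h5] at h2; linarith
      have h7 := (Finset.sum_eq_zero_iff_of_nonneg fun i _ => sq_nonneg (k (.inl i) (.inr ()))).1 h6
      ext i
      rcases i with i | i
      · simpa using h7 i (Finset.mem_univ _)
      · simpa using h5
    have h5 : 1 ≤ k (.inr ()) (.inr ()) := by nlinarith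
    have h6 := lt_of_le_of_ne h5 h4.symm
    rw [h1]; linarith
  have hfix : refl u *ᵥ Pi.single (.inr ()) 1 = k *ᵥ Pi.single (.inr ()) 1 :=
    refl_sub (hk.lor_map _ _).symm hpos.ne'
  have hk' : refl u * k ∈ reflMonoid n := by
    refine mem_reflMonoid_of_fix Finset.univ _ ((isLor_refl hpos.ne').mul hk) ?_
      fun i hi => absurd (Finset.mem_univ i) hi
    rw [← Matrix.mulVec_mulVec, ← hfix, Matrix.mulVec_mulVec, refl_mul_self hpos.ne',
      Matrix.one_mulVec]
  have : k = refl u * (refl u * k) := by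
    rw [← Matrix.mul_assoc, refl_mul_self hpos.ne', Matrix.one_mul]
  rw [this]
  exact mul_mem (refl_mem hpos) hk'

/-- `Spin(2n,1)` covers the identity component of the Lorentz group. -/
theorem IsLor.exists_rho {n : ℕ} {k : Mat n} (hk : IsLor k) (h : 0 < k (.inr ()) (.inr ()))
    (hd : k.det = 1) : ∃ x, rho n x = k := by
  rcases exists_rho_of_mem_reflMonoid (hk.mem_reflMonoid h) with hx | ⟨x, u, hu, rfl⟩
  · exact hx
  · rw [Matrix.det_mul, det_rho, det_refl hu.ne'] at hd
    norm_num at hd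

/-! ### The stabilizer of the null line of `P` -/

section blk
variable {n : ℕ} (Y Y' : Matrix (Tr n) (Tr n) ℝ) (u v w z u' v' w' z' : Tr n → ℝ)
  (a b c d a' b' c' d' : ℝ)

theorem blk_transpose : (blk Y u v w z a b c d)ᵀ = blk Yᵀ w z u v a c b d := by
  ext i j
  rcases i with (i | i) | i <;> rcases j with (j | j) | j <;> rfl

theorem Jm_eq_blk : Jm n = blk 1 0 0 0 0 1 0 0 (-1) := by
  rw [Jm_eq]
  ext i j
  rcases i with (i | i) | i <;> rcases j with (j | j) | j <;>
    simp [blk, Matrix.diagonal_apply, Matrix.one_apply]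

theorem blk_trace : (blk Y u v w z a b c d).trace = Y.trace + a + d := by
  simp [Matrix.trace, Fintype.sum_sum_type, blk]

variable {Y Y' u v w z u' v' w' z' a b c d a' b' c' d'}

theorem blk_inj : blk Y u v w z a b c d = blk Y' u' v' w' z' a' b' c' d' ↔
    Y = Y' ∧ u = u' ∧ v = v' ∧ w = w' ∧ z = z' ∧ a = a' ∧ b = b' ∧ c = c' ∧ d = d' := by
  constructor
  · intro h
    have H : ∀ i j, blk Y u v w z a b c d i j = blk Y' u' v' w' z' a' b' c' d' i j :=
      fun i j => by rw [h]
    exact ⟨Matrix.ext fun i j => H (.inl (.inl i)) (.inl (.inl j)),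
      funext fun i => H (.inl (.inl i)) (.inl (.inr ())), funext fun i => H (.inl (.inl i)) (.inr ()),
      funext fun i => H (.inl (.inr ())) (.inl (.inl i)), funext fun i => H (.inr ()) (.inl (.inl i)),
      H (.inl (.inr ())) (.inl (.inr ())), H (.inl (.inr ())) (.inr ()),
      H (.inr ()) (.inl (.inr ())), H (.inr ()) (.inr ())⟩
  · rintro ⟨rfl, rfl, rfl, rfl, rfl, rfl, rfl, rfl, rfl⟩
    rfl

end blk

/-- The vector with coordinates `ξ`, `p`, `r`. -/
def vc {n : ℕ} (ξ : Tr n → ℝ) (p r : ℝ) : Ix n → ℝ := Sum.elim (Sum.elim ξ fun _ => p) fun _ => r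

theorem exists_vc {n : ℕ} (w : Ix n → ℝ) : ∃ ξ p r, w = vc ξ p r :=
  ⟨fun i => w (.inl (.inl i)), w (.inl (.inr ())), w (.inr ()), by
    ext i; rcases i with (i | i) | i <;> rfl⟩

theorem v₀_eq (n : ℕ) : v₀ n = vc 0 1 1 := rfl

theorem vc_inj {n : ℕ} {ξ ξ' : Tr n → ℝ} {p r p' r' : ℝ} :
    vc ξ p r = vc ξ' p' r' ↔ ξ = ξ' ∧ p = p' ∧ r = r' := by
  constructor
  · intro h
    exact ⟨funext fun i => congrFun h (.inl (.inl i)), congrFun h (.inl (.inr ())),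
      congrFun h (.inr ())⟩
  · rintro ⟨rfl, rfl, rfl⟩
    rfl

theorem vc_sub {n : ℕ} (ξ ξ' : Tr n → ℝ) (p r p' r' : ℝ) :
    vc ξ p r - vc ξ' p' r' = vc (ξ - ξ') (p - p') (r - r') := by
  ext i; rcases i with (i | i) | i <;> rfl

theorem smul_vc {n : ℕ} (c : ℝ) (ξ : Tr n → ℝ) (p r : ℝ) :
    c • vc ξ p r = vc (c • ξ) (c * p) (c * r) := by
  ext i; rcases i with (i | i) | i <;> rfl

theorem lor_vc {n : ℕ} (ξ ξ' : Tr n → ℝ) (p r p' r' : ℝ) :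
    lor (vc ξ p r) (vc ξ' p' r') = ξ ⬝ᵥ ξ' + p * p' - r * r' := by
  simp [lor_eq, vc, Fintype.sum_sum_type, dotProduct]

theorem blk_mulVec_vc {n : ℕ} (Y : Matrix (Tr n) (Tr n) ℝ) (u v w z : Tr n → ℝ)
    (a b c d : ℝ) (x : Tr n → ℝ) (s t : ℝ) :
    blk Y u v w z a b c d *ᵥ vc x s t =
      vc (Y *ᵥ x + s • u + t • v) (w ⬝ᵥ x + a * s + b * t) (z ⬝ᵥ x + c * s + d * t) :=
  blk_mulVec Y u v w z a b c d x s t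

/-! ### Factorization of the stabilizer of `v₀` -/

/-- `diag(W, 1, 1)`. -/
def mM {n : ℕ} (W : Matrix (Tr n) (Tr n) ℝ) : Mat n := blk W 0 0 0 0 1 0 0 1

theorem isLor_mM {n : ℕ} {W : Matrix (Tr n) (Tr n) ℝ} (hW : Wᵀ * W = 1) : IsLor (mM W) := by
  rw [IsLor, mM, blk_transpose, Jm_eq_blk, blk_mul, blk_mul, blk_inj]
  simp [hW]

theorem isLor_aMat {n : ℕ} (t : ℝ) : IsLor (aMat t : Mat n) := by
  have := Real.cosh_sq t
  rw [IsLor, aMat, blk_transpose, Jm_eq_blk, blk_mul, blk_mul, blk_inj]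
  simp
  refine ⟨by linarith, by ring, by ring, by linarith⟩

theorem isLor_nMat {n : ℕ} (α : Tr n → ℝ) : IsLor (nMat α : Mat n) := by
  rw [IsLor, nMat, blk_transpose, Jm_eq_blk, blk_mul, blk_mul, blk_inj]
  simp
  refine ⟨?_, ?_, ?_, ?_, ?_, ?_, ?_, ?_⟩
  all_goals first | module | ring

theorem nMat_neg_mul {n : ℕ} (α : Tr n → ℝ) : (nMat (-α) : Mat n) * nMat α = 1 := by
  rw [nMat_mul, neg_add_cancel]; simp [nMat, ← blk_one]

theorem nMat_mul_neg {n : ℕ} (α : Tr n → ℝ) : (nMat α : Mat n) * nMat (-α) = 1 :=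
  mul_eq_one_comm.1 (nMat_neg_mul α)

/-- The matrix is the square of a Lorentz matrix, whose determinant is `±1`. -/
theorem det_nMat {n : ℕ} (α : Tr n → ℝ) : (nMat α : Mat n).det = 1 := by
  have h : (nMat α : Mat n) = nMat ((1 / 2 : ℝ) • α) * nMat ((1 / 2 : ℝ) • α) := by
    rw [nMat_mul, ← add_smul]; norm_num
  rw [h, Matrix.det_mul, (isLor_nMat _).det_sq]

theorem det_aMat {n : ℕ} (t : ℝ) : (aMat t : Mat n).det = 1 := by
  have h : (aMat t : Mat n) = aMat (t / 2) * aMat (t / 2) := by rw [aMat_mul, add_halves]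
  rw [h, Matrix.det_mul, (isLor_aMat _).det_sq]

theorem mM_eq {n : ℕ} (W : Matrix (Tr n) (Tr n) ℝ) : mM W =
    Matrix.fromBlocks (Matrix.fromBlocks W 0 0 1) 0 0 1 := by
  ext i j
  rcases i with (i | i) | i <;> rcases j with (j | j) | j <;> simp [mM, blk]

theorem det_mM {n : ℕ} (W : Matrix (Tr n) (Tr n) ℝ) : (mM W).det = W.det := by
  rw [mM_eq, Matrix.det_fromBlocks_zero₂₁, Matrix.det_fromBlocks_zero₂₁]
  simp

theorem aMat_mulVec_v₀ {n : ℕ} (t : ℝ) : (aMat t : Mat n) *ᵥ v₀ n = Real.exp t • v₀ n := by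
  rw [aMat, v₀_eq, blk_mulVec_vc, smul_vc, vc_inj, ← Real.cosh_add_sinh]
  simp [add_comm]

theorem nMat_mulVec_v₀ {n : ℕ} (α : Tr n → ℝ) : (nMat α : Mat n) *ᵥ v₀ n = v₀ n := by
  rw [nMat, v₀_eq, blk_mulVec_vc, vc_inj]
  simp

theorem nMat_mM {n : ℕ} (α : Tr n → ℝ) {W : Matrix (Tr n) (Tr n) ℝ} (hW : Wᵀ * W = 1) :
    nMat α * mM W = mM W * nMat (α ᵥ* W) := by
  have hW : W * Wᵀ = 1 := mul_eq_one_comm.1 hW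
  have h1 : W *ᵥ (α ᵥ* W) = α := by
    rw [← Matrix.vecMul_transpose, Matrix.vecMul_vecMul, hW, Matrix.vecMul_one]
  have h2 : (α ᵥ* W) ⬝ᵥ (α ᵥ* W) = α ⬝ᵥ α := by rw [← Matrix.dotProduct_mulVec, h1]
  simp only [nMat, mM, blk_mul]
  congr 1 <;> simp [h1, h2, Matrix.mulVec_neg]

/-- A Lorentz matrix fixing `v₀` lies in `O(2n-1) N`. -/
theorem IsLor.eq_mM_mul_nMat {n : ℕ} {k : Mat n} (hk : IsLor k) (h : k *ᵥ v₀ n = v₀ n) :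
    ∃ (W : Matrix (Tr n) (Tr n) ℝ) (α : Tr n → ℝ), Wᵀ * W = 1 ∧ k = mM W * nMat α := by
  -- The factor in `N` is read off from the image of the opposite null vector `(0, 1, -1)`: that
  -- image is null and pairs with `v₀` to `2`, and `N` reaches every such vector. After its removal
  -- both null vectors are fixed and only a transversal block is left.
  obtain ⟨ξ, p, r, hw⟩ := exists_vc (k *ᵥ vc 0 1 (-1))
  have h1 : ξ ⬝ᵥ ξ + p * p - r * r = 0 := by
    have := hk.lor_map (vc 0 1 (-1)) (vc 0 1 (-1))
    rw [hw, lor_vc, lor_vc] at this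
    simpa using this
  have h2 : p - r = 2 := by
    have := hk.lor_map (vc 0 1 (-1)) (v₀ n)
    rw [hw, h, v₀_eq, lor_vc, lor_vc] at this
    simp at this
    linarith
  have hr : r = p - 2 := by linarith
  obtain ⟨α, rfl⟩ : ∃ α, ξ = -(2 : ℝ) • α := ⟨-(1 / 2 : ℝ) • ξ, by rw [smul_smul]; norm_num⟩
  have hp : p = 1 - α ⬝ᵥ α := by
    rw [hr] at h1
    simp only [smul_dotProduct, dotProduct_smul, smul_eq_mul] at h1
    linarith
  have hn : (nMat α : Mat n) *ᵥ vc 0 1 (-1) = k *ᵥ vc 0 1 (-1) := by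
    rw [hw, nMat, blk_mulVec_vc, vc_inj, hr, hp]
    refine ⟨?_, ?_, ?_⟩
    · simp only [mulVec_zero]; module
    · rw [dotProduct_zero]; ring
    · rw [dotProduct_zero]; ring
  set k' : Mat n := nMat (-α) * k with hk'
  have hkk : k = nMat α * k' := by rw [hk', ← Matrix.mul_assoc, nMat_mul_neg, Matrix.one_mul]
  have hkL : IsLor k' := (isLor_nMat _).mul hk
  have e1 : k' *ᵥ vc 0 1 1 = vc 0 1 1 := by
    rw [hk', ← Matrix.mulVec_mulVec, ← v₀_eq, h, nMat_mulVec_v₀]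
  have e2 : k' *ᵥ vc 0 1 (-1) = vc 0 1 (-1) := by
    rw [hk', ← Matrix.mulVec_mulVec, ← hn, Matrix.mulVec_mulVec, nMat_neg_mul, Matrix.one_mulVec]
  obtain ⟨W, u, v, w, z, a, b, c, d, hX⟩ := exists_blk k'
  have e3 : ∀ x, lor (vc (W *ᵥ x) (w ⬝ᵥ x) (z ⬝ᵥ x)) (vc 0 1 1) = 0 ∧
      lor (vc (W *ᵥ x) (w ⬝ᵥ x) (z ⬝ᵥ x)) (vc 0 1 (-1)) = 0 := by
    intro x
    have e4 : k' *ᵥ vc x 0 0 = vc (W *ᵥ x) (w ⬝ᵥ x) (z ⬝ᵥ x) := by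
      rw [hX, blk_mulVec_vc, vc_inj]; simp
    constructor
    · have := hkL.lor_map (vc x 0 0) (vc 0 1 1)
      rw [e1, e4] at this
      rw [this, lor_vc]; simp
    · have := hkL.lor_map (vc x 0 0) (vc 0 1 (-1))
      rw [e2, e4] at this
      rw [this, lor_vc]; simp
  have hwz : w = 0 ∧ z = 0 := by
    have e5 : ∀ x, w ⬝ᵥ x = 0 ∧ z ⬝ᵥ x = 0 := by
      intro x
      obtain ⟨h3, h4⟩ := e3 x
      rw [lor_vc] at h3 h4
      simp at h3 h4
      constructor <;> linarith
    exact ⟨dotProduct_eq_zero _ fun x => (e5 x).1, dotProduct_eq_zero _ fun x => (e5 x).2⟩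
  obtain ⟨rfl, rfl⟩ := hwz
  rw [hX, blk_mulVec_vc, vc_inj] at e1 e2
  simp at e1 e2
  obtain ⟨f1, f2, f3⟩ := e1
  obtain ⟨g1, g2, g3⟩ := e2
  have hu : u = 0 := by
    ext i
    have h3 := congrFun f1 i
    have h4 := congrFun g1 i
    simp at h3 h4 ⊢
    linarith
  have hv : v = 0 := by rw [hu] at f1; simpa using f1
  have ha : a = 1 := by linarith
  have hb : b = 0 := by linarith
  have hc : c = 0 := by linarith
  have hd : d = 1 := by linarith
  subst hu hv ha hb hc hd
  have hW : Wᵀ * W = 1 := by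
    have := hkL
    rw [hX, IsLor, blk_transpose, Jm_eq_blk, blk_mul, blk_mul, blk_inj] at this
    simpa using this.1
  refine ⟨W, α ᵥ* W, hW, ?_⟩
  rw [hkk, hX, ← nMat_mM α hW, mM]

/-- The time orientation forces `κ > 0`, so a boost with parameter `log κ` reduces to a matrix that
fixes `v₀`; the determinant then puts the transversal block in the special orthogonal group. -/
theorem mem_ParP_of_mulVec_v₀ {n : ℕ} {x : SpinG n} {κ : ℝ} (h : rho n x *ᵥ v₀ n = κ • v₀ n) :
    x ∈ ParP n := by
  have hκ : 0 < κ := by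
    have h1 : κ = rho n x (.inr ()) (.inl (.inr ())) + rho n x (.inr ()) (.inr ()) := by
      have := congrFun h (.inr ())
      simpa [v₀, Matrix.mulVec, dotProduct, Fintype.sum_sum_type] using this.symm
    have h2 := (isLor_rho x).row_zero
    have h3 : rho n x (.inr ()) (.inl (.inr ())) ^ 2 ≤
        ∑ i : Sp n, rho n x (.inr ()) (.inl i) ^ 2 :=
      Finset.single_le_sum (f := fun i : Sp n => rho n x (.inr ()) (.inl i) ^ 2)
        (fun i _ => sq_nonneg _) (Finset.mem_univ _)
    have h4 := rho_zero_zero_pos x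
    rw [h1]
    nlinarith
  have h1 : (aMat (-Real.log κ) * rho n x) *ᵥ v₀ n = v₀ n := by
    rw [← Matrix.mulVec_mulVec, h, Matrix.mulVec_smul, aMat_mulVec_v₀, smul_smul, Real.exp_neg,
      Real.exp_log hκ, mul_inv_cancel₀ hκ.ne', one_smul]
  obtain ⟨W, α, hW, hk⟩ := ((isLor_aMat _).mul (isLor_rho x)).eq_mM_mul_nMat h1
  have hd : W.det = 1 := by
    have := congrArg Matrix.det hk
    rw [Matrix.det_mul, Matrix.det_mul, det_aMat, det_rho, det_nMat, det_mM] at this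
    linarith
  have hx : rho n x = aMat (Real.log κ) * (aMat (-Real.log κ) * rho n x) := by
    rw [← Matrix.mul_assoc, aMat_mul, add_neg_cancel]
    simp [aMat, ← blk_one]
  let W' : Matrix.specialOrthogonalGroup (Tr n) ℝ := ⟨W, by
    rw [Matrix.mem_specialOrthogonalGroup_iff, Matrix.mem_orthogonalGroup_iff']
    exact ⟨hW, hd⟩⟩
  refine ⟨W', Real.log κ, α, ?_⟩
  rw [← aMat_mMat, hx, hk, Matrix.mul_assoc]
  rfl

theorem exists_mem_ParP_of_mulVec_v₀ {n : ℕ} {k : Mat n} (hk : IsLor k) (hd : k.det = 1)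
    (h : k *ᵥ v₀ n = v₀ n) : ∃ x : ParP n, rho n x = k := by
  have h00 : 0 < k (.inr ()) (.inr ()) := by
    have h1 : 1 = k (.inr ()) (.inl (.inr ())) + k (.inr ()) (.inr ()) := by
      have := congrFun h (.inr ())
      simpa [v₀, Matrix.mulVec, dotProduct, Fintype.sum_sum_type] using this.symm
    have h2 := hk.row_zero
    have h3 : k (.inr ()) (.inl (.inr ())) ^ 2 ≤ ∑ i : Sp n, k (.inr ()) (.inl i) ^ 2 :=
      Finset.single_le_sum (f := fun i : Sp n => k (.inr ()) (.inl i) ^ 2)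
        (fun i _ => sq_nonneg _) (Finset.mem_univ _)
    nlinarith
  obtain ⟨x, hx⟩ := hk.exists_rho h00 hd
  exact ⟨⟨x, mem_ParP_of_mulVec_v₀ (κ := 1) (by rw [hx, h, one_smul])⟩, hx⟩

/-! ### Transitivity on the light cone -/

/-- The vector of the last coordinate of `ℝ^{2n-1}`. -/
def eLast (n : ℕ) : Tr n → ℝ := Pi.single (.inr ()) 1

theorem lor_eLast (n : ℕ) : lor (vc (eLast n) 0 0) (vc (eLast n) 0 0) = 1 := by
  rw [lor_vc]; simp [eLast]

/-- `Spin(2n,1)` acts transitively on the future light cone. -/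
theorem exists_rho_mulVec_v₀ {n : ℕ} {w : Ix n → ℝ} (hw : lor w w = 0) (hw0 : 0 < w (.inr ())) :
    ∃ g, rho n g *ᵥ v₀ n = w := by
  obtain ⟨ξ, p, r, rfl⟩ := exists_vc w
  replace hw0 : 0 < r := hw0
  have h1 := hw
  rw [lor_vc] at h1
  have h2 : 0 ≤ ξ ⬝ᵥ ξ := Finset.sum_nonneg fun i _ => mul_self_nonneg _
  -- If `p = r`, the vector is a positive multiple of `v₀` and a boost suffices. Otherwise its
  -- difference with `v₀` is spacelike.
  by_cases hpr : p = r
  · have h3 : ξ = 0 := dotProduct_self_eq_zero.1 (by rw [hpr] at h1; linarith)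
    have hk : IsLor (aMat (Real.log r) : Mat n) := isLor_aMat _
    obtain ⟨g, hg⟩ := hk.exists_rho (by simp [aMat, blk]; positivity) (det_aMat _)
    refine ⟨g, ?_⟩
    rw [hg, aMat_mulVec_v₀, Real.exp_log hw0, v₀_eq, smul_vc, h3, hpr]
    simp
  · have h3 : p < r := by
      refine lt_of_le_of_ne ?_ hpr
      nlinarith
    have h4 : 0 < lor (vc ξ p r - v₀ n) (vc ξ p r - v₀ n) := by
      rw [v₀_eq, vc_sub, lor_vc]
      simp
      linarith
    have h5 : refl (vc ξ p r - v₀ n) *ᵥ v₀ n = vc ξ p r := by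
      refine refl_sub ?_ h4.ne'
      rw [hw, v₀_eq, lor_vc]; simp
    -- The second reflection fixes `v₀`; it only makes the number of reflections even.
    obtain ⟨g, hg⟩ := exists_rho_eq_refl_mul_refl h4 (v := vc (eLast n) 0 0)
      (by rw [lor_eLast]; norm_num)
    refine ⟨g, ?_⟩
    rw [hg, ← Matrix.mulVec_mulVec, refl_of_lor_eq_zero (v := v₀ n), h5]
    rw [v₀_eq, lor_vc]; simp

/-! ### The moment map in coordinates -/

/-- The general element of `𝔤`. -/
def gM {n : ℕ} (Y : Matrix (Tr n) (Tr n) ℝ) (u v : Tr n → ℝ) (b : ℝ) : Mat n :=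
  blk Y u v (-u) v 0 b b 0

/-- The general element of `𝔫`. -/
def nX {n : ℕ} (γ : Tr n → ℝ) : Mat n := blk 0 (-γ) γ γ γ 0 0 0 0

theorem gM_mem {n : ℕ} {Y : Matrix (Tr n) (Tr n) ℝ} (hY : Yᵀ = -Y) (u v : Tr n → ℝ) (b : ℝ) :
    gM Y u v b ∈ gLie n := by
  rw [gM, blk_mem_gLie]
  exact ⟨hY, rfl, rfl, rfl, rfl, rfl⟩

theorem exists_gM {n : ℕ} (X : gLie n) : ∃ (Y : Matrix (Tr n) (Tr n) ℝ) (u v : Tr n → ℝ) (b : ℝ),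
    Yᵀ = -Y ∧ (X : Mat n) = gM Y u v b := by
  obtain ⟨Y, u, v, w, z, a, b, c', d, hX⟩ := exists_blk (X : Mat n)
  obtain ⟨hY, rfl, rfl, rfl, rfl, rfl⟩ := (blk_mem_gLie _ _ _ _ _ _ _ _ _).1 (hX ▸ X.2)
  exact ⟨Y, u, z, c', hY, hX⟩

theorem gM_add_nX {n : ℕ} (Y : Matrix (Tr n) (Tr n) ℝ) (u v γ : Tr n → ℝ) (b : ℝ) :
    gM Y u v b + nX γ = gM Y (u - γ) (v + γ) b := by
  rw [gM, nX, gM, blk_add, blk_inj]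
  simp [sub_eq_add_neg, add_comm]

theorem gM_inj {n : ℕ} {Y Y' : Matrix (Tr n) (Tr n) ℝ} {u v u' v' : Tr n → ℝ} {b b' : ℝ} :
    gM Y u v b = gM Y' u' v' b' ↔ Y = Y' ∧ u = u' ∧ v = v' ∧ b = b' := by
  rw [gM, gM, blk_inj]
  constructor
  · rintro ⟨h1, h2, h3, -, -, -, h4, -⟩
    exact ⟨h1, h2, h3, h4⟩
  · rintro ⟨rfl, rfl, rfl, rfl⟩
    simp

theorem gM_mulVec_v₀ {n : ℕ} (Y : Matrix (Tr n) (Tr n) ℝ) (u v : Tr n → ℝ) (b : ℝ) :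
    gM Y u v b *ᵥ v₀ n = vc (u + v) b b := by
  rw [gM, v₀_eq, blk_mulVec_vc, vc_inj]
  simp

/-- The general element of `𝔭`. -/
def pElt {n : ℕ} (Y : Matrix (Tr n) (Tr n) ℝ) (hY : Yᵀ = -Y) (α : Tr n → ℝ) (a : ℝ) : pLie n :=
  ⟨⟨blk Y (-α) α α α 0 a a 0, by rw [blk_mem_gLie]; simp [hY]⟩, ⟨Y, α, a, rfl⟩⟩

theorem exists_pElt {n : ℕ} (Z : pLie n) : ∃ (Y : Matrix (Tr n) (Tr n) ℝ) (hY : Yᵀ = -Y)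
    (α : Tr n → ℝ) (a : ℝ), Z = pElt Y hY α a := by
  obtain ⟨Y, α, a, h⟩ := Z.2
  have hY := ((blk_mem_gLie _ _ _ _ _ _ _ _ _).1 (h ▸ Z.1.2)).1
  exact ⟨Y, hY, α, a, Subtype.ext (Subtype.ext h)⟩

theorem pElt_mem_nLie {n : ℕ} {Y : Matrix (Tr n) (Tr n) ℝ} {hY : Yᵀ = -Y} {α : Tr n → ℝ} {a : ℝ} :
    pElt Y hY α a ∈ nLie n ↔ Y = 0 ∧ a = 0 := by
  constructor
  · rintro ⟨α', h⟩
    have h' := blk_inj.1 h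
    exact ⟨h'.1, h'.2.2.2.2.2.2.1⟩
  · rintro ⟨rfl, rfl⟩
    exact ⟨α, rfl⟩

/-- Only `Y`, `u + v` and `b` survive restriction. The lost coordinate `v - u` is the direction of
`𝔫`. -/
theorem q_iota_pElt {n : ℕ} {X : gLie n} {Y : Matrix (Tr n) (Tr n) ℝ} {u v : Tr n → ℝ} {b : ℝ}
    (hX : (X : Mat n) = gM Y u v b) (Y' : Matrix (Tr n) (Tr n) ℝ) (hY' : Y'ᵀ = -Y') (α : Tr n → ℝ)
    (a : ℝ) : q n (iota X) (pElt Y' hY' α a) =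
      (1 / 2) * (Y * Y').trace + (u + v) ⬝ᵥ α + b * a := by
  change (1 / 2) * ((X : Mat n) * blk Y' (-α) α α α 0 a a 0).trace = _
  rw [hX, gM, blk_mul, blk_trace]
  simp [Matrix.trace_add, Matrix.trace_vecMulVec]
  ring

theorem eq_zero_of_trace_mul_skew {n : ℕ} {Y : Matrix (Tr n) (Tr n) ℝ} (hY : Yᵀ = -Y)
    (h : (Y * Y).trace = 0) : Y = 0 := by
  have h1 : (Yᵀ * Y).trace = 0 := by rw [hY, Matrix.neg_mul, Matrix.trace_neg, h, neg_zero]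
  have h2 : (Yᴴ * Y).trace = 0 := by rwa [Matrix.conjTranspose_eq_transpose_of_trivial]
  exact Matrix.trace_conjTranspose_mul_self_eq_zero_iff.1 h2

/-- Two elements of `𝔤` have the same image in `𝔭*` if and only if they differ by an element of
`𝔫`. -/
theorem q_iota_eq_iff {n : ℕ} (X X' : gLie n) :
    q n (iota X) = q n (iota X') ↔ ∃ γ, (X' : Mat n) = (X : Mat n) + nX γ := by
  obtain ⟨Y, u, v, b, hY, hX⟩ := exists_gM X
  obtain ⟨Y', u', v', b', hY', hX'⟩ := exists_gM X'
  constructor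
  · intro h
    have H : ∀ (Z : Matrix (Tr n) (Tr n) ℝ) (_ : Zᵀ = -Z) (α : Tr n → ℝ) (a : ℝ), (1 / 2) * (Y * Z).trace + (u + v) ⬝ᵥ α + b * a =
        (1 / 2) * (Y' * Z).trace + (u' + v') ⬝ᵥ α + b' * a := by
      intro Z hZ α a
      exact (q_iota_pElt hX Z hZ α a).symm.trans
        ((LinearMap.congr_fun h _).trans (q_iota_pElt hX' Z hZ α a))
    have hb : b = b' := by simpa using H 0 (by simp) 0 1
    have huv : u + v = u' + v' := by
      have : ∀ α, (u + v - (u' + v')) ⬝ᵥ α = 0 := by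
        intro α
        have := H 0 (by simp) α 0
        rw [sub_dotProduct]
        simp at this
        simp only [add_dotProduct]
        linarith
      exact sub_eq_zero.1 (dotProduct_eq_zero _ this)
    have hYY : Y = Y' := by
      -- The difference is itself an admissible test matrix; tested on it, equality says `tr (Y -
      -- Y')² = 0`, and the trace form is definite on skew matrices.
      have hs : (Y - Y')ᵀ = -(Y - Y') := by rw [Matrix.transpose_sub, hY, hY']; abel
      have h1 := H (Y - Y') hs 0 0
      refine sub_eq_zero.1 (eq_zero_of_trace_mul_skew hs ?_)
      rw [Matrix.sub_mul, Matrix.trace_sub]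
      simp only [dotProduct_zero, mul_zero] at h1
      linarith
    refine ⟨v' - v, ?_⟩
    rw [hX, hX', gM_add_nX, gM_inj]
    refine ⟨hYY.symm, ?_, by abel, hb.symm⟩
    rw [sub_sub_eq_add_sub, huv, add_sub_cancel_right]
  · rintro ⟨γ, h⟩
    rw [hX, gM_add_nX] at h
    refine LinearMap.ext fun Z => ?_
    obtain ⟨Z, hZ, α, a, rfl⟩ := exists_pElt Z
    rw [q_iota_pElt hX, q_iota_pElt h]
    simp

theorem coad_iota {n : ℕ} (g : SpinG n) (X : gLie n) : coad n g (iota X) = iota (Ad n g X) := by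
  refine LinearMap.ext fun Z => ?_
  change (1 / 2) * ((X : Mat n) * (rho n g⁻¹ * (Z : Mat n) * rho n g⁻¹⁻¹)).trace =
    (1 / 2) * ((rho n g * (X : Mat n) * rho n g⁻¹) * (Z : Mat n)).trace
  rw [inv_inv, ← Matrix.mul_assoc, Matrix.trace_mul_comm]
  simp only [Matrix.mul_assoc]

theorem Ad_coe {n : ℕ} (g : SpinG n) (X : gLie n) :
    ((Ad n g X : gLie n) : Mat n) = rho n g * (X : Mat n) * rho n g⁻¹ := rfl

theorem coadGP_iota {n : ℕ} (x : ParP n) (X : gLie n) :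
    coadGP n x (iota X) = iota (Ad n x X) := by
  rw [← coad_iota]
  rfl

/-! ### Orbits and depth -/

section orbit
variable {H V : Type*} [Group H] [AddCommGroup V] [Module ℝ V] (ρ : Representation ℝ H V)

theorem mem_orbit_self (v : V) : v ∈ orbit ρ v := ⟨1, by simp⟩

theorem orbit_eq_of_mem {v w : V} (h : w ∈ orbit ρ v) : orbit ρ w = orbit ρ v := by
  obtain ⟨x, rfl⟩ := h
  ext y
  constructor
  · rintro ⟨z, rfl⟩
    exact ⟨z * x, by simp⟩
  · rintro ⟨z, rfl⟩
    exact ⟨z * x⁻¹, by simp⟩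

end orbit

theorem mem_orbit_iota {n : ℕ} {T : gLie n} {φ : Module.Dual ℝ (gLie n)} :
    φ ∈ orbit (coad n) (iota T) ↔ ∃ g : SpinG n, φ = iota (Ad n g T) := by
  constructor
  · rintro ⟨g, rfl⟩
    exact ⟨g, coad_iota g T⟩
  · rintro ⟨g, rfl⟩
    exact ⟨g, coad_iota g T⟩

/-- The pairing with `𝔫` is through `u + v`, which is also the transversal component of `X v₀`. -/
theorem q_iota_mem_lStar_iff {n : ℕ} {X : gLie n} :
    q n (iota X) ∈ lStar n ↔ ∃ b : ℝ, (X : Mat n) *ᵥ v₀ n = b • v₀ n := by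
  obtain ⟨Y, u, v, b, hY, hX⟩ := exists_gM X
  have h1 : (∃ b : ℝ, (X : Mat n) *ᵥ v₀ n = b • v₀ n) ↔ u + v = 0 := by
    rw [hX, gM_mulVec_v₀, v₀_eq]
    constructor
    · rintro ⟨b', h⟩
      rw [smul_vc, vc_inj] at h
      simpa using h.1
    · intro h
      refine ⟨b, ?_⟩
      rw [smul_vc, vc_inj]
      simp [h]
  rw [h1, lStar, Submodule.mem_dualAnnihilator]
  constructor
  · intro h
    refine dotProduct_eq_zero _ fun α => ?_
    have := (q_iota_pElt hX 0 (by simp) α 0).symm.trans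
      (h (pElt 0 (by simp) α 0) (pElt_mem_nLie.2 ⟨rfl, rfl⟩))
    simpa using this
  · intro h Z hZ
    obtain ⟨Z, hZ', α, a, rfl⟩ := exists_pElt Z
    obtain ⟨rfl, rfl⟩ := pElt_mem_nLie.1 hZ
    refine (q_iota_pElt hX _ _ _ _).trans ?_
    rw [h]
    simp

/-- `P` preserves the line of `v₀`, so the eigenvector condition at one point of the orbit holds at
all of them. -/
theorem depthZero_iff {n : ℕ} {X : gLie n} :
    DepthZero (orbit (coadP n) (q n (iota X))) ↔ ∃ b : ℝ, (X : Mat n) *ᵥ v₀ n = b • v₀ n := by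
  constructor
  · intro h
    exact q_iota_mem_lStar_iff.1 (h (mem_orbit_self _ _))
  · rintro ⟨b, h⟩ _ ⟨x, rfl⟩
    change coadP n x (q n (iota X)) ∈ lStar n
    rw [← q_equivariant, coadGP_iota, q_iota_mem_lStar_iff, Ad_coe]
    obtain ⟨d, hd⟩ := rho_v₀ x
    obtain ⟨e, he⟩ := rho_v₀ x⁻¹
    refine ⟨e * b * d, ?_⟩
    change (rho n x * (X : Mat n) * rho n ((x⁻¹ : ParP n) : SpinG n)) *ᵥ v₀ n = _
    rw [← Matrix.mulVec_mulVec, he, Matrix.mulVec_smul, ← Matrix.mulVec_mulVec, h,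
      Matrix.mulVec_smul, hd, smul_smul, smul_smul]

/-- The action of `N` on `𝔤 / 𝔫`. -/
theorem nMat_conj_gM {n : ℕ} (α : Tr n → ℝ) {Y : Matrix (Tr n) (Tr n) ℝ} (hY : Yᵀ = -Y)
    (u v : Tr n → ℝ) (b : ℝ) :
    ∃ γ, nMat α * gM Y u v b * nMat (-α) =
      gM (Y + vecMulVec α (u + v) - vecMulVec (u + v) α) ((1 / 2 : ℝ) • (u + v))
        ((1 / 2 : ℝ) • (u + v)) (b + α ⬝ᵥ (u + v)) + nX γ := by
  -- Lifting `nMat α` to the group shows that the conjugate is again in `𝔤`. Since `N` fixes `v₀`,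
  -- its components `u' + v'` and `b'` can then be read from the image of `v₀`, and only the
  -- transversal block needs the full product.
  obtain ⟨x, hx⟩ := exists_mem_ParP_of_mulVec_v₀ (isLor_nMat α) (det_nMat α) (nMat_mulVec_v₀ α)
  have hx' : rho n (x : SpinG n)⁻¹ = nMat (-α) := by
    refine left_inv_eq_right_inv (rho_inv_mul _) ?_
    rw [hx, nMat_mul_neg]
  obtain ⟨Y', u', v', b', hY', hX'⟩ := exists_gM (Ad n x ⟨gM Y u v b, gM_mem hY u v b⟩)
  rw [Ad_coe, hx, hx'] at hX'
  change nMat α * gM Y u v b * nMat (-α) = gM Y' u' v' b' at hX'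
  have h1 := congrArg (· *ᵥ v₀ n) hX'
  simp only [← Matrix.mulVec_mulVec, nMat_mulVec_v₀, gM_mulVec_v₀] at h1
  rw [nMat, blk_mulVec_vc, vc_inj] at h1
  obtain ⟨h2, h3, -⟩ := h1
  have h2' : u' + v' = u + v := by rw [← h2, Matrix.one_mulVec]; module
  have h3' : b' = b + α ⬝ᵥ (u + v) := by rw [← h3]; ring
  have h4 : Y' = Y + vecMulVec α (u + v) - vecMulVec (u + v) α := by
    have := hX'
    rw [nMat, nMat, gM, gM, blk_mul, blk_mul, blk_inj] at this
    rw [← this.1]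
    simp only [Matrix.one_mul, Matrix.mul_one]
    ext i j
    simp [vecMulVec_apply]
    ring
  refine ⟨v' - (1 / 2 : ℝ) • (u + v), ?_⟩
  rw [hX', gM_add_nX, gM_inj]
  refine ⟨h4, ?_, by abel, h3'⟩
  rw [sub_sub_eq_add_sub, ← add_smul]
  norm_num
  rw [← h2', add_sub_cancel_right]

/-- The normal form of depth-one functionals under `N`. -/
theorem exists_nMat_conj_gM {n : ℕ} {Y : Matrix (Tr n) (Tr n) ℝ} (hY : Yᵀ = -Y)
    {u v : Tr n → ℝ} (b : ℝ) (huv : u + v ≠ 0) :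
    ∃ (α : Tr n → ℝ) (Y' : Matrix (Tr n) (Tr n) ℝ) (γ : Tr n → ℝ), Y'ᵀ = -Y' ∧
      Y' *ᵥ ((1 / 2 : ℝ) • (u + v)) = 0 ∧ nMat α * gM Y u v b * nMat (-α) =
        gM Y' ((1 / 2 : ℝ) • (u + v)) ((1 / 2 : ℝ) • (u + v)) 0 + nX γ := by
  have hpos : (u + v) ⬝ᵥ (u + v) ≠ 0 := fun h => huv (dotProduct_self_eq_zero.1 h)
  set β := u + v with hβ
  have hYβ : (Y *ᵥ β) ⬝ᵥ β = 0 := by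
    have h1 : (Y *ᵥ β) ⬝ᵥ β = -((Y *ᵥ β) ⬝ᵥ β) := by
      conv_lhs => rw [dotProduct_comm, Matrix.dotProduct_mulVec, ← Matrix.mulVec_transpose, hY,
        Matrix.neg_mulVec, neg_dotProduct]
    linarith
  -- The unique `α` that solves `α · β = -b` together with `(Y + α βᵗ - β αᵗ) β = 0`; consistency of
  -- the two equations is `(Y β) · β = 0`.
  let α : Tr n → ℝ := -(β ⬝ᵥ β)⁻¹ • (Y *ᵥ β + b • β)
  have hα : α ⬝ᵥ β = -b := by
    simp only [α, smul_dotProduct, add_dotProduct, hYβ, smul_eq_mul]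
    field_simp
    ring
  obtain ⟨γ, hγ⟩ := nMat_conj_gM α hY u v b
  refine ⟨α, Y + vecMulVec α β - vecMulVec β α, γ, ?_, ?_, ?_⟩
  rotate_left 2
  · rw [hγ, ← hβ, hα, add_neg_cancel]
  · rw [Matrix.transpose_sub, Matrix.transpose_add, Matrix.transpose_vecMulVec,
      Matrix.transpose_vecMulVec, hY]
    abel
  · rw [Matrix.mulVec_smul, Matrix.sub_mulVec, Matrix.add_mulVec, Matrix.vecMulVec_mulVec,
      Matrix.vecMulVec_mulVec, hα]
    ext i
    simp [α]
    field_simp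
    ring

/-- Every term contains `v₀` or its dual covector, so adding an element of `𝔫` can be undone by row
and column operations on a matrix bordered by `v₀`. -/
theorem nX_eq {n : ℕ} (γ : Tr n → ℝ) :
    nX γ = vecMulVec (v₀ n) (Jm n *ᵥ vc γ 0 0) - vecMulVec (vc γ 0 0) (Jm n *ᵥ v₀ n) := by
  ext i j
  rw [Jm_eq]
  rcases i with (i | i) | i <;> rcases j with (j | j) | j <;>
    simp [nX, blk, vecMulVec_apply, v₀, vc, Matrix.mulVec_diagonal]

/-! ### Bordered determinants -/

/-- A Schur complement in which a solution of `A η = col` clears the last column, so that `A` need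
not be invertible. -/
theorem det_bordered {ι : Type*} [Fintype ι] [DecidableEq ι] {A : Matrix ι ι ℝ} {η col : ι → ℝ}
    (hη : A *ᵥ η = col) (r : ι → ℝ) (d : Matrix Unit Unit ℝ) :
    (Matrix.fromBlocks A (replicateCol Unit col) (replicateRow Unit r) d).det =
      A.det * (d () () - r ⬝ᵥ η) := by
  subst hη
  have h : Matrix.fromBlocks A (replicateCol Unit (A *ᵥ η)) (replicateRow Unit r) d =
      Matrix.fromBlocks A 0 (replicateRow Unit r) (d - replicateRow Unit r * replicateCol Unit η) *
        Matrix.fromBlocks 1 (replicateCol Unit η) 0 1 := by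
    rw [Matrix.fromBlocks_multiply, Matrix.replicateCol_mulVec]
    simp
  rw [h, Matrix.det_mul, Matrix.det_fromBlocks_zero₁₂, Matrix.det_fromBlocks_zero₂₁]
  simp [Matrix.det_unique, Matrix.mul_apply, dotProduct]

/-- The characteristic matrix of `X`, bordered by a vector and its dual. -/
def bord {n : ℕ} (A : Mat n) (w : Ix n → ℝ) : Matrix (Ix n ⊕ Unit) (Ix n ⊕ Unit) ℝ :=
  Matrix.fromBlocks A (replicateCol Unit w) (replicateRow Unit (Jm n *ᵥ w)) 0

theorem det_bord {n : ℕ} (A : Mat n) {w ξ : Ix n → ℝ} (h : A *ᵥ ξ = w) :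
    (bord A w).det = -(A.det * lor w ξ) := by
  rw [bord, det_bordered h, lor_comm, lor, dotProduct_comm]
  simp

theorem IsLor.det_bord_conj {n : ℕ} {k k' : Mat n} (hk : IsLor k) (hkk : k * k' = 1) (A : Mat n)
    (w : Ix n → ℝ) : (bord (k * A * k') (k *ᵥ w)).det = (bord A w).det := by
  have hJ : Jm n * k = k'ᵀ * Jm n := by
    have h1 : k'ᵀ * kᵀ = 1 := by rw [← Matrix.transpose_mul, hkk, Matrix.transpose_one]
    calc _ = k'ᵀ * kᵀ * Jm n * k := by rw [h1, Matrix.one_mul]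
      _ = k'ᵀ * (kᵀ * Jm n * k) := by simp only [Matrix.mul_assoc]
      _ = _ := by rw [hk]
  have h : bord (k * A * k') (k *ᵥ w) =
      Matrix.fromBlocks k 0 0 1 * bord A w * Matrix.fromBlocks k' 0 0 1 := by
    rw [bord, bord, Matrix.fromBlocks_multiply, Matrix.fromBlocks_multiply, Matrix.mulVec_mulVec,
      hJ, ← Matrix.mulVec_mulVec, Matrix.replicateCol_mulVec, Matrix.mulVec_transpose,
      Matrix.replicateRow_vecMul]
    simp
  have hd : k.det * k'.det = 1 := by rw [← Matrix.det_mul, hkk, Matrix.det_one]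
  rw [h, Matrix.det_mul, Matrix.det_mul, Matrix.det_fromBlocks_zero₂₁,
    Matrix.det_fromBlocks_zero₂₁]
  linear_combination ((1 : Matrix Unit Unit ℝ).det ^ 2 * (bord A w).det) * hd +
    (bord A w).det * (by simp : (1 : Matrix Unit Unit ℝ).det ^ 2 = 1)

/-- By `nX_eq` one term is a multiple of the border column and the other of the border row; the two
unipotent factors supply them, and the zero corner prevents a cross term. -/
theorem det_bord_add_nX {n : ℕ} (A : Mat n) (γ : Tr n → ℝ) :
    (bord (A + nX γ) (v₀ n)).det = (bord A (v₀ n)).det := by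
  have h : bord (A + nX γ) (v₀ n) =
      Matrix.fromBlocks 1 (replicateCol Unit (-vc γ 0 0)) 0 1 * bord A (v₀ n) *
        Matrix.fromBlocks 1 0 (replicateRow Unit (Jm n *ᵥ vc γ 0 0)) 1 := by
    rw [bord, bord, Matrix.fromBlocks_multiply, Matrix.fromBlocks_multiply, nX_eq]
    simp [← Matrix.vecMulVec_eq]
    abel
  rw [h, Matrix.det_mul, Matrix.det_mul, Matrix.det_fromBlocks_zero₂₁,
    Matrix.det_fromBlocks_zero₁₂]
  simp

/-- The determinant that carries the invariants of the moment map. -/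
def bdet {n : ℕ} (X : Mat n) (w : Ix n → ℝ) (x : ℝ) : ℝ := (bord (x • (1 : Mat n) - X) w).det

theorem IsLor.bdet_conj {n : ℕ} {k k' : Mat n} (hk : IsLor k) (hkk : k * k' = 1) (X : Mat n)
    (w : Ix n → ℝ) (x : ℝ) : bdet (k * X * k') (k *ᵥ w) x = bdet X w x := by
  rw [bdet, bdet, ← hk.det_bord_conj hkk (x • 1 - X)]
  congr 2
  rw [Matrix.mul_sub, Matrix.sub_mul, Matrix.mul_smul, Matrix.mul_one, Matrix.smul_mul, hkk]

theorem nX_neg {n : ℕ} (γ : Tr n → ℝ) : (nX (-γ) : Mat n) = -nX γ := by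
  ext i j
  rcases i with (i | i) | i <;> rcases j with (j | j) | j <;> simp [nX, blk]

theorem bdet_add_nX {n : ℕ} (X : Mat n) (γ : Tr n → ℝ) (x : ℝ) :
    bdet (X + nX γ) (v₀ n) x = bdet X (v₀ n) x := by
  rw [bdet, bdet, ← det_bord_add_nX (x • 1 - X) (-γ), nX_neg]
  congr 2
  abel

theorem smul_one_sub_gM {n : ℕ} (Y : Matrix (Tr n) (Tr n) ℝ) (u v : Tr n → ℝ) (b x : ℝ) :
    x • (1 : Mat n) - gM Y u v b = blk (x • 1 - Y) (-u) (-v) u (-v) x (-b) (-b) x := by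
  rw [gM, blk_one, blk_smul, blk_sub, blk_inj]
  simp

theorem blk_eq_fromBlocks {n : ℕ} (Y : Matrix (Tr n) (Tr n) ℝ) (u v w z : Tr n → ℝ)
    (a b c d : ℝ) : blk Y u v w z a b c d =
      Matrix.fromBlocks (Matrix.fromBlocks Y (replicateCol Unit u) (replicateRow Unit w)
        (Matrix.of fun _ _ => a)) (replicateCol Unit (Sum.elim v fun _ => b))
        (replicateRow Unit (Sum.elim z fun _ => c)) (Matrix.of fun _ _ => d) := by
  ext i j
  rcases i with (i | i) | i <;> rcases j with (j | j) | j <;> rfl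

/-- Two successive borderings. As `Y β = 0`, the matrix `x - Y` acts on the line of `β` by `x`, so
both auxiliary linear systems have solutions along `β`. -/
theorem det_smul_one_sub_gM {n : ℕ} {Y : Matrix (Tr n) (Tr n) ℝ} {β : Tr n → ℝ}
    (hYβ : Y *ᵥ β = 0) {x : ℝ} (hx : x ≠ 0) :
    (x • (1 : Mat n) - gM Y β β 0).det = x ^ 2 * (x • (1 : Matrix (Tr n) (Tr n) ℝ) - Y).det := by
  have hpos : x ^ 2 + β ⬝ᵥ β ≠ 0 := by
    have : 0 ≤ β ⬝ᵥ β := Finset.sum_nonneg fun i _ => mul_self_nonneg _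
    positivity
  set B := β ⬝ᵥ β with hB
  have h1 : ∀ s : ℝ, (x • (1 : Matrix (Tr n) (Tr n) ℝ) - Y) *ᵥ (s • β) = (x * s) • β := by
    intro s
    rw [Matrix.sub_mulVec, Matrix.mulVec_smul Y, hYβ, Matrix.smul_mulVec, Matrix.one_mulVec,
      smul_zero, sub_zero, smul_smul]
  rw [smul_one_sub_gM, blk_eq_fromBlocks]
  set A := Matrix.fromBlocks (x • (1 : Matrix (Tr n) (Tr n) ℝ) - Y) (replicateCol Unit (-β))
    (replicateRow Unit β) (Matrix.of fun _ _ => x) with hA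
  have h2 : A.det = (x • (1 : Matrix (Tr n) (Tr n) ℝ) - Y).det * (x + B / x) := by
    have h3 : (x • (1 : Matrix (Tr n) (Tr n) ℝ) - Y) *ᵥ ((-x⁻¹) • β) = -β := by
      rw [h1]; simp [hx]
    rw [hA, det_bordered h3]
    simp only [Matrix.of_apply, dotProduct_smul, smul_eq_mul, ← hB]
    ring
  have h4 : A *ᵥ (Sum.elim ((-x / (x ^ 2 + B)) • β) fun _ : Unit => B / (x ^ 2 + B)) =
      (Sum.elim (-β) fun _ => -0 : Sp n → ℝ) := by
    rw [hA, Matrix.fromBlocks_mulVec]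
    have e1 : ((Sum.elim ((-x / (x ^ 2 + B)) • β) fun _ : Unit => B / (x ^ 2 + B)) ∘ Sum.inl :
      Tr n → ℝ) = (-x / (x ^ 2 + B)) • β := rfl
    ext i
    rcases i with i | i
    · simp only [Sum.elim_inl, e1, h1]
      simp [Matrix.mulVec, dotProduct]
      field_simp
      ring
    · have e2 : (replicateRow Unit β *ᵥ ((-x / (x ^ 2 + B)) • β)) i =
          (-x / (x ^ 2 + B)) * B := by
        change β ⬝ᵥ ((-x / (x ^ 2 + B)) • β) = _
        rw [dotProduct_smul, smul_eq_mul]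
      simp only [Sum.elim_inr, e1, Pi.add_apply, e2]
      simp [Matrix.mulVec, dotProduct]
      field_simp
      ring
  have h5 : (Sum.elim (-β) fun _ => -0 : Sp n → ℝ) ⬝ᵥ
      (Sum.elim ((-x / (x ^ 2 + B)) • β) fun _ => B / (x ^ 2 + B)) = x / (x ^ 2 + B) * B := by
    rw [sumElim_dotProduct_sumElim]
    simp [← hB]
    ring
  rw [det_bordered h4, h2, h5]
  simp only [Matrix.of_apply]
  field_simp
  ring

/-- The solution of `(x - X) ξ = v₀` lies in the span of `β` and the last two coordinates, and pairs
with `v₀` to `-4 (β · β) / x³`. -/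
theorem bdet_gM {n : ℕ} {Y : Matrix (Tr n) (Tr n) ℝ} {β : Tr n → ℝ} (hYβ : Y *ᵥ β = 0) {x : ℝ}
    (hx : x ≠ 0) : x * bdet (gM Y β β 0) (v₀ n) x =
      4 * (β ⬝ᵥ β) * (x • (1 : Matrix (Tr n) (Tr n) ℝ) - Y).det := by
  set B := β ⬝ᵥ β with hB
  have h : (x • (1 : Mat n) - gM Y β β 0) *ᵥ
      vc ((2 / x ^ 2) • β) (1 / x - 2 * B / x ^ 3) (1 / x + 2 * B / x ^ 3) = v₀ n := by
    rw [smul_one_sub_gM, blk_mulVec_vc, v₀_eq, vc_inj, Matrix.sub_mulVec, Matrix.mulVec_smul Y, hYβ]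
    refine ⟨?_, ?_, ?_⟩
    · ext i
      simp [Matrix.smul_mulVec]
      field_simp
      ring
    · simp [← hB]
      field_simp
      ring
    · simp [← hB]
      field_simp
      ring
  rw [bdet, det_bord _ h, det_smul_one_sub_gM hYβ hx, v₀_eq, lor_vc, zero_dotProduct]
  field_simp
  ring

/-! ### The base point -/

theorem tPrime_coe {n : ℕ} (a : Fin (n - 1) → ℝ) (c : ℝ) :
    (tPrime a c : Mat n) = gM (skewDiag a) 0 0 c := by
  rw [gM, neg_zero]
  rfl

theorem skewDiag_mulVec_zero {n : ℕ} (a : Fin (n - 1) → ℝ) (ζ : Tr n → ℝ) (i : Fin (n - 1)) :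
    (skewDiag a *ᵥ ζ) (.inl (0, i)) = a i * ζ (.inl (1, i)) := by
  simp [skewDiag, Matrix.mulVec, dotProduct, Fintype.sum_sum_type, Fintype.sum_prod_type,
    Matrix.blockDiagonal_apply]

theorem skewDiag_mulVec_one {n : ℕ} (a : Fin (n - 1) → ℝ) (ζ : Tr n → ℝ) (i : Fin (n - 1)) :
    (skewDiag a *ᵥ ζ) (.inl (1, i)) = -(a i * ζ (.inl (0, i))) := by
  simp [skewDiag, Matrix.mulVec, dotProduct, Fintype.sum_sum_type, Fintype.sum_prod_type,
    Matrix.blockDiagonal_apply]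

theorem skewDiag_mulVec_last {n : ℕ} (a : Fin (n - 1) → ℝ) (ζ : Tr n → ℝ) :
    (skewDiag a *ᵥ ζ) (.inr ()) = 0 := by
  simp [skewDiag, Matrix.mulVec, dotProduct, Fintype.sum_sum_type]

theorem det_smul_one_sub_skewDiag {n : ℕ} (a : Fin (n - 1) → ℝ) (x : ℝ) :
    (x • (1 : Matrix (Tr n) (Tr n) ℝ) - skewDiag a).det = x * ∏ i, (x ^ 2 + a i ^ 2) := by
  have h : x • (1 : Matrix (Tr n) (Tr n) ℝ) - skewDiag a =
      Matrix.fromBlocks (Matrix.blockDiagonal fun i => !![x, -a i; a i, x]) 0 0 (x • 1) := by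
    ext i j
    rcases i with ⟨k, i⟩ | i <;> rcases j with ⟨l, j⟩ | j
    · fin_cases k <;> fin_cases l <;> by_cases hij : i = j <;>
        simp [skewDiag, Matrix.blockDiagonal_apply, hij]
    · simp [skewDiag]
    · simp [skewDiag]
    · simp [skewDiag]
  rw [h, Matrix.det_fromBlocks_zero₂₁, Matrix.det_blockDiagonal]
  simp only [Matrix.det_fin_two_of, Matrix.det_unique, Matrix.smul_apply, Matrix.one_apply_eq,
    smul_eq_mul, mul_one]
  rw [mul_comm]
  congr 1
  refine Finset.prod_congr rfl fun i _ => ?_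
  ring

theorem det_smul_one_sub_tPrime {n : ℕ} (a : Fin (n - 1) → ℝ) (c : ℝ) {x : ℝ} (hx : x ≠ 0) :
    (x • (1 : Mat n) - (tPrime a c : Mat n)).det =
      x * (x ^ 2 - c ^ 2) * ∏ i, (x ^ 2 + a i ^ 2) := by
  rw [tPrime_coe, smul_one_sub_gM, blk_eq_fromBlocks]
  set A := Matrix.fromBlocks (x • (1 : Matrix (Tr n) (Tr n) ℝ) - skewDiag a)
    (replicateCol Unit (-0)) (replicateRow Unit 0) (Matrix.of fun _ _ => x) with hA
  have h1 : A.det = x * (x * ∏ i, (x ^ 2 + a i ^ 2)) := by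
    have h2 : (x • (1 : Matrix (Tr n) (Tr n) ℝ) - skewDiag a) *ᵥ 0 = (-0 : Tr n → ℝ) := by simp
    rw [hA, det_bordered h2, det_smul_one_sub_skewDiag]
    simp [mul_comm]
  have h2 : A *ᵥ (Sum.elim 0 fun _ => -c / x) = (Sum.elim (-0) fun _ => -c : Sp n → ℝ) := by
    rw [hA, Matrix.fromBlocks_mulVec]
    ext i
    rcases i with i | i
    · simp
    · simp [Matrix.mulVec, dotProduct]
      field_simp
  have h3 : (Sum.elim (-0) fun _ => -c : Sp n → ℝ) ⬝ᵥ (Sum.elim 0 fun _ => -c / x) =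
      c ^ 2 / x := by
    rw [sumElim_dotProduct_sumElim]
    simp
    ring
  rw [det_bordered h2, h1, h3]
  simp only [Matrix.of_apply]
  field_simp

/-- The interlacing polynomial with weights `m`, `m₀`. -/
def interPoly {N : ℕ} (a m : Fin N → ℝ) (m₀ t : ℝ) : ℝ :=
  ∑ i, m i * t * ∏ j ∈ Finset.univ.erase i, (t + a j ^ 2) + m₀ * ∏ j, (t + a j ^ 2)

/-- The system `(x - T) ξ = w` is solved block by block, each rotation block contributing the
denominator `x² + aᵢ²` and the boost plane `x² - c²`. The null condition replaces `p² - r²` by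
`-|ζ|²`, which cancels the last denominator and makes all weights nonnegative. -/
theorem bdet_tPrime {n : ℕ} (a : Fin (n - 1) → ℝ) (c : ℝ) (ζ : Tr n → ℝ) (p r : ℝ)
    (hw : lor (vc ζ p r) (vc ζ p r) = 0) {x : ℝ} (hx : x ≠ 0) (hxc : x ^ 2 ≠ c ^ 2) :
    bdet (tPrime a c : Mat n) (vc ζ p r) x = interPoly a
      (fun i => (a i ^ 2 + c ^ 2) * (ζ (.inl (0, i)) ^ 2 + ζ (.inl (1, i)) ^ 2))
      (c ^ 2 * ζ (.inr ()) ^ 2) (x ^ 2) := by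
  have hpos : ∀ i, x ^ 2 + a i ^ 2 ≠ 0 := fun i => by positivity
  have hc : x ^ 2 - c ^ 2 ≠ 0 := sub_ne_zero.2 hxc
  let ξ : Tr n → ℝ := Sum.elim (fun k => if k.1 = 0 then
      (x * ζ (.inl (0, k.2)) + a k.2 * ζ (.inl (1, k.2))) / (x ^ 2 + a k.2 ^ 2) else
      (x * ζ (.inl (1, k.2)) - a k.2 * ζ (.inl (0, k.2))) / (x ^ 2 + a k.2 ^ 2))
    fun _ => ζ (.inr ()) / x
  have h : (x • (1 : Mat n) - (tPrime a c : Mat n)) *ᵥ vc ξ ((x * p + c * r) / (x ^ 2 - c ^ 2))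
      ((x * r + c * p) / (x ^ 2 - c ^ 2)) = vc ζ p r := by
    rw [tPrime_coe, smul_one_sub_gM, blk_mulVec_vc, vc_inj]
    refine ⟨?_, ?_, ?_⟩
    · rw [Matrix.sub_mulVec, Matrix.smul_mulVec, Matrix.one_mulVec]
      ext k
      rcases k with ⟨k, i⟩ | k
      · have := hpos i
        fin_cases k
        · simp [skewDiag_mulVec_zero, ξ]
          field_simp
          ring
        · simp [skewDiag_mulVec_one, ξ]
          field_simp
          ring
      · have e1 := skewDiag_mulVec_last a ξ
        simp only [Pi.add_apply, Pi.sub_apply, Pi.smul_apply, e1]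
        simp [ξ]
        field_simp
    · simp
      field_simp
      ring
    · simp
      field_simp
      ring
  rw [bdet, det_bord _ h, det_smul_one_sub_tPrime a c hx, lor_vc]
  have h1 : ζ ⬝ᵥ ξ = ∑ i, x * (ζ (.inl (0, i)) ^ 2 + ζ (.inl (1, i)) ^ 2) / (x ^ 2 + a i ^ 2) +
      ζ (.inr ()) ^ 2 / x := by
    simp only [dotProduct, Fintype.sum_sum_type, Fintype.sum_prod_type, Fin.sum_univ_two,
      ← Finset.sum_add_distrib]
    congr 1
    · refine Finset.sum_congr rfl fun i _ => ?_
      have := hpos i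
      simp [ξ]
      field_simp
      ring
    · simp [ξ]
      ring
  have h2 : ∑ i, (ζ (.inl (0, i)) ^ 2 + ζ (.inl (1, i)) ^ 2) + ζ (.inr ()) ^ 2 + p * p - r * r
      = 0 := by
    rw [lor_vc] at hw
    rw [← hw]
    congr 2
    simp only [dotProduct, Fintype.sum_sum_type, Fintype.sum_prod_type, Fin.sum_univ_two,
      ← Finset.sum_add_distrib, ← sq]
    simp
  rw [h1, interPoly]
  set P := ∏ i, (x ^ 2 + a i ^ 2) with hP
  have hPi : ∀ i, P = (x ^ 2 + a i ^ 2) * ∏ j ∈ Finset.univ.erase i, (x ^ 2 + a j ^ 2) :=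
    fun i => (Finset.mul_prod_erase _ _ (Finset.mem_univ i)).symm
  -- Termwise this is `aᵢ² + c² = (x² + aᵢ²) - (x² - c²)`, divided by `x² + aᵢ²`.
  have h3 : ∑ i, (a i ^ 2 + c ^ 2) * (ζ (.inl (0, i)) ^ 2 + ζ (.inl (1, i)) ^ 2) * x ^ 2 *
      ∏ j ∈ Finset.univ.erase i, (x ^ 2 + a j ^ 2) =
      x ^ 2 * P * ∑ i, (ζ (.inl (0, i)) ^ 2 + ζ (.inl (1, i)) ^ 2) -
      x * (x ^ 2 - c ^ 2) * P *
        ∑ i, x * (ζ (.inl (0, i)) ^ 2 + ζ (.inl (1, i)) ^ 2) / (x ^ 2 + a i ^ 2) := by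
    rw [Finset.mul_sum, Finset.mul_sum, ← Finset.sum_sub_distrib]
    refine Finset.sum_congr rfl fun i _ => ?_
    rw [hPi i]
    have := hpos i
    field_simp
    ring
  rw [h3]
  generalize ∑ i, x * (ζ (.inl (0, i)) ^ 2 + ζ (.inl (1, i)) ^ 2) / (x ^ 2 + a i ^ 2) = S at *
  have h4 : ∑ i, (ζ (.inl (0, i)) ^ 2 + ζ (.inl (1, i)) ^ 2) =
    -(ζ (.inr ()) ^ 2 + p * p - r * r) := by linarith
  rw [h4]
  field_simp
  ring

/-! ### Interlacing -/

section interlacing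
variable {N : ℕ}

/-- `interPoly` as a polynomial. -/
def interP (a m : Fin N → ℝ) (m₀ : ℝ) : ℝ[X] :=
  ∑ i, C (m i) * X * ∏ j ∈ Finset.univ.erase i, (X + C (a j ^ 2)) +
    C m₀ * ∏ j, (X + C (a j ^ 2))

theorem eval_interP (a m : Fin N → ℝ) (m₀ t : ℝ) :
    (interP a m m₀).eval t = interPoly a m m₀ t := by
  simp [interP, interPoly, Polynomial.eval_finsetSum, Polynomial.eval_prod]

/-- Substituting `t = (t + aᵢ²) - aᵢ²` in each summand isolates the coefficient of degree `N`. -/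
theorem interP_eq (a m : Fin N → ℝ) (m₀ : ℝ) :
    interP a m m₀ = (∑ i, m i + m₀) • ∏ j, (X + C (a j ^ 2)) -
      ∑ i, (m i * a i ^ 2) • ∏ j ∈ Finset.univ.erase i, (X + C (a j ^ 2)) := by
  rw [interP, add_smul, Finset.sum_smul, add_sub_right_comm, ← Finset.sum_sub_distrib,
    Polynomial.smul_eq_C_mul]
  congr 1
  refine Finset.sum_congr rfl fun i _ => ?_
  rw [← Finset.mul_prod_erase _ _ (Finset.mem_univ i), Polynomial.smul_eq_C_mul,
    Polynomial.smul_eq_C_mul, C_mul]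
  ring

theorem monic_prod_X_add (s : Finset (Fin N)) (x : Fin N → ℝ) :
    (∏ j ∈ s, ((X : ℝ[X]) + C (x j))).Monic :=
  Polynomial.monic_prod_of_monic _ _ fun j _ => Polynomial.monic_X_add_C (x j)

theorem degree_prod_X_add (s : Finset (Fin N)) (x : Fin N → ℝ) :
    (∏ j ∈ s, ((X : ℝ[X]) + C (x j))).degree = s.card := by
  rw [Polynomial.degree_prod]
  simp

/-- The terms of degree `N` cancel, so an identity with this leading coefficient needs checking at
only `N` points. -/
theorem interP_sub_mem (a m x : Fin N → ℝ) (m₀ : ℝ) :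
    interP a m m₀ - (∑ i, m i + m₀) • ∏ j, (X + C (x j ^ 2)) ∈ Polynomial.degreeLT ℝ N := by
  rw [interP_eq, sub_right_comm, ← smul_sub]
  refine Submodule.sub_mem _ (Submodule.smul_mem _ _ ?_) (Submodule.sum_mem _ fun i _ =>
    Submodule.smul_mem _ _ ?_)
  · rw [Polynomial.mem_degreeLT]
    have h1 := degree_prod_X_add Finset.univ fun j => a j ^ 2
    have h2 := degree_prod_X_add Finset.univ fun j => x j ^ 2
    have := Polynomial.degree_sub_lt_left (h1.trans h2.symm) (monic_prod_X_add _ _).ne_zero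
      ((monic_prod_X_add _ _).leadingCoeff.trans (monic_prod_X_add _ _).leadingCoeff.symm)
    rw [h1] at this
    simpa using this
  · rw [Polynomial.mem_degreeLT, degree_prod_X_add, Finset.card_erase_of_mem (Finset.mem_univ i),
      Finset.card_fin]
    have := i.pos
    exact_mod_cast Nat.sub_lt this one_pos

/-- At this node all summands but one vanish. This recovers the weight from the polynomial, and its
sign from the sign of the value. -/
theorem interPoly_neg_sq (a m : Fin N → ℝ) (m₀ : ℝ) (i : Fin N) :
    interPoly a m m₀ (-a i ^ 2) =
      -(m i * a i ^ 2 * ∏ j ∈ Finset.univ.erase i, (a j ^ 2 - a i ^ 2)) := by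
  rw [interPoly, Finset.prod_eq_zero (Finset.mem_univ i) (by ring), mul_zero, add_zero,
    Finset.sum_eq_single i]
  · have : ∀ j, -a i ^ 2 + a j ^ 2 = a j ^ 2 - a i ^ 2 := fun j => by ring
    simp only [this]
    ring
  · intro k _ hk
    rw [Finset.prod_eq_zero (Finset.mem_erase.2 ⟨hk.symm, Finset.mem_univ i⟩) (by ring), mul_zero]
  · simp

theorem interPoly_zero (a m : Fin N → ℝ) (m₀ : ℝ) :
    interPoly a m m₀ 0 = m₀ * ∏ j, a j ^ 2 := by
  simp [interPoly]

theorem sq_sub_sq_ne_zero {a : Fin N → ℝ} (ha : StrictAnti a) (ha₀ : ∀ i, 0 < a i) {i j : Fin N}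
    (h : j ≠ i) : a j ^ 2 - a i ^ 2 ≠ 0 := by
  rw [sub_ne_zero]
  intro h'
  exact h (ha.injective ((sq_eq_sq₀ (ha₀ j).le (ha₀ i).le).1 h'))

theorem prod_sq_sub_ne_zero {a : Fin N → ℝ} (ha : StrictAnti a) (ha₀ : ∀ i, 0 < a i) (i : Fin N) :
    ∏ j ∈ Finset.univ.erase i, (a j ^ 2 - a i ^ 2) ≠ 0 :=
  Finset.prod_ne_zero_iff.2 fun _ hj => sq_sub_sq_ne_zero ha ha₀ (Finset.ne_of_mem_erase hj)

/-- Equality for all `t > c²` is an identity of polynomials; evaluation at `-aᵢ²` and at `0`, points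
outside the original range, then isolates the weights. -/
theorem interPoly_unique {a : Fin N → ℝ} (ha : StrictAnti a) (ha₀ : ∀ i, 0 < a i) (c : ℝ)
    {m m' : Fin N → ℝ} {m₀ m₀' : ℝ}
    (h : ∀ x : ℝ, x ≠ 0 → x ^ 2 ≠ c ^ 2 → interPoly a m m₀ (x ^ 2) = interPoly a m' m₀' (x ^ 2)) :
    m = m' ∧ m₀ = m₀' := by
  have h1 : interP a m m₀ = interP a m' m₀' := by
    refine Polynomial.eq_of_infinite_eval_eq _ _ ((Set.Ioi_infinite (c ^ 2)).mono fun t ht => ?_)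
    have ht0 : 0 < t := (sq_nonneg c).trans_lt ht
    have h2 := h (Real.sqrt t) (Real.sqrt_pos.2 ht0).ne' (by
      rw [Real.sq_sqrt ht0.le]; exact (ne_of_lt ht).symm)
    rw [Real.sq_sqrt ht0.le] at h2
    simpa only [Set.mem_ofPred_eq, eval_interP] using h2
  have h2 : ∀ t, interPoly a m m₀ t = interPoly a m' m₀' t := fun t => by
    rw [← eval_interP, ← eval_interP, h1]
  constructor
  · ext i
    have h3 := h2 (-a i ^ 2)
    rw [interPoly_neg_sq, interPoly_neg_sq, neg_inj] at h3
    have h4 := mul_right_cancel₀ (prod_sq_sub_ne_zero ha ha₀ i) h3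
    exact mul_right_cancel₀ (pow_ne_zero 2 (ha₀ i).ne') h4
  · have h3 := h2 0
    rw [interPoly_zero, interPoly_zero] at h3
    exact mul_right_cancel₀ (Finset.prod_ne_zero_iff.2 fun j _ => pow_ne_zero 2 (ha₀ j).ne') h3

/-- Interlacing of `x` and `a`. -/
def Interlace (a x : Fin N → ℝ) : Prop :=
  (∀ i, 0 ≤ x i) ∧ (∀ i, x i ≤ a i) ∧ ∀ i j : Fin N, (j : ℕ) = i + 1 → a j ≤ x i

theorem Interlace.le_of_lt {a x : Fin N → ℝ} (ha : StrictAnti a) (h : Interlace a x) {i j : Fin N}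
    (hij : i < j) : a j ≤ x i := by
  have hlt : (i : ℕ) + 1 < N := by have := j.2; have : (i : ℕ) < j := hij; omega
  refine le_trans (ha.antitone ?_) (h.2.2 i ⟨i + 1, hlt⟩ rfl)
  exact Nat.succ_le_of_lt hij

theorem Interlace.antitone {a x : Fin N → ℝ} (ha : StrictAnti a) (h : Interlace a x) :
    Antitone x := by
  intro i j hij
  rcases hij.eq_or_lt with rfl | hij
  · exact le_rfl
  · exact (h.2.1 j).trans (h.le_of_lt ha hij)

/-- Interlacing sequences come from nonnegative weights. -/
theorem Interlace.exists_weights {a x : Fin N → ℝ} (ha : StrictAnti a) (ha₀ : ∀ i, 0 < a i)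
    (h : Interlace a x) {M : ℝ} (hM : 0 ≤ M) :
    ∃ (m : Fin N → ℝ) (m₀ : ℝ), (∀ i, 0 ≤ m i) ∧ 0 ≤ m₀ ∧
      ∀ t, interPoly a m m₀ t = M * ∏ i, (t + x i ^ 2) := by
  -- The values forced by evaluating the desired identity at `-aᵢ²` and at `0`.
  let m : Fin N → ℝ := fun i => M * ((a i ^ 2 - x i ^ 2) / a i ^ 2) *
    ∏ j ∈ Finset.univ.erase i, (x j ^ 2 - a i ^ 2) / (a j ^ 2 - a i ^ 2)
  let m₀ : ℝ := M * ∏ j, x j ^ 2 / a j ^ 2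
  refine ⟨m, m₀, fun i => ?_, ?_, ?_⟩
  · refine mul_nonneg (mul_nonneg hM (div_nonneg ?_ (sq_nonneg _)))
      (Finset.prod_nonneg fun j hj => ?_)
    · have := h.1 i; have := h.2.1 i
      nlinarith
    -- Interlacing gives the numerator and the denominator of each factor compatible signs: both
    -- nonnegative for `j < i`, both nonpositive for `j > i`.
    · have hji := Finset.ne_of_mem_erase hj
      have h1 := h.1 i; have h2 := h.1 j; have h3 := ha₀ i; have h4 := ha₀ j
      rcases lt_or_gt_of_ne hji with hlt | hlt
      · have h5 := h.le_of_lt ha hlt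
        have h6 := ha hlt
        exact div_nonneg (by nlinarith) (by nlinarith)
      · have h5 := h.2.1 j
        have h6 := ha hlt
        exact div_nonneg_of_nonpos (by nlinarith) (by nlinarith)
  · exact mul_nonneg hM (Finset.prod_nonneg fun j _ => div_nonneg (sq_nonneg _) (sq_nonneg _))
  · have hpoly : interP a m m₀ = M • ∏ j, (X + C (x j ^ 2)) := by
      let e : Fin N ↪ ℝ := ⟨fun i => -a i ^ 2, fun i j hij => ha.injective
        ((sq_eq_sq₀ (ha₀ i).le (ha₀ j).le).1 (neg_injective hij))⟩
      -- The extra node `0` is needed: `M` is not yet known to be the leading coefficient, so the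
      -- difference may have degree `N`.
      let s : Finset ℝ := insert 0 (Finset.univ.map e)
      have hs0 : (0 : ℝ) ∉ Finset.univ.map e := by
        rw [Finset.mem_map]
        rintro ⟨i, -, hi⟩
        exact (neg_ne_zero.2 (pow_ne_zero 2 (ha₀ i).ne')) hi
      have hcard : s.card = N + 1 := by
        rw [Finset.card_insert_of_notMem hs0, Finset.card_map, Finset.card_fin]
      refine Polynomial.eq_of_degree_sub_lt_of_eval_finset_eq s ?_ fun t ht => ?_
      · rw [hcard, ← Polynomial.mem_degreeLT]
        have h1 := interP_sub_mem a m x m₀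
        have h2 : interP a m m₀ - M • ∏ j, (X + C (x j ^ 2)) =
            (interP a m m₀ - (∑ i, m i + m₀) • ∏ j, (X + C (x j ^ 2))) +
            ((∑ i, m i + m₀) - M) • ∏ j, (X + C (x j ^ 2)) := by
          rw [sub_smul]; abel
        rw [h2]
        refine Submodule.add_mem _ (Polynomial.degreeLT_mono (Nat.le_succ N) h1)
          (Submodule.smul_mem _ _ ?_)
        rw [Polynomial.mem_degreeLT, degree_prod_X_add Finset.univ fun j => x j ^ 2,
          Finset.card_fin]
        exact_mod_cast Nat.lt_succ_self N
      · rw [eval_interP, Polynomial.eval_smul, Polynomial.eval_prod]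
        simp only [Polynomial.eval_add, Polynomial.eval_X, Polynomial.eval_C, smul_eq_mul]
        rcases Finset.mem_insert.1 ht with rfl | ht
        · rw [interPoly_zero]
          simp only [m₀, zero_add]
          rw [mul_assoc, ← Finset.prod_mul_distrib]
          congr 1
          refine Finset.prod_congr rfl fun j _ => ?_
          have := (ha₀ j).ne'
          field_simp
        · obtain ⟨i, -, rfl⟩ := Finset.mem_map.1 ht
          change interPoly a m m₀ (-a i ^ 2) = M * ∏ j, (-a i ^ 2 + x j ^ 2)
          rw [interPoly_neg_sq, ← Finset.mul_prod_erase _ _ (Finset.mem_univ i)]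
          simp only [m]
          have h1 : (∏ j ∈ Finset.univ.erase i, (x j ^ 2 - a i ^ 2) / (a j ^ 2 - a i ^ 2)) *
              ∏ j ∈ Finset.univ.erase i, (a j ^ 2 - a i ^ 2) =
              ∏ j ∈ Finset.univ.erase i, (-a i ^ 2 + x j ^ 2) := by
            rw [← Finset.prod_mul_distrib]
            refine Finset.prod_congr rfl fun j hj => ?_
            have := sq_sub_sq_ne_zero ha ha₀ (Finset.ne_of_mem_erase hj)
            field_simp
            ring
          rw [← h1]
          have := (ha₀ i).ne'
          field_simp
          ring
    intro t
    rw [← eval_interP, hpoly, Polynomial.eval_smul, Polynomial.eval_prod]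
    simp

/-- The negative factors are those with `j > i`, and there are `N - 1 - i` of them. -/
theorem sign_prod_sq_sub {a : Fin N → ℝ} (ha : StrictAnti a) (ha₀ : ∀ i, 0 < a i) (i : Fin N) :
    0 < (-1) ^ (N - 1 - i : ℕ) * ∏ j ∈ Finset.univ.erase i, (a j ^ 2 - a i ^ 2) := by
  have h1 : ∏ j ∈ Finset.univ.erase i, (a j ^ 2 - a i ^ 2) =
      (∏ j ∈ Finset.univ.erase i, if i < j then (-1 : ℝ) else 1) *
        ∏ j ∈ Finset.univ.erase i, |a j ^ 2 - a i ^ 2| := by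
    rw [← Finset.prod_mul_distrib]
    refine Finset.prod_congr rfl fun j hj => ?_
    have h2 := ha₀ i; have h3 := ha₀ j
    rcases lt_or_gt_of_ne (Finset.ne_of_mem_erase hj) with hlt | hlt
    · have := ha hlt
      rw [if_neg hlt.le.not_gt, abs_of_pos (by nlinarith), one_mul]
    · have := ha hlt
      rw [if_pos hlt, abs_of_neg (by nlinarith)]
      ring
  have h2 : (∏ j ∈ Finset.univ.erase i, if i < j then (-1 : ℝ) else 1) =
      (-1) ^ (N - 1 - i : ℕ) := by
    rw [Finset.prod_ite, Finset.prod_const_one, mul_one, Finset.prod_const]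
    congr 1
    rw [← Fin.card_Ioi]
    congr 1
    ext j
    simp only [Finset.mem_filter, Finset.mem_erase, Finset.mem_univ, and_true, Finset.mem_Ioi,
      and_iff_right_iff_imp]
    exact fun h => h.ne'
  rw [h1, h2, ← mul_assoc, ← mul_pow]
  simp only [mul_neg, mul_one, neg_neg, one_pow, one_mul]
  exact Finset.prod_pos fun j hj =>
    abs_pos.2 (sq_sub_sq_ne_zero ha ha₀ (Finset.ne_of_mem_erase hj))

theorem continuous_interPoly_neg_sq (a m : Fin N → ℝ) (m₀ : ℝ) :
    Continuous fun x : ℝ => interPoly a m m₀ (-x ^ 2) := by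
  unfold interPoly
  fun_prop

/-- Positive weights make the polynomial alternate strictly in sign at the `-aᵢ²` and at `0`. The
intermediate value theorem puts a root in each of the `N` gaps, and these exhaust the degree. -/
theorem exists_interlace_of_pos {a : Fin N → ℝ} (ha : StrictAnti a) (ha₀ : ∀ i, 0 < a i)
    {m : Fin N → ℝ} {m₀ : ℝ} (hm : ∀ i, 0 < m i) (hm₀ : 0 < m₀) :
    ∃ x, Interlace a x ∧ ∀ t, interPoly a m m₀ t = (∑ i, m i + m₀) * ∏ i, (t + x i ^ 2) := by
  let g : ℝ → ℝ := fun x => interPoly a m m₀ (-x ^ 2)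
  have hg : Continuous g := continuous_interPoly_neg_sq a m m₀
  have hsign : ∀ i : Fin N, 0 < (-1) ^ (N - i : ℕ) * g (a i) := by
    intro i
    have h1 := sign_prod_sq_sub ha ha₀ i
    have h2 : N - (i : ℕ) = (N - 1 - i) + 1 := by have := i.2; omega
    have h3 := hm i
    have h4 := ha₀ i
    change 0 < (-1) ^ (N - i : ℕ) * interPoly a m m₀ (-a i ^ 2)
    rw [interPoly_neg_sq, h2, pow_succ]
    have : (-1) ^ (N - 1 - i : ℕ) * -1 * -(m i * a i ^ 2 *
        ∏ j ∈ Finset.univ.erase i, (a j ^ 2 - a i ^ 2)) = (m i * a i ^ 2) *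
        ((-1) ^ (N - 1 - i : ℕ) * ∏ j ∈ Finset.univ.erase i, (a j ^ 2 - a i ^ 2)) := by ring
    rw [this]
    positivity
  have h0 : 0 < g 0 := by
    change 0 < interPoly a m m₀ (-0 ^ 2)
    rw [zero_pow two_ne_zero, neg_zero, interPoly_zero]
    exact mul_pos hm₀ (Finset.prod_pos fun j _ => pow_pos (ha₀ j) 2)
  -- The lower end of the `i`-th gap: the next `a`, or `0` below the last one.
  let l : Fin N → ℝ := fun i => if h : (i : ℕ) + 1 < N then a ⟨i + 1, h⟩ else 0
  have hl0 : ∀ i, 0 ≤ l i := by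
    intro i
    simp only [l]
    split_ifs with h
    · exact (ha₀ _).le
    · exact le_rfl
  have hla : ∀ i, l i ≤ a i := by
    intro i
    simp only [l]
    split_ifs with h
    · exact ha.antitone (Nat.le_succ i)
    · exact (ha₀ i).le
  have hopp : ∀ i : Fin N, 0 < (-1) ^ (N - 1 - i : ℕ) * g (l i) ∧
      0 < (-1) ^ (N - 1 - i : ℕ) * -g (a i) := by
    intro i
    constructor
    · simp only [l]
      split_ifs with h
      · have := hsign ⟨i + 1, h⟩
        have e : N - 1 - (i : ℕ) = N - (i + 1) := by omega
        rw [e]; exact this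
      · have e : N - 1 - (i : ℕ) = 0 := by omega
        rw [e]; simpa using h0
    · have := hsign i
      have h2 : N - (i : ℕ) = (N - 1 - i) + 1 := by have := i.2; omega
      rw [h2, pow_succ] at this
      linarith
  have hroot : ∀ i, ∃ x ∈ Set.Ioo (l i) (a i), g x = 0 := by
    intro i
    obtain ⟨h1, h2⟩ := hopp i
    rcases neg_one_pow_eq_or ℝ (N - 1 - i : ℕ) with h3 | h3
    · rw [h3] at h1 h2
      obtain ⟨x, hx, hx0⟩ := intermediate_value_Ioo' (hla i) hg.continuousOn
        (show (0 : ℝ) ∈ Set.Ioo (g (a i)) (g (l i)) from ⟨by linarith, by linarith⟩)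
      exact ⟨x, hx, hx0⟩
    · rw [h3] at h1 h2
      obtain ⟨x, hx, hx0⟩ := intermediate_value_Ioo (hla i) hg.continuousOn
        (show (0 : ℝ) ∈ Set.Ioo (g (l i)) (g (a i)) from ⟨by linarith, by linarith⟩)
      exact ⟨x, hx, hx0⟩
  choose x hx hx0 using hroot
  have hint : Interlace a x := by
    refine ⟨fun i => (hl0 i).trans (hx i).1.le, fun i => (hx i).2.le, fun i j hij => ?_⟩
    have h1 : (i : ℕ) + 1 < N := hij ▸ j.2
    have h2 : l i = a j := by
      simp only [l]
      rw [dif_pos h1]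
      congr 1
      exact Fin.ext hij.symm
    exact h2 ▸ (hx i).1.le
  have hxpos : ∀ i, 0 < x i := fun i => (hl0 i).trans_lt (hx i).1
  have hxanti : StrictAnti x := by
    intro i j hij
    exact (hx j).2.trans_le (hint.le_of_lt ha hij)
  refine ⟨x, hint, ?_⟩
  have hpoly : interP a m m₀ = (∑ i, m i + m₀) • ∏ j, (X + C (x j ^ 2)) := by
    let e : Fin N ↪ ℝ := ⟨fun i => -x i ^ 2, fun i j hij => hxanti.injective
      ((sq_eq_sq₀ (hxpos i).le (hxpos j).le).1 (neg_injective hij))⟩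
    refine Polynomial.eq_of_degree_sub_lt_of_eval_finset_eq (Finset.univ.map e) ?_ fun t ht => ?_
    · rw [Finset.card_map, Finset.card_fin, ← Polynomial.mem_degreeLT]
      exact interP_sub_mem a m x m₀
    · obtain ⟨i, -, rfl⟩ := Finset.mem_map.1 ht
      change (interP a m m₀).eval (-x i ^ 2) = _
      rw [eval_interP, Polynomial.eval_smul, Polynomial.eval_prod,
        Finset.prod_eq_zero (Finset.mem_univ i), smul_zero]
      · exact hx0 i
      · change Polynomial.eval (-x i ^ 2) _ = 0
        simp
  intro t
  rw [← eval_interP, hpoly, Polynomial.eval_smul, Polynomial.eval_prod]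
  simp

/-- Nonnegative weights give interlacing roots. -/
theorem exists_interlace {a : Fin N → ℝ} (ha : StrictAnti a) (ha₀ : ∀ i, 0 < a i)
    {m : Fin N → ℝ} {m₀ : ℝ} (hm : ∀ i, 0 ≤ m i) (hm₀ : 0 ≤ m₀) :
    ∃ x, Interlace a x ∧ ∀ t, interPoly a m m₀ t = (∑ i, m i + m₀) * ∏ i, (t + x i ^ 2) := by
  -- Vanishing weights allow roots to meet the nodes, so all weights are raised by `1 / (k + 1)`;
  -- the roots stay in a compact box, and interlacing is a closed condition.
  have h : ∀ k : ℕ, ∃ x, Interlace a x ∧ ∀ t,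
      interPoly a (fun i => m i + 1 / ((k : ℝ) + 1)) (m₀ + 1 / ((k : ℝ) + 1)) t =
        (∑ i, (m i + 1 / ((k : ℝ) + 1)) + (m₀ + 1 / ((k : ℝ) + 1))) * ∏ i, (t + x i ^ 2) := by
    intro k
    have hk : 0 < 1 / ((k : ℝ) + 1) := by positivity
    exact exists_interlace_of_pos ha ha₀ (fun i => add_pos_of_nonneg_of_pos (hm i) hk)
      (add_pos_of_nonneg_of_pos hm₀ hk)
  choose x hx hxt using h
  have hbox : ∀ k, x k ∈ Set.pi Set.univ fun i => Set.Icc 0 (a i) :=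
    fun k i _ => ⟨(hx k).1 i, (hx k).2.1 i⟩
  obtain ⟨y, hy, φ, hφ, hlim⟩ :=
    (isCompact_univ_pi fun i => isCompact_Icc (a := (0 : ℝ)) (b := a i)).tendsto_subseq hbox
  have hlim' : ∀ i, Filter.Tendsto (fun k => x (φ k) i) Filter.atTop (nhds (y i)) :=
    fun i => (tendsto_pi_nhds.1 hlim) i
  refine ⟨y, ⟨fun i => (hy i trivial).1, fun i => (hy i trivial).2, fun i j hij => ?_⟩, fun t => ?_⟩
  · exact ge_of_tendsto' (hlim' i) fun k => (hx (φ k)).2.2 i j hij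
  · have hε : Filter.Tendsto (fun k => 1 / ((φ k : ℝ) + 1)) Filter.atTop (nhds 0) :=
      tendsto_one_div_add_atTop_nhds_zero_nat.comp hφ.tendsto_atTop
    have hL : Continuous fun ε : ℝ => interPoly a (fun i => m i + ε) (m₀ + ε) t := by
      unfold interPoly
      fun_prop
    have hR : Continuous fun ε : ℝ => ∑ i, (m i + ε) + (m₀ + ε) := by fun_prop
    have h1 := (hL.tendsto 0).comp hε
    have h2 := ((hR.tendsto 0).comp hε).mul
      (tendsto_finsetProd Finset.univ fun i _ => ((hlim' i).pow 2).const_add t)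
    have h3 := tendsto_nhds_unique (h1.congr fun k => hxt (φ k) t) h2
    simpa using h3

end interlacing

/-! ### Congruences of skew forms have determinant one -/

/-- Nondegeneracy of `B` makes the Darboux matrix `Q` invertible, so conjugation by it turns `M`
into a symplectic matrix. The equivalence `e` only reindexes `Q` to a square matrix. -/
theorem det_eq_one_of_congr {ι l : Type*} [Fintype ι] [DecidableEq ι] [Fintype l] [DecidableEq l]
    (e : ι ≃ l ⊕ l) {Q : Matrix (l ⊕ l) ι ℝ} {B M : Matrix ι ι ℝ} (hB : Qᵀ * Matrix.J l ℝ * Q = B)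
    (hdet : B.det ≠ 0) (hM : Mᵀ * B * M = B) : M.det = 1 := by
  set Q' : Matrix ι ι ℝ := Q.submatrix e id with hQ'
  set J' : Matrix ι ι ℝ := (Matrix.J l ℝ).submatrix e e with hJ'
  have hB' : Q'ᵀ * J' * Q' = B := by
    rw [← hB, hQ', hJ', Matrix.transpose_submatrix, Matrix.submatrix_mul_equiv,
      Matrix.submatrix_mul_equiv, Matrix.submatrix_id_id]
  have hQ : IsUnit Q'.det := by
    refine isUnit_iff_ne_zero.2 fun h => hdet ?_
    rw [← hB', Matrix.det_mul, h, mul_zero]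
  have h1 : Q' * Q'⁻¹ = 1 := Matrix.mul_nonsing_inv _ hQ
  have h2 : Q'⁻¹ * Q' = 1 := Matrix.nonsing_inv_mul _ hQ
  have h3 : (Q'⁻¹)ᵀ * Q'ᵀ = 1 := by rw [← Matrix.transpose_mul, h1, Matrix.transpose_one]
  set K := Q' * M * Q'⁻¹ with hK
  have hK' : Kᵀ * J' * K = J' := by
    calc _ = (Q'⁻¹)ᵀ * (Mᵀ * (Q'ᵀ * J' * Q') * M) * Q'⁻¹ := by
          rw [hK]; simp only [Matrix.transpose_mul, Matrix.mul_assoc]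
      _ = ((Q'⁻¹)ᵀ * Q'ᵀ) * J' * (Q' * Q'⁻¹) := by
          rw [hB', hM, ← hB']; simp only [Matrix.mul_assoc]
      _ = J' := by rw [h3, h1, Matrix.one_mul, Matrix.mul_one]
  have hmem : K.submatrix e.symm e.symm ∈ Matrix.symplecticGroup l ℝ := by
    rw [SymplecticGroup.mem_iff']
    have hJ : Matrix.J l ℝ = J'.submatrix e.symm e.symm := by
      rw [hJ', Matrix.submatrix_submatrix]; simp
    rw [hJ, Matrix.transpose_submatrix, Matrix.submatrix_mul_equiv, Matrix.submatrix_mul_equiv, hK']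
  have h4 := SymplecticGroup.det_eq_one hmem
  rw [Matrix.det_submatrix_equiv_self, hK, Matrix.det_mul, Matrix.det_mul] at h4
  have h5 : Q'.det * Q'⁻¹.det = 1 := by rw [← Matrix.det_mul, h1, Matrix.det_one]
  linear_combination h4 - M.det * h5

/-! ### The bordered skew form -/

/-- The skew form `J X`, bordered by a vector. -/
def skewBord {n : ℕ} (X : Mat n) (w : Ix n → ℝ) : Matrix (Ix n ⊕ Unit) (Ix n ⊕ Unit) ℝ :=
  Matrix.fromBlocks (Jm n * X) (replicateCol Unit (Jm n *ᵥ w)) (-replicateRow Unit (Jm n *ᵥ w)) 0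

theorem IsLor.skewBord_congr {n : ℕ} {k : Mat n} (hk : IsLor k) {X X' : Mat n}
    (hX : k * X = X' * k) (w : Ix n → ℝ) :
    (Matrix.fromBlocks k 0 0 (1 : Matrix Unit Unit ℝ))ᵀ * skewBord X' (k *ᵥ w) *
      Matrix.fromBlocks k 0 0 1 = skewBord X w := by
  have h1 : kᵀ * (Jm n * X') * k = Jm n * X := by
    calc _ = kᵀ * Jm n * (X' * k) := by simp only [Matrix.mul_assoc]
      _ = kᵀ * Jm n * k * X := by rw [← hX]; simp only [Matrix.mul_assoc]
      _ = _ := by rw [hk]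
  have h2 : kᵀ *ᵥ (Jm n *ᵥ (k *ᵥ w)) = Jm n *ᵥ w := by
    rw [Matrix.mulVec_mulVec, Matrix.mulVec_mulVec, hk]
  rw [skewBord, skewBord, Matrix.fromBlocks_transpose, Matrix.fromBlocks_multiply,
    Matrix.fromBlocks_multiply]
  simp only [Matrix.transpose_zero, Matrix.transpose_one, Matrix.zero_mul, Matrix.mul_zero,
    Matrix.one_mul, Matrix.mul_one, add_zero, zero_add, h1, Matrix.neg_mul,
    ← Matrix.replicateCol_mulVec, ← Matrix.replicateRow_vecMul, h2]
  rw [← Matrix.mulVec_transpose, h2]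
  simp

/-- Here the two terms of `nX_eq` are mutually transposed, so one unipotent congruence produces
both. Having determinant one, it does not affect the sign that is to be detected. -/
theorem skewBord_add_nX {n : ℕ} (X : Mat n) (γ : Tr n → ℝ) :
    (Matrix.fromBlocks 1 0 (replicateRow Unit (Jm n *ᵥ vc γ 0 0)) (1 : Matrix Unit Unit ℝ))ᵀ *
      skewBord X (v₀ n) * Matrix.fromBlocks 1 0 (replicateRow Unit (Jm n *ᵥ vc γ 0 0)) 1 =
      skewBord (X + nX γ) (v₀ n) := by
  have h : ∀ u v : Ix n → ℝ, Jm n * vecMulVec u v = vecMulVec (Jm n *ᵥ u) v :=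
    fun u v => Matrix.mul_vecMulVec _ _ _
  rw [skewBord, skewBord, Matrix.fromBlocks_transpose, Matrix.fromBlocks_multiply,
    Matrix.fromBlocks_multiply, nX_eq, Matrix.mul_add, Matrix.mul_sub, h, h]
  simp [← Matrix.vecMulVec_eq]
  abel

/-- Explicit Darboux covectors: one pair for each rotation plane, one for the boost plane, and one
that couples the kernel coordinate of the base point to the border. No condition on `ζ` is needed,
since the last pair may degenerate. -/
theorem exists_darboux {n : ℕ} {a : Fin (n - 1) → ℝ} {c : ℝ} (ha : ∀ i, a i ≠ 0) (hc : c ≠ 0)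
    (ζ : Tr n → ℝ) (p r : ℝ) :
    ∃ Q : Matrix ((Fin (n - 1) ⊕ (Unit ⊕ Unit)) ⊕ (Fin (n - 1) ⊕ (Unit ⊕ Unit))) (Ix n ⊕ Unit) ℝ,
      Qᵀ * Matrix.J (Fin (n - 1) ⊕ (Unit ⊕ Unit)) ℝ * Q = skewBord (tPrime a c : Mat n) (vc ζ p r) := by
  let A : Fin (n - 1) ⊕ (Unit ⊕ Unit) → (Ix n ⊕ Unit) → ℝ := Sum.elim
    (fun i => Sum.elim (vc (Pi.single (.inl (0, i)) (a i)) 0 0) fun _ => -ζ (.inl (1, i)))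
    (Sum.elim (fun _ => Sum.elim (vc 0 c 0) fun _ => r)
      fun _ => Sum.elim (vc (Pi.single (.inr ()) (ζ (.inr ()))) 0 0) fun _ => 0)
  let B : Fin (n - 1) ⊕ (Unit ⊕ Unit) → (Ix n ⊕ Unit) → ℝ := Sum.elim
    (fun i => Sum.elim (vc (Pi.single (.inl (1, i)) 1) 0 0) fun _ => ζ (.inl (0, i)) / a i)
    (Sum.elim (fun _ => Sum.elim (vc 0 0 1) fun _ => p / c)
      fun _ => Sum.elim (vc 0 0 0) fun _ => 1)
  -- `B` comes first because `Matrix.J` has the block `-1` in its upper right corner.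
  let Q : Matrix ((Fin (n - 1) ⊕ (Unit ⊕ Unit)) ⊕ (Fin (n - 1) ⊕ (Unit ⊕ Unit))) (Ix n ⊕ Unit) ℝ :=
    Matrix.of (Sum.elim B A)
  refine ⟨Q, ?_⟩
  have h : Qᵀ * Matrix.J (Fin (n - 1) ⊕ (Unit ⊕ Unit)) ℝ * Q =
      Matrix.of fun x y => ∑ l, (A l x * B l y - B l x * A l y) := by
    ext x y
    rw [Matrix.mul_assoc]
    simp [Q, Matrix.mul_apply, Matrix.J, Fintype.sum_sum_type, Matrix.one_apply,
      Finset.sum_sub_distrib]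
    ring
  rw [h, skewBord, tPrime_coe, gM, Jm_eq_blk, blk_mul]
  have hJ : (blk 1 0 0 0 0 1 0 0 (-1) : Mat n) *ᵥ vc ζ p r = vc ζ p (-r) := by
    rw [blk_mulVec_vc, vc_inj]; simp
  rw [hJ]
  ext x y
  rw [Matrix.of_apply, Fintype.sum_sum_type, Fintype.sum_sum_type]
  rcases x with (((⟨k, i⟩ | x) | x) | x) | x <;> rcases y with (((⟨l, j⟩ | y) | y) | y) | y
  · fin_cases k <;> fin_cases l <;> by_cases hij : i = j <;>
      simp [A, B, vc, blk, skewDiag, Pi.single_apply, Matrix.blockDiagonal_apply, hij, eq_comm]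
  all_goals try fin_cases k
  all_goals try fin_cases l
  all_goals simp [A, B, vc, blk, skewDiag, Pi.single_apply, hc, mul_div_cancel₀, ha]
  rw [Finset.sum_eq_zero fun i _ => by ring]
  ring

theorem tPrime_mulVec_vc {n : ℕ} (a : Fin (n - 1) → ℝ) (c : ℝ) (ζ : Tr n → ℝ) (p r : ℝ) :
    (tPrime a c : Mat n) *ᵥ vc ζ p r = vc (skewDiag a *ᵥ ζ) (c * r) (c * p) := by
  rw [tPrime_coe, gM, blk_mulVec_vc, vc_inj]
  simp

theorem eq_single_of_tPrime_mulVec {n : ℕ} {a : Fin (n - 1) → ℝ} {c : ℝ} (ha : ∀ i, a i ≠ 0)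
    (hc : c ≠ 0) {y : Ix n → ℝ} (h : (tPrime a c : Mat n) *ᵥ y = 0) :
    y = y (.inl (.inl (.inr ()))) • vc (eLast n) 0 0 := by
  obtain ⟨ζ, p, r, rfl⟩ := exists_vc y
  have h0 : (0 : Ix n → ℝ) = vc 0 0 0 := by ext i; rcases i with (i | i) | i <;> rfl
  rw [tPrime_mulVec_vc, h0, vc_inj] at h
  rw [smul_vc, vc_inj]
  refine ⟨?_, ?_, ?_⟩
  · ext k
    rcases k with ⟨k, i⟩ | k
    · fin_cases k
      · have := congrFun h.1 (.inl (1, i))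
        rw [skewDiag_mulVec_one] at this
        simpa [ha, eLast] using this
      · have := congrFun h.1 (.inl (0, i))
        rw [skewDiag_mulVec_zero] at this
        simpa [ha, eLast] using this
    · simp [eLast, vc]
  · simpa [hc] using h.2.2
  · simpa [hc] using h.2.1

/-- For a kernel vector `(z, t)` one has `T z = -t w`. The last transversal coordinate of `T z`
vanishes while that of `w` does not, so `t = 0`. Then `z` lies on the kernel line of `T`, which `w`
does not annihilate. -/
theorem det_skewBord_ne_zero {n : ℕ} {a : Fin (n - 1) → ℝ} {c : ℝ} (ha : ∀ i, a i ≠ 0)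
    (hc : c ≠ 0) {ζ : Tr n → ℝ} {p r : ℝ} (hs : ζ (.inr ()) ≠ 0) :
    (skewBord (tPrime a c : Mat n) (vc ζ p r)).det ≠ 0 := by
  intro hdet
  obtain ⟨y, hy, hy0⟩ := Matrix.exists_mulVec_eq_zero_iff.2 hdet
  obtain ⟨z, t, rfl⟩ : ∃ z t, y = Sum.elim z fun _ : Unit => t :=
    ⟨fun i => y (.inl i), y (.inr ()), by ext i; rcases i with i | i <;> rfl⟩
  rw [skewBord, Matrix.fromBlocks_mulVec] at hy0
  have h1 : (Jm n * (tPrime a c : Mat n)) *ᵥ z + t • (Jm n *ᵥ vc ζ p r) = 0 := by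
    ext i
    have := congrFun hy0 (.inl i)
    simp only [Sum.elim_inl] at this
    rw [Pi.zero_apply] at this ⊢
    rw [← this, Pi.add_apply, Pi.add_apply]
    congr 1
    simp [Matrix.mulVec, dotProduct, mul_comm]
  have h2 : lor (vc ζ p r) z = 0 := by
    have := congrFun hy0 (.inr ())
    simp only [Sum.elim_inr] at this
    rw [lor_comm, lor, dotProduct_comm]
    have e : (-replicateRow Unit (Jm n *ᵥ vc ζ p r) *ᵥ z) () =
      -((Jm n *ᵥ vc ζ p r) ⬝ᵥ z) := by
      rw [Matrix.neg_mulVec]; rfl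
    have e' : (Sum.elim z fun _ : Unit => t) ∘ Sum.inl = z := rfl
    rw [e', Pi.add_apply, e] at this
    simpa using this
  have h3 : (tPrime a c : Mat n) *ᵥ z = (-t) • vc ζ p r := by
    have := congrArg (Jm n *ᵥ ·) h1
    simp only [Matrix.mulVec_add, Matrix.mulVec_smul, Matrix.mulVec_mulVec, ← Matrix.mul_assoc,
      Jm_mul_Jm, Matrix.one_mul, Matrix.one_mulVec, Matrix.mulVec_zero] at this
    rw [neg_smul]
    exact eq_neg_of_add_eq_zero_left this
  have ht : t = 0 := by
    obtain ⟨ζ', p', r', rfl⟩ := exists_vc z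
    rw [tPrime_mulVec_vc, smul_vc, vc_inj] at h3
    have := congrFun h3.1 (.inr ())
    rw [skewDiag_mulVec_last] at this
    simpa [hs] using this
  rw [ht, neg_zero, zero_smul] at h3
  have h4 := eq_single_of_tPrime_mulVec ha hc h3
  have h5 : z (.inl (.inl (.inr ()))) = 0 := by
    rw [h4, lor_smul, lor_vc] at h2
    simpa [eLast, hs] using h2
  refine hy ?_
  rw [h4, h5, ht]
  ext i
  rcases i with i | i <;> simp

/-- Two elements of `𝔤` that differ by `𝔫` and are conjugate to the base point are not conjugate by a
Lorentz matrix of determinant `-1` that fixes `v₀`, unless the null vector is degenerate. -/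
theorem det_eq_one_of_conj_add_nX {n : ℕ} {a : Fin (n - 1) → ℝ} {c : ℝ} (ha : ∀ i, a i ≠ 0)
    (hc : c ≠ 0) {k g : Mat n} (hk : IsLor k) (hg : IsLor g) {X : Mat n} {γ : Tr n → ℝ}
    {ζ : Tr n → ℝ} {p r : ℝ} (hs : ζ (.inr ()) ≠ 0) (hX : g * (tPrime a c : Mat n) = X * g)
    (hw : g *ᵥ vc ζ p r = v₀ n) (hkX : k * X = (X + nX γ) * k) (hkv : k *ᵥ v₀ n = v₀ n) :
    k.det = 1 := by
  have h1 := hk.skewBord_congr hkX (v₀ n)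
  rw [hkv, ← skewBord_add_nX] at h1
  have h2 := hg.skewBord_congr hX (vc ζ p r)
  rw [hw] at h2
  set U : Matrix (Ix n ⊕ Unit) (Ix n ⊕ Unit) ℝ :=
    Matrix.fromBlocks 1 0 (replicateRow Unit (Jm n *ᵥ vc γ 0 0)) (1 : Matrix Unit Unit ℝ) with hU
  set K : Matrix (Ix n ⊕ Unit) (Ix n ⊕ Unit) ℝ :=
    Matrix.fromBlocks k 0 0 (1 : Matrix Unit Unit ℝ) with hK
  set G : Matrix (Ix n ⊕ Unit) (Ix n ⊕ Unit) ℝ :=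
    Matrix.fromBlocks g 0 0 (1 : Matrix Unit Unit ℝ) with hG
  obtain ⟨G', hG1⟩ : ∃ G' : Matrix (Ix n ⊕ Unit) (Ix n ⊕ Unit) ℝ, G * G' = 1 :=
    ⟨Matrix.fromBlocks (Jm n * gᵀ * Jm n) 0 0 1, by
      rw [hG, Matrix.fromBlocks_multiply, hg.mul_inv]; simp⟩
  have hG3 : G'ᵀ * Gᵀ = 1 := by rw [← Matrix.transpose_mul, hG1, Matrix.transpose_one]
  set S := skewBord X (v₀ n) with hS
  -- Conjugation by `k` is undone up to `𝔫`, and `U` accounts for that part; together they are an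
  -- isometry of the skew form.
  have hL : (U * K)ᵀ * S * (U * K) = S := by
    refine Eq.trans ?_ h1
    simp only [Matrix.transpose_mul, Matrix.mul_assoc]
  have hS' : S = G'ᵀ * skewBord (tPrime a c : Mat n) (vc ζ p r) * G' := by
    rw [← h2]
    calc S = (G'ᵀ * Gᵀ) * S * (G * G') := by rw [hG3, hG1, Matrix.one_mul, Matrix.mul_one]
      _ = _ := by simp only [Matrix.mul_assoc]
  obtain ⟨Q, hQ⟩ := exists_darboux ha hc ζ p r
  have e : (Ix n ⊕ Unit) ≃ (Fin (n - 1) ⊕ (Unit ⊕ Unit)) ⊕ (Fin (n - 1) ⊕ (Unit ⊕ Unit)) :=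
    Fintype.equivOfCardEq (by simp; ring)
  have hdet : (U * K).det = 1 := by
    refine det_eq_one_of_congr e (Q := Q * G') (B := S) ?_ ?_ hL
    · rw [hS', ← hQ]
      simp only [Matrix.transpose_mul, Matrix.mul_assoc]
    · rw [hS', Matrix.det_mul, Matrix.det_mul, Matrix.det_transpose]
      have hne : G'.det ≠ 0 := by
        intro h0
        have := congrArg Matrix.det hG1
        rw [Matrix.det_mul, h0, mul_zero, Matrix.det_one] at this
        norm_num at this
      exact mul_ne_zero (mul_ne_zero hne (det_skewBord_ne_zero ha hc hs)) hne
  rw [Matrix.det_mul, hU, hK, Matrix.det_fromBlocks_zero₁₂, Matrix.det_fromBlocks_zero₂₁] at hdet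
  simpa using hdet

/-! ### Injectivity of the moment map on `P`-orbits -/

theorem exists_rotation {x y x' y' : ℝ} (h : x ^ 2 + y ^ 2 = x' ^ 2 + y' ^ 2) :
    ∃ P Q : ℝ, P ^ 2 + Q ^ 2 = 1 ∧ P * x + Q * y = x' ∧ -(Q * x) + P * y = y' := by
  by_cases h0 : x ^ 2 + y ^ 2 = 0
  · have hx : x = 0 := by nlinarith [sq_nonneg x, sq_nonneg y]
    have hy : y = 0 := by nlinarith [sq_nonneg x, sq_nonneg y]
    have hx' : x' = 0 := by nlinarith [sq_nonneg x', sq_nonneg y']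
    have hy' : y' = 0 := by nlinarith [sq_nonneg x', sq_nonneg y']
    exact ⟨1, 0, by simp, by simp [hx, hx'], by simp [hy, hy']⟩
  · refine ⟨(x * x' + y * y') / (x ^ 2 + y ^ 2), (y * x' - x * y') / (x ^ 2 + y ^ 2), ?_, ?_, ?_⟩
    · field_simp
      linear_combination (-(x ^ 2 + y ^ 2)) * h
    · field_simp; ring
    · field_simp; ring

/-- In light-cone coordinates a boost scales `r + p` and `r - p` by `exp t` and `exp (-t)`. Their
product does not tell which of them vanishes on the cone, whence the hypothesis `h0`. -/
theorem exists_boost {p r p' r' : ℝ} (h : r ^ 2 - p ^ 2 = r' ^ 2 - p' ^ 2) (hr : 0 < r)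
    (hr' : 0 < r') (hD : 0 ≤ r ^ 2 - p ^ 2) (h0 : p + r = 0 ↔ p' + r' = 0) :
    ∃ t : ℝ, Real.cosh t * p + Real.sinh t * r = p' ∧ Real.sinh t * p + Real.cosh t * r = r' := by
  suffices H : ∃ t : ℝ, Real.exp t * (r + p) = r' + p' ∧ Real.exp (-t) * (r - p) = r' - p' by
    obtain ⟨t, h1, h2⟩ := H
    refine ⟨t, ?_, ?_⟩ <;> rw [Real.cosh_eq, Real.sinh_eq] <;> linarith
  have hle : -r ≤ p ∧ p ≤ r := abs_le.1 (abs_le_of_sq_le_sq (by linarith) hr.le)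
  have hle' : -r' ≤ p' ∧ p' ≤ r' := abs_le.1 (abs_le_of_sq_le_sq (by linarith) hr'.le)
  by_cases hp : p + r = 0
  · have hp' := h0.1 hp
    refine ⟨Real.log (r / r'), ?_, ?_⟩
    · rw [show r + p = 0 by linarith, show r' + p' = 0 by linarith, mul_zero]
    · rw [Real.exp_neg, Real.exp_log (div_pos hr hr')]
      rw [show p = -r by linarith, show p' = -r' by linarith]
      field_simp
  · have hp' : p' + r' ≠ 0 := fun h => hp (h0.2 h)
    have h1 : 0 < r + p := lt_of_le_of_ne (by linarith) (by rw [add_comm]; exact Ne.symm hp)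
    have h2 : 0 < r' + p' := lt_of_le_of_ne (by linarith) (by rw [add_comm]; exact Ne.symm hp')
    refine ⟨Real.log ((r' + p') / (r + p)), ?_, ?_⟩
    · rw [Real.exp_log (div_pos h2 h1)]
      field_simp
    · rw [Real.exp_neg, Real.exp_log (div_pos h2 h1)]
      field_simp
      linear_combination h

/-! ### The centralizer of the base point -/

/-- Elements of the centralizer of `tPrime a c`: block rotations. -/
def rotM {n : ℕ} (P Q : Fin (n - 1) → ℝ) : Matrix (Tr n) (Tr n) ℝ :=
  Matrix.fromBlocks (Matrix.blockDiagonal fun i => !![P i, Q i; -Q i, P i]) 0 0 1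

theorem rotM_transpose_mul {n : ℕ} {P Q : Fin (n - 1) → ℝ} (h : ∀ i, P i ^ 2 + Q i ^ 2 = 1) :
    (rotM P Q : Matrix (Tr n) (Tr n) ℝ)ᵀ * rotM P Q = 1 := by
  rw [rotM, Matrix.fromBlocks_transpose, Matrix.fromBlocks_multiply, Matrix.blockDiagonal_transpose,
    ← Matrix.blockDiagonal_mul]
  have : (fun i => (!![P i, Q i; -Q i, P i])ᵀ * !![P i, Q i; -Q i, P i]) =
      fun _ : Fin (n - 1) => (1 : Matrix (Fin 2) (Fin 2) ℝ) := by
    funext i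
    ext j k
    have := h i
    fin_cases j <;> fin_cases k <;> simp [Matrix.mul_apply] <;> linarith
  rw [this]
  have h1 : Matrix.blockDiagonal (fun _ : Fin (n - 1) => (1 : Matrix (Fin 2) (Fin 2) ℝ)) = 1 :=
    Matrix.blockDiagonal_one
  simp [h1]

theorem det_rotM {n : ℕ} {P Q : Fin (n - 1) → ℝ} (h : ∀ i, P i ^ 2 + Q i ^ 2 = 1) :
    (rotM P Q : Matrix (Tr n) (Tr n) ℝ).det = 1 := by
  rw [rotM, Matrix.det_fromBlocks_zero₂₁, Matrix.det_blockDiagonal, Matrix.det_one, mul_one]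
  refine Finset.prod_eq_one fun i _ => ?_
  rw [Matrix.det_fin_two_of, ← h i]
  ring

theorem rotM_mul_skewDiag {n : ℕ} (P Q a : Fin (n - 1) → ℝ) :
    (rotM P Q : Matrix (Tr n) (Tr n) ℝ) * skewDiag a = skewDiag a * rotM P Q := by
  rw [rotM, skewDiag, Matrix.fromBlocks_multiply, Matrix.fromBlocks_multiply,
    ← Matrix.blockDiagonal_mul, ← Matrix.blockDiagonal_mul]
  simp only [Matrix.zero_mul, Matrix.mul_zero, add_zero]
  congr 2
  funext i
  ext j k
  fin_cases j <;> fin_cases k <;> simp [mul_comm]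

theorem rotM_mulVec_zero {n : ℕ} (P Q : Fin (n - 1) → ℝ) (ζ : Tr n → ℝ) (i : Fin (n - 1)) :
    (rotM P Q *ᵥ ζ) (.inl (0, i)) = P i * ζ (.inl (0, i)) + Q i * ζ (.inl (1, i)) := by
  simp [rotM, Matrix.mulVec, dotProduct, Fintype.sum_sum_type, Fintype.sum_prod_type,
    Matrix.blockDiagonal_apply]

theorem rotM_mulVec_one {n : ℕ} (P Q : Fin (n - 1) → ℝ) (ζ : Tr n → ℝ) (i : Fin (n - 1)) :
    (rotM P Q *ᵥ ζ) (.inl (1, i)) = -(Q i * ζ (.inl (0, i))) + P i * ζ (.inl (1, i)) := by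
  simp [rotM, Matrix.mulVec, dotProduct, Fintype.sum_sum_type, Fintype.sum_prod_type,
    Matrix.blockDiagonal_apply]

theorem rotM_mulVec_last {n : ℕ} (P Q : Fin (n - 1) → ℝ) (ζ : Tr n → ℝ) :
    (rotM P Q *ᵥ ζ) (.inr ()) = ζ (.inr ()) := by
  simp [rotM, Matrix.mulVec, dotProduct, Fintype.sum_sum_type]

theorem dotProduct_self_Tr {n : ℕ} (ζ : Tr n → ℝ) : ζ ⬝ᵥ ζ =
    ∑ i, (ζ (.inl (0, i)) ^ 2 + ζ (.inl (1, i)) ^ 2) + ζ (.inr ()) ^ 2 := by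
  simp [dotProduct, Fintype.sum_sum_type, Fintype.sum_prod_type, Finset.sum_add_distrib, pow_two]

theorem mM_mul_tPrime {n : ℕ} {W : Matrix (Tr n) (Tr n) ℝ} {a : Fin (n - 1) → ℝ} (c : ℝ)
    (h : W * skewDiag a = skewDiag a * W) :
    mM W * (tPrime a c : Mat n) = (tPrime a c : Mat n) * mM W := by
  rw [tPrime_coe, gM, mM, blk_mul, blk_mul]
  simp [h]

theorem aMat_mul_tPrime {n : ℕ} (a : Fin (n - 1) → ℝ) (c t : ℝ) :
    (aMat t : Mat n) * (tPrime a c : Mat n) = (tPrime a c : Mat n) * aMat t := by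
  rw [tPrime_coe, gM, aMat, blk_mul, blk_mul]
  simp [mul_comm]

/-- The centralizer of `tPrime a c` acts transitively on null vectors with given invariants. -/
theorem exists_commute_tPrime {n : ℕ} (a : Fin (n - 1) → ℝ) (c : ℝ) {ζ ζ' : Tr n → ℝ}
    {p r p' r' : ℝ} (hw : lor (vc ζ p r) (vc ζ p r) = 0) (hw' : lor (vc ζ' p' r') (vc ζ' p' r') = 0)
    (hr : 0 < r) (hr' : 0 < r') (hz : ∀ i, ζ (.inl (0, i)) ^ 2 + ζ (.inl (1, i)) ^ 2 =
      ζ' (.inl (0, i)) ^ 2 + ζ' (.inl (1, i)) ^ 2) (hs : ζ (.inr ()) = ζ' (.inr ()))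
    (h0 : p + r = 0 ↔ p' + r' = 0) :
    ∃ h : Mat n, IsLor h ∧ h.det = 1 ∧ h * (tPrime a c : Mat n) = (tPrime a c : Mat n) * h ∧
      h *ᵥ vc ζ p r = vc ζ' p' r' := by
  rw [lor_vc] at hw hw'
  have hpos : 0 ≤ ζ ⬝ᵥ ζ := Finset.sum_nonneg fun i _ => mul_self_nonneg _
  have heq : ζ ⬝ᵥ ζ = ζ' ⬝ᵥ ζ' := by
    rw [dotProduct_self_Tr, dotProduct_self_Tr, hs, Finset.sum_congr rfl fun i _ => hz i]
  obtain ⟨t, ht1, ht2⟩ := exists_boost (p := p) (r := r) (p' := p') (r' := r')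
    (by linarith) hr hr' (by linarith) h0
  choose P Q hPQ h1 h2 using fun i => exists_rotation (hz i)
  refine ⟨mM (rotM P Q) * aMat t, (isLor_mM (rotM_transpose_mul hPQ)).mul (isLor_aMat t), ?_, ?_, ?_⟩
  · rw [Matrix.det_mul, det_mM, det_rotM hPQ, det_aMat, one_mul]
  · rw [Matrix.mul_assoc, aMat_mul_tPrime, ← Matrix.mul_assoc, mM_mul_tPrime c (rotM_mul_skewDiag ..),
      Matrix.mul_assoc]
  · rw [← Matrix.mulVec_mulVec, aMat, blk_mulVec_vc, mM, blk_mulVec_vc, vc_inj]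
    refine ⟨?_, by simpa using ht1, by simpa using ht2⟩
    simp only [Matrix.one_mulVec, smul_zero, add_zero]
    ext k
    rcases k with ⟨k, i⟩ | k
    · fin_cases k
      · simpa [h1] using rotM_mulVec_zero P Q ζ i
      · simpa [h2] using rotM_mulVec_one P Q ζ i
    · simpa [hs] using rotM_mulVec_last P Q ζ

/-- The reflection in the coordinate `x_{2n-1}`. -/
def sRefl (n : ℕ) : Matrix (Tr n) (Tr n) ℝ := Matrix.fromBlocks 1 0 0 (-1)

theorem sRefl_transpose_mul (n : ℕ) : (sRefl n)ᵀ * sRefl n = 1 := by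
  simp [sRefl, Matrix.fromBlocks_transpose, Matrix.fromBlocks_multiply]

theorem det_sRefl (n : ℕ) : (sRefl n).det = -1 := by
  simp [sRefl]

theorem sRefl_mul_skewDiag {n : ℕ} (a : Fin (n - 1) → ℝ) :
    sRefl n * skewDiag a = skewDiag a * sRefl n := by
  simp [sRefl, skewDiag, Matrix.fromBlocks_multiply]

theorem sRefl_mulVec_inl {n : ℕ} (ζ : Tr n → ℝ) (k : Fin 2 × Fin (n - 1)) :
    (sRefl n *ᵥ ζ) (.inl k) = ζ (.inl k) := by
  simp [sRefl, Matrix.mulVec, dotProduct, Fintype.sum_sum_type, Matrix.one_apply]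

theorem sRefl_mulVec_inr {n : ℕ} (ζ : Tr n → ℝ) :
    (sRefl n *ᵥ ζ) (.inr ()) = -ζ (.inr ()) := by
  simp [sRefl, Matrix.mulVec, dotProduct, Fintype.sum_sum_type]

theorem nX_mulVec_v₀ {n : ℕ} (γ : Tr n → ℝ) : (nX γ : Mat n) *ᵥ v₀ n = 0 := by
  have h0 : (0 : Ix n → ℝ) = vc 0 0 0 := by ext i; rcases i with (i | i) | i <;> rfl
  rw [nX, v₀_eq, blk_mulVec_vc, h0, vc_inj]
  simp

theorem rho_mulVec_inr_pos {n : ℕ} (g : SpinG n) : 0 < (rho n g *ᵥ v₀ n) (.inr ()) := by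
  have h1 : (rho n g *ᵥ v₀ n) (.inr ()) =
      rho n g (.inr ()) (.inl (.inr ())) + rho n g (.inr ()) (.inr ()) := by
    simp [v₀, Matrix.mulVec, dotProduct, Fintype.sum_sum_type]
  have h2 := (isLor_rho g).row_zero
  have h3 : rho n g (.inr ()) (.inl (.inr ())) ^ 2 ≤ ∑ i : Sp n, rho n g (.inr ()) (.inl i) ^ 2 :=
    Finset.single_le_sum (f := fun i : Sp n => rho n g (.inr ()) (.inl i) ^ 2)
      (fun i _ => sq_nonneg _) (Finset.mem_univ _)
  have h4 := rho_zero_zero_pos g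
  rw [h1]
  nlinarith

theorem lor_rho_v₀ {n : ℕ} (g : SpinG n) : lor (rho n g *ᵥ v₀ n) (rho n g *ᵥ v₀ n) = 0 := by
  rw [(isLor_rho g).lor_map, v₀_eq, lor_vc]
  simp

/-- The null vector `g⁻¹ v₀` attached to `Ad g T`. -/
theorem exists_vc_rho_inv {n : ℕ} (g : SpinG n) : ∃ ζ p r, rho n g *ᵥ vc ζ p r = v₀ n ∧ 0 < r ∧
    lor (vc ζ p r) (vc ζ p r) = 0 := by
  obtain ⟨ζ, p, r, h⟩ := exists_vc (rho n g⁻¹ *ᵥ v₀ n)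
  refine ⟨ζ, p, r, ?_, ?_, ?_⟩
  · rw [← h, Matrix.mulVec_mulVec, rho_mul_inv, Matrix.one_mulVec]
  · have := rho_mulVec_inr_pos g⁻¹
    rwa [h] at this
  · rw [← h, lor_rho_v₀]

/-- When `ζ = 0` all weights vanish and `bdet` cannot separate `p = r` from `p = -r`. The eigenvalue
on `v₀` does, and it too depends only on the restriction to `𝔭`. -/
theorem conj_tPrime_mulVec_v₀_iff {n : ℕ} {a : Fin (n - 1) → ℝ} {c : ℝ} (hc : c ≠ 0) {g : SpinG n}
    {ζ : Tr n → ℝ} {p r : ℝ} (hg : rho n g *ᵥ vc ζ p r = v₀ n)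
    (hw : lor (vc ζ p r) (vc ζ p r) = 0) :
    (rho n g * (tPrime a c : Mat n) * rho n g⁻¹) *ᵥ v₀ n = (-c) • v₀ n ↔ p + r = 0 := by
  have h1 : (rho n g * (tPrime a c : Mat n) * rho n g⁻¹) *ᵥ v₀ n =
      rho n g *ᵥ ((tPrime a c : Mat n) *ᵥ vc ζ p r) := by
    rw [← hg, Matrix.mulVec_mulVec, Matrix.mul_assoc, rho_inv_mul, Matrix.mul_one,
      Matrix.mulVec_mulVec]
  have h2 : (-c) • v₀ n = rho n g *ᵥ ((-c) • vc ζ p r) := by rw [Matrix.mulVec_smul, hg]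
  have hinj : ∀ x y : Ix n → ℝ, rho n g *ᵥ x = rho n g *ᵥ y ↔ x = y := fun x y => by
    refine ⟨fun h => ?_, fun h => by rw [h]⟩
    have := congrArg (rho n g⁻¹ *ᵥ ·) h
    simpa only [Matrix.mulVec_mulVec, rho_inv_mul, Matrix.one_mulVec] using this
  rw [h1, h2, hinj, tPrime_mulVec_vc, smul_vc, vc_inj]
  constructor
  · rintro ⟨-, h, -⟩
    have : c * (p + r) = 0 := by linarith
    simpa [hc] using this
  · intro h
    have hp : p = -r := by linarith
    rw [lor_vc, hp] at hw
    have hζ : ζ = 0 := dotProduct_self_eq_zero.1 (by linarith)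
    refine ⟨by rw [hζ]; simp, ?_, ?_⟩ <;> rw [hp] <;> ring

/-- Two elements of the orbit with the same restriction to `𝔭` are conjugate under `P`. -/
theorem exists_ParP_conj {n : ℕ} {a : Fin (n - 1) → ℝ} (ha : StrictAnti a) (ha₀ : ∀ i, 0 < a i)
    {c : ℝ} (hc : 0 < c) {g g' : SpinG n} {γ : Tr n → ℝ}
    (h : rho n g' * (tPrime a c : Mat n) * rho n g'⁻¹ =
      rho n g * (tPrime a c : Mat n) * rho n g⁻¹ + nX γ) :
    ∃ x : ParP n, Ad n x (Ad n g (tPrime a c)) = Ad n g' (tPrime a c) := by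
  obtain ⟨ζ, p, r, hg, hr, hw⟩ := exists_vc_rho_inv g
  obtain ⟨ζ', p', r', hg', hr', hw'⟩ := exists_vc_rho_inv g'
  set T : Mat n := (tPrime a c : Mat n) with hT
  have hb : ∀ x : ℝ, bdet T (vc ζ p r) x = bdet T (vc ζ' p' r') x := by
    intro x
    rw [← (isLor_rho g).bdet_conj (rho_mul_inv g) T,
      ← (isLor_rho g').bdet_conj (rho_mul_inv g') T (vc ζ' p' r'), hg, hg', h, bdet_add_nX]
  obtain ⟨hm, hm₀⟩ := interPoly_unique ha ha₀ c fun x hx hxc =>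
    (bdet_tPrime a c ζ p r hw hx hxc).symm.trans
      ((hb x).trans (bdet_tPrime a c ζ' p' r' hw' hx hxc))
  have hz : ∀ i, ζ (.inl (0, i)) ^ 2 + ζ (.inl (1, i)) ^ 2 =
      ζ' (.inl (0, i)) ^ 2 + ζ' (.inl (1, i)) ^ 2 := fun i =>
    mul_left_cancel₀ (b := ζ (.inl (0, i)) ^ 2 + ζ (.inl (1, i)) ^ 2)
      (by have := sq_nonneg (a i); positivity : a i ^ 2 + c ^ 2 ≠ 0) (congrFun hm i)
  have hss : ζ (.inr ()) ^ 2 = ζ' (.inr ()) ^ 2 :=     mul_left_cancel₀ (by positivity : c ^ 2 ≠ 0) hm₀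
  have h0 : p + r = 0 ↔ p' + r' = 0 := by
    rw [← conj_tPrime_mulVec_v₀_iff (a := a) hc.ne' hg hw,
      ← conj_tPrime_mulVec_v₀_iff (a := a) hc.ne' hg' hw', h, Matrix.add_mulVec, nX_mulVec_v₀,
      add_zero]
  -- A matrix commuting with `T` that matches the two null vectors becomes, between `g` and `g'`, a
  -- matrix fixing `v₀` that conjugates one orbit element to the other.
  have key : ∀ k : Mat n, IsLor k → k * T = T * k → k *ᵥ vc ζ p r = vc ζ' p' r' →
      IsLor (rho n g' * k * rho n g⁻¹) ∧ (rho n g' * k * rho n g⁻¹).det = k.det ∧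
      (rho n g' * k * rho n g⁻¹) *ᵥ v₀ n = v₀ n ∧
      (rho n g' * k * rho n g⁻¹) * (rho n g * T * rho n g⁻¹) =
        (rho n g' * T * rho n g'⁻¹) * (rho n g' * k * rho n g⁻¹) := by
    intro k hk hkT hkw
    refine ⟨((isLor_rho g').mul hk).mul (isLor_rho g⁻¹), ?_, ?_, ?_⟩
    · rw [Matrix.det_mul, Matrix.det_mul, det_rho, det_rho, one_mul, mul_one]
    · rw [← hg, Matrix.mulVec_mulVec, Matrix.mul_assoc, rho_inv_mul, Matrix.mul_one,
        ← Matrix.mulVec_mulVec, hkw, hg', hg]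
    · calc _ = rho n g' * (k * ((rho n g⁻¹ * rho n g) * (T * rho n g⁻¹))) := by
            simp only [Matrix.mul_assoc]
        _ = rho n g' * ((k * T) * rho n g⁻¹) := by
            rw [rho_inv_mul, Matrix.one_mul, Matrix.mul_assoc k]
        _ = rho n g' * (T * ((rho n g'⁻¹ * rho n g') * (k * rho n g⁻¹))) := by
            rw [hkT, rho_inv_mul, Matrix.one_mul, Matrix.mul_assoc T]
        _ = _ := by simp only [Matrix.mul_assoc]
  -- With opposite nonzero signs, composing with `sRefl` still matches the vectors, but at
  -- determinant `-1`, which the bordered skew form excludes.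
  have hs : ζ (.inr ()) = ζ' (.inr ()) := by
    by_contra hne
    have hneg : ζ (.inr ()) = -ζ' (.inr ()) := (sq_eq_sq_iff_eq_or_eq_neg.1 hss).resolve_left hne
    have hs0 : ζ (.inr ()) ≠ 0 := fun h0 => hne (by
      rw [h0] at hneg; rw [h0]; linarith)
    have hww : vc (sRefl n *ᵥ ζ) p r = mM (sRefl n) *ᵥ vc ζ p r := by
      rw [mM, blk_mulVec_vc, vc_inj]; simp
    have hL := isLor_mM (sRefl_transpose_mul n)
    obtain ⟨k, hk, hkd, hkT, hkw⟩ := exists_commute_tPrime a c (ζ := sRefl n *ᵥ ζ) (p := p) (r := r)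
      (by rw [hww, hL.lor_map, hw]) hw' hr hr' (fun i => by
        rw [sRefl_mulVec_inl, sRefl_mulVec_inl, hz]) (by rw [sRefl_mulVec_inr, hneg, neg_neg]) h0
    rw [hww, Matrix.mulVec_mulVec] at hkw
    obtain ⟨h1, h2, h3, h4⟩ := key (k * mM (sRefl n)) (hk.mul hL) (by
      rw [Matrix.mul_assoc, mM_mul_tPrime c (sRefl_mul_skewDiag a), ← Matrix.mul_assoc, hkT,
        Matrix.mul_assoc]) hkw
    rw [h] at h4
    have h5 := det_eq_one_of_conj_add_nX (a := a) (c := c) (fun i => (ha₀ i).ne') hc.ne' h1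
      (isLor_rho g) hs0 (by rw [Matrix.mul_assoc, rho_inv_mul, Matrix.mul_one]) hg h4 h3
    rw [h2, Matrix.det_mul, hkd, det_mM, det_sRefl] at h5
    norm_num at h5
  obtain ⟨k, hk, hkd, hkT, hkw⟩ := exists_commute_tPrime a c hw hw' hr hr' hz hs h0
  obtain ⟨h1, h2, h3, h4⟩ := key k hk hkT hkw
  obtain ⟨x, hx⟩ := exists_mem_ParP_of_mulVec_v₀ h1 (h2.trans hkd) h3
  refine ⟨x, Subtype.ext ?_⟩
  rw [Ad_coe, Ad_coe, Ad_coe, hx, h4, ← hx, Matrix.mul_assoc, rho_mul_inv, Matrix.mul_one]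

theorem exists_ParP_of_q_eq {n : ℕ} {a : Fin (n - 1) → ℝ} (ha : StrictAnti a) (ha₀ : ∀ i, 0 < a i)
    {c : ℝ} (hc : 0 < c) {φ ψ : Module.Dual ℝ (gLie n)} (hφ : φ ∈ orbit (coad n) (iota (tPrime a c)))
    (hψ : ψ ∈ orbit (coad n) (iota (tPrime a c))) (h : q n φ = q n ψ) :
    ∃ x : ParP n, coadGP n x φ = ψ := by
  obtain ⟨g, rfl⟩ := mem_orbit_iota.1 hφ
  obtain ⟨g', rfl⟩ := mem_orbit_iota.1 hψ
  obtain ⟨γ, hγ⟩ := (q_iota_eq_iff _ _).1 h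
  obtain ⟨x, hx⟩ := exists_ParP_conj ha ha₀ hc hγ
  exact ⟨x, by rw [coadGP_iota, hx]⟩

theorem coadGP_mem_orbit {n : ℕ} {f φ : Module.Dual ℝ (gLie n)} (hφ : φ ∈ orbit (coad n) f)
    (x : ParP n) : coadGP n x φ ∈ orbit (coad n) f := by
  obtain ⟨g, rfl⟩ := hφ
  exact ⟨x * g, by simp [map_mul]⟩

theorem orbit_coadGP_eq_of_orbit_q_eq {n : ℕ} {a : Fin (n - 1) → ℝ} (ha : StrictAnti a)
    (ha₀ : ∀ i, 0 < a i) {c : ℝ} (hc : 0 < c) {φ ψ : Module.Dual ℝ (gLie n)}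
    (hφ : φ ∈ orbit (coad n) (iota (tPrime a c))) (hψ : ψ ∈ orbit (coad n) (iota (tPrime a c)))
    (h : orbit (coadP n) (q n φ) = orbit (coadP n) (q n ψ)) :
    orbit (coadGP n) φ = orbit (coadGP n) ψ := by
  obtain ⟨x, hx⟩ : q n ψ ∈ orbit (coadP n) (q n φ) := h ▸ mem_orbit_self _ _
  obtain ⟨y, hy⟩ := exists_ParP_of_q_eq ha ha₀ hc (coadGP_mem_orbit hφ x) hψ
    ((q_equivariant x φ).trans hx)
  refine (orbit_eq_of_mem _ ⟨y * x, ?_⟩).symm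
  rw [← hy]
  simp only [map_mul]
  rfl

theorem nonempty_unique_reducedSpace {n : ℕ} {a : Fin (n - 1) → ℝ} (ha : StrictAnti a)
    (ha₀ : ∀ i, 0 < a i) {c : ℝ} (hc : 0 < c) (g : SpinG n) :
    Nonempty (Unique (ReducedSpace (orbit (coad n) (iota (tPrime a c)))
      (q n (coad n g (iota (tPrime a c)))))) := by
  refine ⟨⟨⟨Quotient.mk _ ⟨coad n g (iota (tPrime a c)), ⟨g, rfl⟩, rfl⟩⟩, fun z => ?_⟩⟩
  induction z using Quotient.inductionOn with
  | h φ =>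
    refine Quotient.sound ?_
    obtain ⟨x, hx⟩ := exists_ParP_of_q_eq ha ha₀ hc φ.2.1 (ψ := coad n g (iota (tPrime a c)))
      ⟨g, rfl⟩ φ.2.2
    refine ⟨x, ?_, hx⟩
    conv_lhs => rw [← φ.2.2]
    rw [← q_equivariant, hx]

/-! ### Orthogonal conjugacy of skew matrices -/

section skew
variable {ι : Type*} [Fintype ι] [DecidableEq ι]

/-- Symmetric functional calculus: a positive definite matrix has an inverse square root that
commutes with everything it commutes with. -/
theorem exists_inv_sqrt {M : Matrix ι ι ℝ} (hM : M.det ≠ 0) :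
    ∃ S : Matrix ι ι ℝ, Sᵀ = S ∧ S * (Mᵀ * M) * S = 1 ∧
      ∀ Y, Mᵀ * M * Y = Y * (Mᵀ * M) → S * Y = Y * S := by
  have hP : (Mᵀ * M).PosDef := by
    have := Matrix.PosDef.conjTranspose_mul_self M
      (Matrix.mulVec_injective_iff_isUnit.2 ((Matrix.isUnit_iff_isUnit_det _).2 hM.isUnit))
    rwa [Matrix.conjTranspose_eq_transpose_of_trivial] at this
  set P := Mᵀ * M with hPdef
  set d := hP.1.eigenvalues with hd
  set V : Matrix ι ι ℝ := hP.1.eigenvectorUnitary.1 with hV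
  have hVV : Vᵀ * V = 1 := by
    have := (Matrix.mem_unitaryGroup_iff' (A := V)).1 hP.1.eigenvectorUnitary.2
    rwa [Matrix.star_eq_conjTranspose, Matrix.conjTranspose_eq_transpose_of_trivial] at this
  have hVV' : V * Vᵀ = 1 := mul_eq_one_comm.1 hVV
  have hspec : P = V * Matrix.diagonal d * Vᵀ := by
    have := hP.1.spectral_theorem
    rw [Unitary.conjStarAlgAut_apply] at this
    rw [this]
    simp [Matrix.star_eq_conjTranspose, Matrix.conjTranspose_eq_transpose_of_trivial]
    rfl
  have hdpos : ∀ i, 0 < d i := hP.eigenvalues_pos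
  have hf : ∀ i, (Real.sqrt (d i))⁻¹ * d i * (Real.sqrt (d i))⁻¹ = 1 := fun i => by
    have h0 := Real.sqrt_pos.2 (hdpos i)
    nth_rewrite 2 [← Real.mul_self_sqrt (hdpos i).le]
    field_simp
  refine ⟨V * Matrix.diagonal (fun i => (Real.sqrt (d i))⁻¹) * Vᵀ, ?_, ?_, ?_⟩
  · simp [Matrix.transpose_mul, Matrix.mul_assoc]
  · rw [hspec]
    calc _ = V * Matrix.diagonal (fun i => (Real.sqrt (d i))⁻¹) * (Vᵀ * V) * Matrix.diagonal d *
          (Vᵀ * V) * Matrix.diagonal (fun i => (Real.sqrt (d i))⁻¹) * Vᵀ := by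
            simp only [Matrix.mul_assoc]
      _ = V * (Matrix.diagonal (fun i => (Real.sqrt (d i))⁻¹) * Matrix.diagonal d *
          Matrix.diagonal (fun i => (Real.sqrt (d i))⁻¹)) * Vᵀ := by
            rw [hVV, Matrix.mul_one, Matrix.mul_one]; simp only [Matrix.mul_assoc]
      _ = 1 := by
            rw [Matrix.diagonal_mul_diagonal, Matrix.diagonal_mul_diagonal]
            simp only [hf, Matrix.diagonal_one, Matrix.mul_one, hVV']
  · intro Y hY
    set Y' := Vᵀ * Y * V with hY'
    have hYY : Y = V * Y' * Vᵀ := by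
      calc Y = (V * Vᵀ) * Y * (V * Vᵀ) := by rw [hVV', Matrix.one_mul, Matrix.mul_one]
        _ = _ := by rw [hY']; simp only [Matrix.mul_assoc]
    have h1 : Matrix.diagonal d * Y' = Y' * Matrix.diagonal d := by
      calc _ = (Vᵀ * V) * Matrix.diagonal d * Vᵀ * Y * V := by
            rw [hVV, Matrix.one_mul, hY']; simp only [Matrix.mul_assoc]
        _ = Vᵀ * (P * Y) * V := by rw [hspec]; simp only [Matrix.mul_assoc]
        _ = Vᵀ * (Y * P) * V := by rw [hY]
        _ = Y' * Matrix.diagonal d * (Vᵀ * V) := by rw [hspec, hY']; simp only [Matrix.mul_assoc]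
        _ = _ := by rw [hVV, Matrix.mul_one]
    have h2 : Matrix.diagonal (fun i => (Real.sqrt (d i))⁻¹) * Y' =
        Y' * Matrix.diagonal (fun i => (Real.sqrt (d i))⁻¹) := by
      ext i j
      have := congrFun (congrFun h1 i) j
      rw [Matrix.diagonal_mul, Matrix.mul_diagonal] at this ⊢
      by_cases hij : Y' i j = 0
      · simp [hij]
      -- A nonzero entry only connects equal eigenvalues, on which any function of them agrees.
      · have : d i = d j := mul_right_cancel₀ hij (this.trans (mul_comm _ _))
        rw [this, mul_comm]
    rw [hYY]
    calc _ = V * Matrix.diagonal (fun i => (Real.sqrt (d i))⁻¹) * (Vᵀ * V) * Y' * Vᵀ := by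
            simp only [Matrix.mul_assoc]
      _ = V * (Matrix.diagonal (fun i => (Real.sqrt (d i))⁻¹) * Y') * Vᵀ := by
            rw [hVV, Matrix.mul_one]; simp only [Matrix.mul_assoc]
      _ = V * Y' * (Vᵀ * V) * Matrix.diagonal (fun i => (Real.sqrt (d i))⁻¹) * Vᵀ := by
            rw [h2, hVV, Matrix.mul_one]; simp only [Matrix.mul_assoc]
      _ = _ := by simp only [Matrix.mul_assoc]

/-- Similar skew matrices are orthogonally similar. -/
theorem exists_orthogonal_of_similar {Y Y' M : Matrix ι ι ℝ} (hY : Yᵀ = -Y) (hY' : Y'ᵀ = -Y')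
    (hM : M.det ≠ 0) (h : M * Y = Y' * M) :
    ∃ W : Matrix ι ι ℝ, Wᵀ * W = 1 ∧ W * Y = Y' * W := by
  obtain ⟨S, hS, hS1, hS2⟩ := exists_inv_sqrt hM
  have h1 : Y * Mᵀ = Mᵀ * Y' := by
    have := congrArg Matrix.transpose h
    rw [Matrix.transpose_mul, Matrix.transpose_mul, hY, hY', Matrix.neg_mul, Matrix.mul_neg,
      neg_inj] at this
    exact this
  have h2 : Mᵀ * M * Y = Y * (Mᵀ * M) := by
    rw [Matrix.mul_assoc, h, ← Matrix.mul_assoc, ← h1, Matrix.mul_assoc]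
  -- The orthogonal factor of the polar decomposition of `M`; skewness of both matrices makes `Y`
  -- commute with `Mᵀ M`, hence with `S`.
  refine ⟨M * S, ?_, ?_⟩
  · rw [Matrix.transpose_mul, hS, ← hS1]
    simp only [Matrix.mul_assoc]
  · rw [Matrix.mul_assoc, hS2 Y h2, ← Matrix.mul_assoc, h, Matrix.mul_assoc]

theorem isHermitian_I_smul {ι : Type*} {Y : Matrix ι ι ℝ} (hY : Yᵀ = -Y) :
    (Complex.I • Y.map ((↑) : ℝ → ℂ)).IsHermitian := by
  ext i j
  have : Y j i = -Y i j := congrFun (congrFun hY i) j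
  simp [Matrix.conjTranspose_apply, this]

theorem charpoly_I_smul (Y : Matrix ι ι ℝ) (z : ℂ) :
    (Complex.I • Y.map ((↑) : ℝ → ℂ)).charpoly.eval z =
      Complex.I ^ Fintype.card ι * (Y.charpoly.map Complex.ofRealHom).eval (-Complex.I * z) := by
  rw [← Matrix.charpoly_map, Matrix.eval_charpoly, Matrix.eval_charpoly, ← Matrix.det_smul]
  congr 1
  ext i j
  by_cases hij : i = j
  · subst hij
    simp [mul_sub]
    linear_combination z * Complex.I_mul_I
  · simp [hij]

/-- After multiplication by `i` the matrices are Hermitian with the same spectrum, so a unitary `U`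
intertwines them. Its real and imaginary parts `R`, `K` intertwine the real matrices, and `det (R +
t K)` is a polynomial that does not vanish at `t = i`, hence not at some real `t`. -/
theorem exists_similar_of_charpoly_eq {Y Y' : Matrix ι ι ℝ} (hY : Yᵀ = -Y) (hY' : Y'ᵀ = -Y')
    (h : Y.charpoly = Y'.charpoly) : ∃ M : Matrix ι ι ℝ, M.det ≠ 0 ∧ M * Y = Y' * M := by
  set A : Matrix ι ι ℂ := Complex.I • Y.map ((↑) : ℝ → ℂ) with hA
  set A' : Matrix ι ι ℂ := Complex.I • Y'.map ((↑) : ℝ → ℂ) with hA'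
  have hAh : A.IsHermitian := isHermitian_I_smul hY
  have hAh' : A'.IsHermitian := isHermitian_I_smul hY'
  have hch : A.charpoly = A'.charpoly := Polynomial.funext fun z => by
    rw [hA, hA', charpoly_I_smul, charpoly_I_smul, h]
  have hev := (Matrix.IsHermitian.eigenvalues_eq_eigenvalues_iff hAh hAh').2 hch
  obtain ⟨U, U', hUU, hUA⟩ : ∃ U U' : Matrix ι ι ℂ, U * U' = 1 ∧ U * A = A' * U := by
    set V : Matrix ι ι ℂ := hAh.eigenvectorUnitary.1 with hV
    set V' : Matrix ι ι ℂ := hAh'.eigenvectorUnitary.1 with hV'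
    have h1 : star V * V = 1 := Matrix.mem_unitaryGroup_iff'.1 hAh.eigenvectorUnitary.2
    have h2 : star V' * V' = 1 := Matrix.mem_unitaryGroup_iff'.1 hAh'.eigenvectorUnitary.2
    have h2' : V' * star V' = 1 := mul_eq_one_comm.1 h2
    have e1 := hAh.spectral_theorem
    have e2 := hAh'.spectral_theorem
    rw [Unitary.conjStarAlgAut_apply] at e1 e2
    rw [← hev] at e2
    set D : Matrix ι ι ℂ := Matrix.diagonal (RCLike.ofReal ∘ hAh.eigenvalues) with hD
    change A = V * D * star V at e1
    change A' = V' * D * star V' at e2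
    refine ⟨V' * star V, V * star V', ?_, ?_⟩
    · calc _ = V' * (star V * V) * star V' := by simp only [Matrix.mul_assoc]
        _ = 1 := by rw [h1, Matrix.mul_one, h2']
    · rw [e1, e2]
      calc _ = V' * (star V * V) * D * star V := by simp only [Matrix.mul_assoc]
        _ = V' * D * (star V' * V') * star V := by rw [h1, h2, Matrix.mul_one, Matrix.mul_one]
        _ = _ := by simp only [Matrix.mul_assoc]
  have hU0 : U.det ≠ 0 := fun h0 => by
    have := congrArg Matrix.det hUU
    rw [Matrix.det_mul, h0, zero_mul, Matrix.det_one] at this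
    exact zero_ne_one this
  have hUY : U * Y.map ((↑) : ℝ → ℂ) = Y'.map ((↑) : ℝ → ℂ) * U := by
    rw [hA, hA', Matrix.mul_smul, Matrix.smul_mul] at hUA
    exact smul_right_injective _ Complex.I_ne_zero hUA
  set R : Matrix ι ι ℝ := U.map Complex.re with hR
  set K : Matrix ι ι ℝ := U.map Complex.im with hK
  have hRe : R * Y = Y' * R := by
    ext i j
    have := congrArg Complex.re (congrFun (congrFun hUY i) j)
    simpa [Matrix.mul_apply, hR] using this
  have hIm : K * Y = Y' * K := by
    ext i j
    have := congrArg Complex.im (congrFun (congrFun hUY i) j)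
    simpa [Matrix.mul_apply, hK] using this
  let p : ℝ[X] := (R.map C + (X : ℝ[X]) • K.map C).det
  have hp : ∀ t : ℝ, p.eval t = (R + t • K).det := fun t => by
    rw [← Polynomial.coe_evalRingHom, RingHom.map_det]
    congr 1
    ext i j
    simp [mul_comm _ t]
  have hp0 : p ≠ 0 := by
    intro h0
    refine hU0 ?_
    have h1 : (p.eval₂ Complex.ofRealHom Complex.I) = U.det := by
      rw [← Polynomial.coe_eval₂RingHom, RingHom.map_det]
      congr 1
      ext i j
      simp [hR, hK]
    rw [← h1, h0, Polynomial.eval₂_zero]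
  obtain ⟨t, ht⟩ : ∃ t, p.eval t ≠ 0 := by
    by_contra! hall
    exact hp0 (Polynomial.funext fun t => by rw [hall, Polynomial.eval_zero])
  refine ⟨R + t • K, by rwa [← hp], ?_⟩
  rw [Matrix.add_mul, Matrix.mul_add, Matrix.smul_mul, Matrix.mul_smul, hRe, hIm]

/-- Skew matrices with the same characteristic polynomial, with marked vectors of the same length
in their kernels, are orthogonally similar. -/
theorem exists_orthogonal_of_charpoly_eq {Y Y' : Matrix ι ι ℝ} (hY : Yᵀ = -Y) (hY' : Y'ᵀ = -Y')
    (h : Y.charpoly = Y'.charpoly) {β β' : ι → ℝ} (hβ : Y *ᵥ β = 0) (hβ' : Y' *ᵥ β' = 0)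
    (hl : β ⬝ᵥ β = β' ⬝ᵥ β') :
    ∃ W : Matrix ι ι ℝ, Wᵀ * W = 1 ∧ W * Y = Y' * W ∧ W *ᵥ β = β' := by
  obtain ⟨M, hM, hMY⟩ := exists_similar_of_charpoly_eq hY hY' h
  obtain ⟨W, hW, hWY⟩ := exists_orthogonal_of_similar hY hY' hM hMY
  by_cases hu : W *ᵥ β = β'
  · exact ⟨W, hW, hWY, hu⟩
  set u := W *ᵥ β - β' with hudef
  have hu0 : u ⬝ᵥ u ≠ 0 := fun h0 => hu (sub_eq_zero.1 (dotProduct_self_eq_zero.1 h0))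
  have hlW : (W *ᵥ β) ⬝ᵥ (W *ᵥ β) = β' ⬝ᵥ β' := by
    rw [← hl, Matrix.dotProduct_mulVec, ← Matrix.mulVec_transpose, Matrix.mulVec_mulVec, hW,
      Matrix.one_mulVec]
  have huW : 2 * (u ⬝ᵥ (W *ᵥ β)) = u ⬝ᵥ u := by
    rw [hudef, sub_dotProduct, sub_dotProduct, dotProduct_sub, dotProduct_sub, hlW,
      dotProduct_comm β' (W *ᵥ β)]
    ring
  have hY'u : Y' *ᵥ u = 0 := by
    rw [hudef, Matrix.mulVec_sub, hβ', Matrix.mulVec_mulVec, ← hWY, ← Matrix.mulVec_mulVec, hβ,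
      Matrix.mulVec_zero, sub_zero]
  have huY' : u ᵥ* Y' = 0 := by
    rw [← Matrix.mulVec_transpose, hY', Matrix.neg_mulVec, hY'u, neg_zero]
  -- The reflection exchanging `W β` and `β'`. Both lie in the kernel of `Y'`, hence so does `u`,
  -- and the reflection commutes with `Y'`.
  set H : Matrix ι ι ℝ := 1 - (2 / (u ⬝ᵥ u)) • vecMulVec u u with hH
  have hHt : Hᵀ = H := by simp [hH, Matrix.transpose_vecMulVec]
  have hHH : H * H = 1 := by
    rw [hH, Matrix.sub_mul, Matrix.one_mul, Matrix.mul_sub, Matrix.mul_one, Matrix.smul_mul,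
      Matrix.mul_smul, Matrix.vecMulVec_mul_vecMulVec, Matrix.vecMulVec_smul, smul_smul, smul_smul]
    have : 2 / (u ⬝ᵥ u) * (2 / (u ⬝ᵥ u)) * (u ⬝ᵥ u) = 2 * (2 / (u ⬝ᵥ u)) := by field_simp
    rw [this]
    module
  refine ⟨H * W, ?_, ?_, ?_⟩
  · calc _ = Wᵀ * (H * H) * W := by rw [Matrix.transpose_mul, hHt]; simp only [Matrix.mul_assoc]
      _ = 1 := by rw [hHH, Matrix.mul_one, hW]
  · have : H * Y' = Y' * H := by
      rw [hH, Matrix.sub_mul, Matrix.mul_sub, Matrix.one_mul, Matrix.mul_one, Matrix.smul_mul,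
        Matrix.mul_smul, Matrix.vecMulVec_mul, Matrix.mul_vecMulVec, hY'u, huY']
      simp
    rw [Matrix.mul_assoc, hWY, ← Matrix.mul_assoc, this, Matrix.mul_assoc]
  · rw [← Matrix.mulVec_mulVec, hH, Matrix.sub_mulVec, Matrix.one_mulVec, Matrix.smul_mulVec,
      Matrix.vecMulVec_mulVec]
    have : (2 / (u ⬝ᵥ u)) * (u ⬝ᵥ (W *ᵥ β)) = 1 := by
      rw [div_mul_eq_mul_div, huW, div_self hu0]
    simp only [op_smul_eq_smul, smul_smul, this, one_smul]
    rw [hudef, sub_sub_cancel]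

/-- For skew `Y` of odd size, the characteristic polynomials of `Y` and `YᵗY` determine each
other. -/
theorem charpoly_skew_iff {Y : Matrix ι ι ℝ} (hY : Yᵀ = -Y) {N : ℕ}
    (hN : Fintype.card ι = 2 * N + 1) (x : Fin N → ℝ) :
    (Yᵀ * Y).charpoly = (X : ℝ[X]) * ∏ i, (X - C (x i ^ 2)) ^ 2 ↔
      Y.charpoly = (X : ℝ[X]) * ∏ i, (X ^ 2 + C (x i ^ 2)) := by
  have h3 : ∀ t : ℝ, (∏ i, (-t ^ 2 - x i ^ 2)) ^ 2 = (∏ i, (t ^ 2 + x i ^ 2)) ^ 2 := fun t => by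
    rw [← Finset.prod_pow, ← Finset.prod_pow]
    exact Finset.prod_congr rfl fun i _ => by ring
  -- The factorization is `-t² - YᵀY = -(t - Y)(t + Y)`; transposition identifies the determinants
  -- of the two factors, and the odd size gives the sign. The square root taken below is fixed by
  -- monicity.
  have h1 : ∀ t : ℝ, (Yᵀ * Y).charpoly.eval (-t ^ 2) = -(Y.charpoly.eval t) ^ 2 := by
    intro t
    have e1 : Y.charpoly.eval t = (t • (1 : Matrix ι ι ℝ) - Y).det := by
      rw [Matrix.eval_charpoly, Matrix.scalar_apply, Matrix.smul_one_eq_diagonal]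
    have e2 : Y.charpoly.eval t = (t • (1 : Matrix ι ι ℝ) + Y).det := by
      rw [e1, ← Matrix.det_transpose, Matrix.transpose_sub, hY, sub_neg_eq_add]
      simp
    have e3 : (Yᵀ * Y).charpoly.eval (-t ^ 2) =
        (-((t • (1 : Matrix ι ι ℝ) - Y) * (t • (1 : Matrix ι ι ℝ) + Y))).det := by
      rw [Matrix.eval_charpoly, Matrix.scalar_apply, ← Matrix.smul_one_eq_diagonal]
      congr 1
      rw [hY]
      simp only [Matrix.sub_mul, Matrix.mul_add, Matrix.smul_mul, Matrix.mul_smul, Matrix.one_mul,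
        Matrix.mul_one, Matrix.neg_mul]
      module
    rw [e3, Matrix.det_neg, hN, Matrix.det_mul, ← e1, ← e2, pow_succ, pow_mul]
    simp [pow_two]
  constructor
  · intro h
    have hsq : Y.charpoly ^ 2 = ((X : ℝ[X]) * ∏ i, (X ^ 2 + C (x i ^ 2))) ^ 2 := by
      refine Polynomial.funext fun t => ?_
      have h2 := h1 t
      rw [h] at h2
      simp only [Polynomial.eval_mul, Polynomial.eval_X, Polynomial.eval_prod, Polynomial.eval_pow,
        Polynomial.eval_sub, Polynomial.eval_C, Finset.prod_pow, h3] at h2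
      simp only [Polynomial.eval_pow, Polynomial.eval_mul, Polynomial.eval_X, Polynomial.eval_prod,
        Polynomial.eval_add, Polynomial.eval_C, mul_pow]
      linarith
    have hm : ((X : ℝ[X]) * ∏ i, (X ^ 2 + C (x i ^ 2))).Monic :=
      Polynomial.monic_X.mul (Polynomial.monic_prod_of_monic _ _ fun i _ =>
        Polynomial.monic_X_pow_add_C _ two_ne_zero)
    rcases sq_eq_sq_iff_eq_or_eq_neg.1 hsq with h2 | h2
    · exact h2
    · exfalso
      have h3 := Matrix.charpoly_monic Y
      rw [h2, Polynomial.Monic, Polynomial.leadingCoeff_neg, hm.leadingCoeff] at h3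
      norm_num at h3
  · intro h
    refine Polynomial.eq_of_infinite_eval_eq _ _ ((Set.Iic_infinite (0 : ℝ)).mono fun s hs => ?_)
    obtain ⟨t, rfl⟩ : ∃ t : ℝ, s = -t ^ 2 :=
      ⟨Real.sqrt (-s), by rw [Real.sq_sqrt (neg_nonneg.2 hs), neg_neg]⟩
    change _ = _
    rw [h1, h]
    simp only [Polynomial.eval_mul, Polynomial.eval_X, Polynomial.eval_prod, Polynomial.eval_pow,
      Polynomial.eval_sub, Polynomial.eval_add, Polynomial.eval_C, Finset.prod_pow, h3]
    ring

end skew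

/-! ### The image of the moment map -/

theorem gInfMat_eq (n : ℕ) : gInfMat n = blk (sRefl n) 0 0 0 0 (-1) 0 0 1 := by
  ext i j
  rcases i with ((i | i) | i) | i <;> rcases j with ((j | j) | j) | j <;>
    simp [gInfMat, blk, sRefl, Matrix.diagonal_apply, Matrix.one_apply]

theorem isLor_gInfMat (n : ℕ) : IsLor (gInfMat n) := by
  rw [IsLor, Jm_eq_blk, gInfMat_eq, blk_transpose, blk_mul, blk_mul, blk_inj]
  simp [sRefl_transpose_mul]

theorem exists_rho_eq_gInfMat (n : ℕ) : ∃ g : SpinG n, rho n g = gInfMat n := by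
  refine (isLor_gInfMat n).exists_rho (by simp [gInfMat]) ?_
  rw [gInfMat, Matrix.det_diagonal]
  simp [Fintype.prod_sum_type]

theorem gInfMat_mulVec {n : ℕ} (ζ : Tr n → ℝ) (p r : ℝ) :
    gInfMat n *ᵥ vc ζ p r = vc (sRefl n *ᵥ ζ) (-p) r := by
  rw [gInfMat_eq, blk_mulVec_vc, vc_inj]
  simp

theorem gInfMat_mul_self (n : ℕ) : gInfMat n * gInfMat n = 1 := by
  rw [gInfMat, Matrix.diagonal_mul_diagonal, ← Matrix.diagonal_one]
  congr 1
  ext i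
  rcases i with ((i | i) | i) | i <;> simp

theorem rho_inv_of_eq_gInfMat {n : ℕ} {g : SpinG n} (hg : rho n g = gInfMat n) :
    rho n g⁻¹ = gInfMat n := by
  have h := rho_inv_mul g
  rw [hg] at h
  calc _ = rho n g⁻¹ * (gInfMat n * gInfMat n) := by rw [gInfMat_mul_self, Matrix.mul_one]
    _ = _ := by rw [← Matrix.mul_assoc, h, Matrix.one_mul]

theorem mulVec_rho_inj {n : ℕ} (g : SpinG n) {x y : Ix n → ℝ} (h : rho n g *ᵥ x = rho n g *ᵥ y) :
    x = y := by
  have := congrArg (rho n g⁻¹ *ᵥ ·) h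
  simpa only [Matrix.mulVec_mulVec, rho_inv_mul, Matrix.one_mulVec] using this

theorem conj_mulVec_v₀ {n : ℕ} {T : Mat n} {g : SpinG n} {w : Ix n → ℝ}
    (hg : rho n g *ᵥ w = v₀ n) : (rho n g * T * rho n g⁻¹) *ᵥ v₀ n = rho n g *ᵥ (T *ᵥ w) := by
  rw [← hg, Matrix.mulVec_mulVec, Matrix.mul_assoc, rho_inv_mul, Matrix.mul_one,
    Matrix.mulVec_mulVec]

theorem tPrime_mulVec_v₀ {n : ℕ} (a : Fin (n - 1) → ℝ) (c : ℝ) :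
    (tPrime a c : Mat n) *ᵥ v₀ n = c • v₀ n := by
  rw [v₀_eq, tPrime_mulVec_vc, smul_vc, vc_inj]
  simp

theorem Ad_gInf_tPrime_mulVec_v₀ {n : ℕ} (a : Fin (n - 1) → ℝ) (c : ℝ) {g : SpinG n}
    (hg : rho n g = gInfMat n) :
    ((Ad n g (tPrime a c) : gLie n) : Mat n) *ᵥ v₀ n = (-c) • v₀ n := by
  rw [Ad_coe, rho_inv_of_eq_gInfMat hg, hg, ← Matrix.mulVec_mulVec, ← Matrix.mulVec_mulVec, v₀_eq,
    gInfMat_mulVec, tPrime_mulVec_vc, gInfMat_mulVec, smul_vc, vc_inj]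
  simp

theorem depthZero_q_iota_tPrime {n : ℕ} (a : Fin (n - 1) → ℝ) (c : ℝ) :
    DepthZero (orbit (coadP n) (q n (iota (tPrime a c)))) :=
  depthZero_iff.2 ⟨c, tPrime_mulVec_v₀ a c⟩

theorem depthZero_q_coad_gInf {n : ℕ} (a : Fin (n - 1) → ℝ) (c : ℝ) {g : SpinG n}
    (hg : rho n g = gInfMat n) :
    DepthZero (orbit (coadP n) (q n (coad n g (iota (tPrime a c))))) := by
  rw [coad_iota]
  exact depthZero_iff.2 ⟨-c, Ad_gInf_tPrime_mulVec_v₀ a c hg⟩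

/-- The eigenvalue of `X` on `v₀` is unchanged by `P` and by adding `𝔫`; it is `c` on one orbit and
`-c` on the other. -/
theorem orbit_q_tPrime_ne {n : ℕ} (a : Fin (n - 1) → ℝ) {c : ℝ} (hc : 0 < c) {g : SpinG n}
    (hg : rho n g = gInfMat n) : orbit (coadP n) (q n (iota (tPrime a c))) ≠
      orbit (coadP n) (q n (coad n g (iota (tPrime a c)))) := by
  intro h
  obtain ⟨x, hx⟩ : q n (coad n g (iota (tPrime a c))) ∈
      orbit (coadP n) (q n (iota (tPrime a c))) := by
    rw [h]
    exact mem_orbit_self _ _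
  have hx' : q n (iota (Ad n x (tPrime a c))) = q n (iota (Ad n g (tPrime a c))) := by
    rw [← coadGP_iota, q_equivariant, ← coad_iota]
    exact hx
  obtain ⟨γ, hγ⟩ := (q_iota_eq_iff _ _).1 hx'
  have h1 := Ad_gInf_tPrime_mulVec_v₀ a c hg
  obtain ⟨κ, hκ⟩ := rho_v₀ x⁻¹
  have h2 : rho n x *ᵥ (κ • v₀ n) = v₀ n := by
    rw [← hκ, Matrix.mulVec_mulVec]
    change (rho n x * rho n (x : SpinG n)⁻¹) *ᵥ _ = _
    rw [rho_mul_inv, Matrix.one_mulVec]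
  rw [hγ, Matrix.add_mulVec, nX_mulVec_v₀, add_zero, Ad_coe, conj_mulVec_v₀ h2, Matrix.mulVec_smul,
    tPrime_mulVec_v₀, smul_comm, Matrix.mulVec_smul, h2] at h1
  have h3 := congrFun h1 (.inr ())
  simp [v₀] at h3
  linarith

/-- A nonzero time coordinate forces `b² = c²`. The rotation planes and the kernel line have no such
eigenvalue, so only the two null directions of the boost plane remain. -/
theorem eigenvector_tPrime {n : ℕ} {a : Fin (n - 1) → ℝ} (ha₀ : ∀ i, 0 < a i) {c : ℝ} (hc : 0 < c)
    {ζ : Tr n → ℝ} {p r b : ℝ} (hr : 0 < r)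
    (h : (tPrime a c : Mat n) *ᵥ vc ζ p r = b • vc ζ p r) : ζ = 0 ∧ (p = r ∨ p = -r) := by
  rw [tPrime_mulVec_vc, smul_vc, vc_inj] at h
  obtain ⟨h1, h2, h3⟩ := h
  have hbc : b ^ 2 = c ^ 2 := by
    have : r * b ^ 2 = r * c ^ 2 := by linear_combination (-b) * h3 - c * h2
    exact mul_left_cancel₀ hr.ne' this
  have hb : b ≠ 0 := by
    rintro rfl
    have : 0 < c ^ 2 := by positivity
    rw [← hbc] at this
    norm_num at this
  refine ⟨?_, ?_⟩
  · ext k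
    rcases k with ⟨k, i⟩ | k
    · have e0 := congrFun h1 (.inl (0, i))
      have e1 := congrFun h1 (.inl (1, i))
      rw [skewDiag_mulVec_zero] at e0
      rw [skewDiag_mulVec_one] at e1
      simp only [Pi.smul_apply, smul_eq_mul] at e0 e1
      have hpos : a i ^ 2 + b ^ 2 ≠ 0 := by have := ha₀ i; positivity
      fin_cases k
      · have : (a i ^ 2 + b ^ 2) * ζ (.inl (0, i)) = 0 := by linear_combination -a i * e1 - b * e0
        simpa [hpos] using this
      · have : (a i ^ 2 + b ^ 2) * ζ (.inl (1, i)) = 0 := by linear_combination a i * e0 - b * e1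
        simpa [hpos] using this
    · have e := congrFun h1 (.inr ())
      rw [skewDiag_mulVec_last] at e
      simpa [hb] using e.symm
  · rcases sq_eq_sq_iff_eq_or_eq_neg.1 hbc with rfl | rfl
    · exact .inl (mul_left_cancel₀ hc.ne' h3)
    · exact .inr (mul_left_cancel₀ hc.ne' (by linarith))

/-- An element of the orbit whose restriction has depth zero lies over one of the two depth zero
orbits. -/
theorem q_mem_of_depthZero {n : ℕ} {a : Fin (n - 1) → ℝ} (ha₀ : ∀ i, 0 < a i) {c : ℝ} (hc : 0 < c)
    {g' : SpinG n} (hg' : rho n g' = gInfMat n) {g : SpinG n} {b : ℝ}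
    (h : ((Ad n g (tPrime a c) : gLie n) : Mat n) *ᵥ v₀ n = b • v₀ n) :
    q n (iota (Ad n g (tPrime a c))) ∈ orbit (coadP n) (q n (iota (tPrime a c))) ∪
      orbit (coadP n) (q n (coad n g' (iota (tPrime a c)))) := by
  obtain ⟨ζ, p, r, hg, hr, hw⟩ := exists_vc_rho_inv g
  rw [Ad_coe, conj_mulVec_v₀ hg] at h
  conv_rhs at h => rw [← hg]
  rw [← Matrix.mulVec_smul] at h
  obtain ⟨rfl, hp⟩ := eigenvector_tPrime ha₀ hc hr (mulVec_rho_inj g h)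
  rcases hp with rfl | rfl
  · left
    have h1 : rho n g *ᵥ v₀ n = p⁻¹ • v₀ n := by
      conv_rhs => rw [← hg]
      rw [← Matrix.mulVec_smul, smul_vc, v₀_eq]
      simp [hr.ne']
    refine ⟨⟨g, mem_ParP_of_mulVec_v₀ h1⟩, ?_⟩
    change coadP n _ (q n _) = _
    rw [← q_equivariant, coadGP_iota]
  · right
    -- The null vector of `g` is `r` times the image of `v₀` under `gInfMat`, an involution, so `g *
    -- g'` preserves the line of `v₀`.
    have h1 : rho n (g * g') *ᵥ v₀ n = r⁻¹ • v₀ n := by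
      conv_rhs => rw [← hg]
      rw [map_mul, hg', ← Matrix.mulVec_mulVec, ← Matrix.mulVec_smul, smul_vc, v₀_eq,
        gInfMat_mulVec]
      simp [hr.ne']
    refine ⟨⟨g * g', mem_ParP_of_mulVec_v₀ h1⟩, ?_⟩
    change coadP n _ (q n _) = _
    rw [← q_equivariant, coad_iota, coadGP_iota]
    have hsub : ∀ X' : gLie n, (X' : Mat n) = ((Ad n g (tPrime a c) : gLie n) : Mat n) →
        q n (iota X') = q n (iota (Ad n g (tPrime a c))) := fun X' h => by rw [Subtype.ext h]
    refine hsub _ ?_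
    change rho n (g * g') * (rho n g' * (tPrime a c : Mat n) * rho n g'⁻¹) * rho n (g * g')⁻¹ = _
    rw [Ad_coe, _root_.mul_inv_rev, map_mul, map_mul, rho_inv_of_eq_gInfMat hg', hg']
    calc _ = rho n g * (gInfMat n * gInfMat n) * (tPrime a c : Mat n) * (gInfMat n * gInfMat n) *
          rho n g⁻¹ := by simp only [Matrix.mul_assoc]
      _ = _ := by rw [gInfMat_mul_self, Matrix.mul_one, Matrix.mul_one]

/-- The normal form of a depth one element of the orbit, and its invariants. -/
theorem exists_normal_form {n : ℕ} {a : Fin (n - 1) → ℝ} {c : ℝ} {g : SpinG n} {ζ : Tr n → ℝ}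
    {p r : ℝ} (hg : rho n g *ᵥ vc ζ p r = v₀ n) (hw : lor (vc ζ p r) (vc ζ p r) = 0)
    {x : Fin (n - 1) → ℝ} {M : ℝ} (hM : ∀ t, interPoly a
      (fun i => (a i ^ 2 + c ^ 2) * (ζ (.inl (0, i)) ^ 2 + ζ (.inl (1, i)) ^ 2))
      (c ^ 2 * ζ (.inr ()) ^ 2) t = M * ∏ i, (t + x i ^ 2))
    (hd : ∀ b : ℝ, ((Ad n g (tPrime a c) : gLie n) : Mat n) *ᵥ v₀ n ≠ b • v₀ n) :
    ∃ (y : ParP n) (Y : Matrix (Tr n) (Tr n) ℝ) (β γ : Tr n → ℝ), Yᵀ = -Y ∧ β ≠ 0 ∧ Y *ᵥ β = 0 ∧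
      ((Ad n y (Ad n g (tPrime a c)) : gLie n) : Mat n) = gM Y β β 0 + nX γ ∧
      M = 4 * (β ⬝ᵥ β) ∧ Y.charpoly = (X : ℝ[X]) * ∏ i, (X ^ 2 + C (x i ^ 2)) := by
  obtain ⟨Y, u, v, b, hY, hX⟩ := exists_gM (Ad n g (tPrime a c))
  have huv : u + v ≠ 0 := fun h0 => hd b (by rw [hX, gM_mulVec_v₀, h0, v₀_eq, smul_vc]; simp)
  obtain ⟨α, Y', γ, hY', hYβ, hα⟩ := exists_nMat_conj_gM hY b huv
  obtain ⟨y, hy⟩ := exists_mem_ParP_of_mulVec_v₀ (isLor_nMat α) (det_nMat α) (nMat_mulVec_v₀ α)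
  set β : Tr n → ℝ := (1 / 2 : ℝ) • (u + v) with hβ
  have hβ0 : β ≠ 0 := smul_ne_zero (by norm_num) huv
  have hy' : rho n (y : SpinG n)⁻¹ = nMat (-α) := by
    have := rho_inv_mul (y : SpinG n)
    rw [hy] at this
    calc _ = rho n (y : SpinG n)⁻¹ * (nMat α * nMat (-α)) := by rw [nMat_mul_neg, Matrix.mul_one]
      _ = _ := by rw [← Matrix.mul_assoc, this, Matrix.one_mul]
  have hAd : ((Ad n y (Ad n g (tPrime a c)) : gLie n) : Mat n) = gM Y' β β 0 + nX γ := by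
    rw [Ad_coe, hX, hy, hy', hα]
  have hbd : ∀ t : ℝ, bdet (gM Y' β β 0) (v₀ n) t = bdet (tPrime a c : Mat n) (vc ζ p r) t := by
    intro t
    rw [← bdet_add_nX _ γ, ← hα, ← hX, ← nMat_mulVec_v₀ α,
      (isLor_nMat α).bdet_conj (nMat_mul_neg α), Ad_coe, ← hg,
      (isLor_rho g).bdet_conj (rho_mul_inv g)]
  have hev : ∀ t : ℝ, Y'.charpoly.eval t = (t • (1 : Matrix (Tr n) (Tr n) ℝ) - Y').det := fun t => by
    rw [Matrix.eval_charpoly, Matrix.scalar_apply, Matrix.smul_one_eq_diagonal]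
  -- The two evaluations of the invariant agree for `t > |c|`, away from the excluded values.
  -- Leading coefficients then identify `M`, and cancelling it leaves the characteristic polynomial.
  have hpoly : C (4 * (β ⬝ᵥ β)) * Y'.charpoly =
      C M * ((X : ℝ[X]) * ∏ i, (X ^ 2 + C (x i ^ 2))) := by
    refine Polynomial.eq_of_infinite_eval_eq _ _ ((Set.Ioi_infinite |c|).mono fun t ht => ?_)
    have ht0 : 0 < t := (abs_nonneg c).trans_lt ht
    have htc : t ^ 2 ≠ c ^ 2 := by
      rw [← sq_abs c]
      exact (pow_lt_pow_left₀ ht (abs_nonneg c) two_ne_zero).ne'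
    have h1 := bdet_gM hYβ ht0.ne'
    rw [hbd, bdet_tPrime a c ζ p r hw ht0.ne' htc, hM] at h1
    change _ = _
    simp only [Polynomial.eval_mul, Polynomial.eval_C, Polynomial.eval_X, Polynomial.eval_prod,
      Polynomial.eval_add, Polynomial.eval_pow, hev]
    linarith
  have hm : ((X : ℝ[X]) * ∏ i, (X ^ 2 + C (x i ^ 2))).Monic :=
    Polynomial.monic_X.mul (Polynomial.monic_prod_of_monic _ _ fun i _ =>
      Polynomial.monic_X_pow_add_C _ two_ne_zero)
  have hMeq : 4 * (β ⬝ᵥ β) = M := by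
    have := congrArg Polynomial.leadingCoeff hpoly
    rwa [Polynomial.leadingCoeff_mul, Polynomial.leadingCoeff_mul, Polynomial.leadingCoeff_C,
      Polynomial.leadingCoeff_C, (Matrix.charpoly_monic Y').leadingCoeff, hm.leadingCoeff, mul_one,
      mul_one] at this
  have hMne : C (4 * (β ⬝ᵥ β)) ≠ 0 := by
    have : β ⬝ᵥ β ≠ 0 := fun h => hβ0 (dotProduct_self_eq_zero.1 h)
    rw [Ne, Polynomial.C_eq_zero]
    positivity
  refine ⟨y, Y', β, γ, hY', hβ0, hYβ, hAd, hMeq.symm, ?_⟩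
  rw [← hMeq] at hpoly
  exact mul_left_cancel₀ hMne hpoly

theorem card_Tr {n : ℕ} : Fintype.card (Tr n) = 2 * (n - 1) + 1 := by simp

theorem hasSingularValues_of_mem {n : ℕ} {a : Fin (n - 1) → ℝ} (ha : StrictAnti a)
    (ha₀ : ∀ i, 0 < a i) {c : ℝ} {g : SpinG n}
    (hd : ∀ b : ℝ, ((Ad n g (tPrime a c) : gLie n) : Mat n) *ᵥ v₀ n ≠ b • v₀ n) :
    ∃ x, HasSingularValues (orbit (coadP n) (q n (iota (Ad n g (tPrime a c))))) x ∧
      Interlace a x := by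
  obtain ⟨ζ, p, r, hg, hr, hw⟩ := exists_vc_rho_inv g
  obtain ⟨x, hx, hM⟩ := exists_interlace ha ha₀
    (m := fun i => (a i ^ 2 + c ^ 2) * (ζ (.inl (0, i)) ^ 2 + ζ (.inl (1, i)) ^ 2))
    (m₀ := c ^ 2 * ζ (.inr ()) ^ 2) (fun i => by positivity) (by positivity)
  obtain ⟨y, Y, β, γ, hY, hβ, hYβ, hAd, -, hch⟩ := exists_normal_form hg hw hM hd
  refine ⟨x, ⟨hx.antitone ha, hx.1, ⟨gM Y β β 0, gM_mem hY _ _ _⟩, Y, β, rfl, hβ, hYβ, ?_,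
    (charpoly_skew_iff hY card_Tr x).2 hch⟩, hx⟩
  refine ⟨y, ?_⟩
  change coadP n y (q n _) = _
  rw [← q_equivariant, coadGP_iota]
  exact ((q_iota_eq_iff _ _).2 ⟨γ, hAd⟩).symm

/-- The orbit is stable under `O(2n-1)`. -/
theorem exists_Ad_eq_mM_conj {n : ℕ} (a : Fin (n - 1) → ℝ) (c : ℝ) {W : Matrix (Tr n) (Tr n) ℝ}
    (hW : Wᵀ * W = 1) (g : SpinG n) : ∃ g' : SpinG n, ((Ad n g' (tPrime a c) : gLie n) : Mat n) =
      mM W * ((Ad n g (tPrime a c) : gLie n) : Mat n) * mM Wᵀ := by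
  have key : ∀ {V : Matrix (Tr n) (Tr n) ℝ}, Vᵀ * V = 1 →
      V * skewDiag a = skewDiag a * V → W.det * V.det = 1 → ∃ g' : SpinG n,
      ((Ad n g' (tPrime a c) : gLie n) : Mat n) =
        mM W * ((Ad n g (tPrime a c) : gLie n) : Mat n) * mM Wᵀ := by
    intro V hV hVa hdet
    have hWW : mM W * mM Wᵀ = 1 := by
      rw [mM, mM, blk_mul, blk_one, mul_eq_one_comm.1 hW]; simp
    obtain ⟨g', hg'⟩ := (((isLor_mM hW).mul (isLor_rho g)).mul (isLor_mM hV)).exists_rho (by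
      have h0 := rho_zero_zero_pos g
      obtain ⟨Y, u, v, w, z, a', b', c', d, hX⟩ := exists_blk (rho n g)
      rw [hX] at h0 ⊢
      rw [mM, mM, blk_mul, blk_mul]
      simpa [blk] using h0) (by
      rw [Matrix.det_mul, Matrix.det_mul, det_mM, det_mM, det_rho, mul_one, hdet])
    refine ⟨g', ?_⟩
    have h1 : rho n g' * (tPrime a c : Mat n) =
        mM W * ((Ad n g (tPrime a c) : gLie n) : Mat n) * mM Wᵀ * rho n g' := by
      have hWt : mM Wᵀ * mM W = (1 : Mat n) := mul_eq_one_comm.1 hWW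
      rw [hg', Ad_coe]
      calc _ = mM W * rho n g * (mM V * (tPrime a c : Mat n)) := by simp only [Matrix.mul_assoc]
        _ = mM W * (rho n g * (tPrime a c : Mat n) * (rho n g⁻¹ * ((mM Wᵀ * mM W) *
            (rho n g * mM V)))) := by
              rw [mM_mul_tPrime c hVa, hWt, Matrix.one_mul, ← Matrix.mul_assoc (rho n g⁻¹),
                rho_inv_mul, Matrix.one_mul]
              simp only [Matrix.mul_assoc]
        _ = _ := by simp only [Matrix.mul_assoc]
    rw [Ad_coe, h1, Matrix.mul_assoc, rho_mul_inv, Matrix.mul_one]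
  have hd : W.det * W.det = 1 := by
    have := congrArg Matrix.det hW
    rwa [Matrix.det_mul, Matrix.det_transpose, Matrix.det_one] at this
  -- An improper `W` is compensated on the right by `sRefl`, which centralizes the base point.
  rcases mul_self_eq_one_iff.1 hd with h | h
  · exact key (V := 1) (by simp) (by simp) (by simp [h])
  · exact key (V := sRefl n) (sRefl_transpose_mul n)
      (sRefl_mul_skewDiag a) (by rw [h, det_sRefl]; norm_num)

theorem mM_conj_gM {n : ℕ} (W : Matrix (Tr n) (Tr n) ℝ)
    (Y : Matrix (Tr n) (Tr n) ℝ) (u v : Tr n → ℝ) (b : ℝ) :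
    mM W * gM Y u v b * mM Wᵀ = gM (W * Y * Wᵀ) (W *ᵥ u) (W *ᵥ v) b := by
  rw [mM, mM, gM, gM, blk_mul, blk_mul, blk_inj]
  simp [Matrix.vecMul_transpose, Matrix.mulVec_neg]

/-- Weights with the prescribed roots yield a null vector, and so an orbit point whose normal form
has the prescribed `|β|` and characteristic polynomial. An orthogonal conjugation then matches the
normal forms themselves. -/
theorem exists_q_iota_eq {n : ℕ} {a : Fin (n - 1) → ℝ} (ha : StrictAnti a) (ha₀ : ∀ i, 0 < a i)
    {c : ℝ} (hc : 0 < c) {x : Fin (n - 1) → ℝ} (hx : Interlace a x) {Z : gLie n}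
    {Y : Matrix (Tr n) (Tr n) ℝ} {β : Tr n → ℝ} (hZ : (Z : Mat n) = gM Y β β 0) (hβ : β ≠ 0)
    (hYβ : Y *ᵥ β = 0) (hch : (Yᵀ * Y).charpoly = (X : ℝ[X]) * ∏ i, (X - C (x i ^ 2)) ^ 2) :
    ∃ g : SpinG n, q n (iota (Ad n g (tPrime a c))) = q n (iota Z) := by
  have hY : Yᵀ = -Y := ((blk_mem_gLie _ _ _ _ _ _ _ _ _).1 (hZ ▸ Z.2)).1
  have hββ : 0 < β ⬝ᵥ β := lt_of_le_of_ne (Finset.sum_nonneg fun i _ => mul_self_nonneg _)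
    fun h => hβ (dotProduct_self_eq_zero.1 h.symm)
  obtain ⟨m, m₀, hm, hm₀, hM⟩ := hx.exists_weights ha ha₀ (M := 4 * (β ⬝ᵥ β)) (by positivity)
  have hac : ∀ i, 0 < a i ^ 2 + c ^ 2 := fun i => by positivity
  let ζ : Tr n → ℝ := Sum.elim (fun k => if k.1 = 0 then Real.sqrt (m k.2 / (a k.2 ^ 2 + c ^ 2))
    else 0) fun _ => Real.sqrt (m₀ / c ^ 2)
  have hζ : (fun i => (a i ^ 2 + c ^ 2) * (ζ (.inl (0, i)) ^ 2 + ζ (.inl (1, i)) ^ 2)) = m := by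
    funext i
    have := hac i
    simp only [ζ, Sum.elim_inl, if_true]
    rw [if_neg (by decide : ¬ (1 : Fin 2) = 0), Real.sq_sqrt (div_nonneg (hm i) this.le)]
    field_simp
    ring
  have hζ₀ : c ^ 2 * ζ (.inr ()) ^ 2 = m₀ := by
    simp only [ζ, Sum.elim_inr]
    rw [Real.sq_sqrt (div_nonneg hm₀ (sq_nonneg c))]
    field_simp
  -- If `ζ` vanished, the interlacing polynomial would be zero, but its value at `1` is positive.
  -- The null vector is completed with `p = 0` and `r = |ζ|`, so it avoids both eigenlines.
  have hζ0 : 0 < ζ ⬝ᵥ ζ := by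
    refine lt_of_le_of_ne (Finset.sum_nonneg fun i _ => mul_self_nonneg _) fun h => ?_
    have h0 : ζ = 0 := dotProduct_self_eq_zero.1 h.symm
    have h1 := hM 1
    rw [← hζ, ← hζ₀, h0] at h1
    have h2 : 0 < 4 * (β ⬝ᵥ β) * ∏ i, (1 + x i ^ 2) :=
      mul_pos (by positivity) (Finset.prod_pos fun i _ => by positivity)
    rw [← h1] at h2
    simp [interPoly] at h2
  set r := Real.sqrt (ζ ⬝ᵥ ζ) with hr
  have hr0 : 0 < r := Real.sqrt_pos.2 hζ0
  have hw : lor (vc ζ 0 r) (vc ζ 0 r) = 0 := by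
    rw [lor_vc, hr, Real.mul_self_sqrt hζ0.le]; ring
  obtain ⟨g₀, hg₀⟩ := exists_rho_mulVec_v₀ hw hr0
  have hg : rho n g₀⁻¹ *ᵥ vc ζ 0 r = v₀ n := by
    rw [← hg₀, Matrix.mulVec_mulVec, rho_inv_mul, Matrix.one_mulVec]
  obtain ⟨y, Y₁, β₁, γ, hY₁, -, hYβ₁, hAd, hM₁, hch₁⟩ := exists_normal_form (a := a) (c := c) hg hw
    (M := 4 * (β ⬝ᵥ β)) (x := x) (by rw [hζ, hζ₀]; exact hM) fun b hb => by
      rw [Ad_coe, conj_mulVec_v₀ hg] at hb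
      conv_rhs at hb => rw [← hg]
      rw [← Matrix.mulVec_smul] at hb
      rcases (eigenvector_tPrime ha₀ hc hr0 (mulVec_rho_inj _ hb)).2 with h | h <;> linarith
  obtain ⟨W, hW, hWY, hWβ⟩ := exists_orthogonal_of_charpoly_eq hY₁ hY
    (hch₁.trans ((charpoly_skew_iff hY card_Tr x).1 hch).symm) hYβ₁ hYβ (by linarith)
  obtain ⟨g', hg'⟩ := exists_Ad_eq_mM_conj a c hW ((y : SpinG n) * g₀⁻¹)
  refine ⟨g', ((q_iota_eq_iff _ _).2 ⟨W *ᵥ γ, ?_⟩).symm⟩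
  rw [hg', map_mul, Module.End.mul_apply, hAd, gM_add_nX, mM_conj_gM W, hZ, gM_add_nX, hWY,
    Matrix.mulVec_sub, Matrix.mulVec_add, hWβ, Matrix.mul_assoc, mul_eq_one_comm.1 hW,
    Matrix.mul_one]

theorem image_q {n : ℕ} {a : Fin (n - 1) → ℝ} (ha : StrictAnti a) (ha₀ : ∀ i, 0 < a i)
    {c : ℝ} (hc : 0 < c) {g' : SpinG n} (hg' : rho n g' = gInfMat n) :
    q n '' orbit (coad n) (iota (tPrime a c)) = orbit (coadP n) (q n (iota (tPrime a c))) ∪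
      orbit (coadP n) (q n (coad n g' (iota (tPrime a c)))) ∪
        {μ | ¬ DepthZero (orbit (coadP n) μ) ∧
          ∃ x : Fin (n - 1) → ℝ, HasSingularValues (orbit (coadP n) μ) x ∧
            (∀ i, x i ≤ a i) ∧ (∀ i j : Fin (n - 1), (j : ℕ) = i + 1 → a j ≤ x i)} := by
  have hstable : ∀ {φ : Module.Dual ℝ (gLie n)}, φ ∈ orbit (coad n) (iota (tPrime a c)) →
      ∀ x : ParP n, coadP n x (q n φ) ∈ q n '' orbit (coad n) (iota (tPrime a c)) := fun hφ x =>
    ⟨coadGP n x _, coadGP_mem_orbit hφ x, q_equivariant x _⟩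
  ext μ
  constructor
  · rintro ⟨φ, hφ, rfl⟩
    obtain ⟨g, rfl⟩ := mem_orbit_iota.1 hφ
    by_cases hd : ∃ b : ℝ, ((Ad n g (tPrime a c) : gLie n) : Mat n) *ᵥ v₀ n = b • v₀ n
    · obtain ⟨b, hb⟩ := hd
      exact .inl (q_mem_of_depthZero ha₀ hc hg' hb)
    · refine .inr ⟨fun h => hd (depthZero_iff.1 h), ?_⟩
      push Not at hd
      obtain ⟨x, hx, hx'⟩ := hasSingularValues_of_mem ha ha₀ hd
      exact ⟨x, hx, hx'.2⟩
  · rintro ((⟨x, rfl⟩ | ⟨x, rfl⟩) | ⟨-, x, ⟨-, hx₀, Z, Y, β, hZ, hβ, hYβ, hmem, hch⟩, hx⟩)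
    · exact hstable (mem_orbit_self _ _) x
    · exact hstable ⟨g', rfl⟩ x
    · obtain ⟨g, hg⟩ := exists_q_iota_eq ha ha₀ hc ⟨hx₀, hx⟩ hZ hβ hYβ hch
      rw [← hg] at hmem
      obtain ⟨y, hy⟩ : μ ∈ orbit (coadP n) (q n (iota (Ad n g (tPrime a c)))) := by
        rw [orbit_eq_of_mem _ hmem]
        exact mem_orbit_self _ _
      rw [← hy]
      exact hstable (mem_orbit_iota.2 ⟨g, rfl⟩) y

/-! ### The orbit is closed -/

theorem lor_mulVec_gLie {n : ℕ} (X : gLie n) (u v : Ix n → ℝ) :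
    lor ((X : Mat n) *ᵥ u) v = -lor u ((X : Mat n) *ᵥ v) := by
  have h : Jm n * (X : Mat n)ᵀ * Jm n = -(X : Mat n) := by
    rw [Matrix.mul_assoc, mem_gLie.1 X.2, Matrix.mul_neg, ← Matrix.mul_assoc, Jm_mul_Jm,
      Matrix.one_mul]
  rw [lor_mulVec, h, Matrix.neg_mulVec, lor_neg]

/-- `X²` is self-adjoint for the Lorentz form. -/
theorem lor_eq_zero_of_eigen {n : ℕ} (X : gLie n) {u v : Ix n → ℝ} {s t : ℝ} (hst : s ≠ t)
    (hu : (X : Mat n) *ᵥ ((X : Mat n) *ᵥ u) = s • u)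
    (hv : (X : Mat n) *ᵥ ((X : Mat n) *ᵥ v) = t • v) : lor u v = 0 := by
  have h : lor ((X : Mat n) *ᵥ ((X : Mat n) *ᵥ u)) v = lor u ((X : Mat n) *ᵥ ((X : Mat n) *ᵥ v)) := by
    rw [lor_mulVec_gLie, lor_mulVec_gLie, neg_neg]
  rw [hu, hv, smul_lor, lor_smul] at h
  have : (s - t) * lor u v = 0 := by linear_combination h
  simpa [sub_ne_zero.2 hst] using this

/-- Cauchy–Schwarz on the spatial parts: the orthogonal complement of a timelike vector is positive
definite. -/
theorem lor_self_pos_of_timelike {n : ℕ} {τ u : Ix n → ℝ} (hτ : lor τ τ < 0) (h : lor τ u = 0)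
    (hu : u ≠ 0) : 0 < lor u u := by
  by_cases hs : u (.inr ()) = 0
  · exact lor_self_pos hs hu
  rw [lor_eq] at hτ h ⊢
  have hcs := Finset.sum_mul_sq_le_sq_mul_sq Finset.univ (fun i : Sp n => τ (.inl i))
    fun i => u (.inl i)
  simp only [← pow_two] at hτ ⊢
  set A := ∑ i : Sp n, τ (.inl i) ^ 2
  set U := ∑ i : Sp n, u (.inl i) ^ 2
  have hA : 0 ≤ A := Finset.sum_nonneg fun i _ => sq_nonneg _
  rw [sub_eq_zero.1 h] at hcs
  have hs2 : 0 < u (.inr ()) ^ 2 := by positivity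
  have ht2 : 0 < τ (.inr ()) ^ 2 := by linarith
  by_contra! hle
  have h1 : A * U < τ (.inr ()) ^ 2 * u (.inr ()) ^ 2 := by nlinarith
  nlinarith

/-- A Lorentz basis in which `X` has the matrix `tPrime a c` conjugates it to `tPrime a c`. -/
theorem exists_Ad_tPrime_eq_of_basis {n : ℕ} {a : Fin (n - 1) → ℝ} (ha : StrictAnti a)
    (ha₀ : ∀ i, 0 < a i) {c : ℝ} (hc : 0 < c) {X : gLie n} {e f : Fin (n - 1) → Ix n → ℝ}
    {k v τ : Ix n → ℝ} (hXe : ∀ i, (X : Mat n) *ᵥ e i = (-a i) • f i)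
    (hXf : ∀ i, (X : Mat n) *ᵥ f i = a i • e i) (hk : (X : Mat n) *ᵥ k = 0)
    (hXv : (X : Mat n) *ᵥ v = c • τ) (hXτ : (X : Mat n) *ᵥ τ = c • v)
    (hee : ∀ i, lor (e i) (e i) = 1) (hkk : lor k k = 1) (hvv : lor v v = 1) (hττ : lor τ τ = -1)
    (hvτ : lor v τ = 0) (hτr : 0 < τ (.inr ())) : ∃ g : SpinG n, Ad n g (tPrime a c) = X := by
  have hX2τ : (X : Mat n) *ᵥ ((X : Mat n) *ᵥ τ) = c ^ 2 • τ := by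
    rw [hXτ, Matrix.mulVec_smul, hXv, smul_smul, pow_two]
  have hX2v : (X : Mat n) *ᵥ ((X : Mat n) *ᵥ v) = c ^ 2 • v := by
    rw [hXv, Matrix.mulVec_smul, hXτ, smul_smul, pow_two]
  have hX2e : ∀ i, (X : Mat n) *ᵥ ((X : Mat n) *ᵥ e i) = (-a i ^ 2) • e i := fun i => by
    rw [hXe, Matrix.mulVec_smul, hXf, smul_smul]
    congr 1
    ring
  have hX2f : ∀ i, (X : Mat n) *ᵥ ((X : Mat n) *ᵥ f i) = (-a i ^ 2) • f i := fun i => by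
    rw [hXf, Matrix.mulVec_smul, hXe, smul_smul]
    congr 1
    ring
  have hef : ∀ i, lor (e i) (f i) = 0 := fun i => by
    have h := lor_mulVec_gLie X (e i) (e i)
    rw [hXe, smul_lor, lor_smul, lor_comm (f i)] at h
    have : a i * lor (e i) (f i) = 0 := by linarith
    simpa [(ha₀ i).ne'] using this
  have hff : ∀ i, lor (f i) (f i) = 1 := fun i => by
    have h := lor_mulVec_gLie X (e i) (f i)
    rw [hXe, hXf, smul_lor, lor_smul, hee] at h
    have : a i * (lor (f i) (f i) - 1) = 0 := by linarith
    have := (mul_eq_zero.1 this).resolve_left (ha₀ i).ne'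
    linarith
  let B : Ix n → Ix n → ℝ := Sum.elim (Sum.elim (Sum.elim
    (fun l => if l.1 = 0 then e l.2 else f l.2) fun _ => k) fun _ => v) fun _ => τ
  -- The eigenvalues of `X²` on the basis. Distinct ones give orthogonality for free, so the Gram
  -- matrix only needs checking inside each plane and on the kernel line.
  let lam : Ix n → ℝ := Sum.elim (Sum.elim (Sum.elim
    (fun l => -a l.2 ^ 2) fun _ => 0) fun _ => c ^ 2) fun _ => c ^ 2
  have hB : ∀ j, (X : Mat n) *ᵥ ((X : Mat n) *ᵥ B j) = lam j • B j := by
    rintro (((⟨l, i⟩ | j) | j) | j)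
    · fin_cases l
      · exact hX2e i
      · exact hX2f i
    · change (X : Mat n) *ᵥ ((X : Mat n) *ᵥ k) = (0 : ℝ) • k
      rw [hk, Matrix.mulVec_zero, zero_smul]
    · exact hX2v
    · exact hX2τ
  have horth : ∀ i j, lam i ≠ lam j → lor (B i) (B j) = 0 := fun i j h =>
    lor_eq_zero_of_eigen X h (hB i) (hB j)
  set K : Mat n := Matrix.of fun i j => B j i with hK
  have hKx : ∀ (ζ : Tr n → ℝ) (s t : ℝ), K *ᵥ vc ζ s t =
      ∑ i, (ζ (.inl (0, i)) • e i + ζ (.inl (1, i)) • f i) + ζ (.inr ()) • k + s • v + t • τ := by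
    intro ζ s t
    have : K *ᵥ vc ζ s t = ∑ j, vc ζ s t j • B j := by
      ext i
      simp [hK, Matrix.mulVec, dotProduct, mul_comm]
    rw [this]
    simp [Fintype.sum_sum_type, Fintype.sum_prod_type, B, vc, Finset.sum_add_distrib]
  have hXK : (X : Mat n) * K = K * (tPrime a c : Mat n) := by
    refine Matrix.ext_of_mulVec_single fun j => ?_
    obtain ⟨ζ, s, t, h⟩ := exists_vc (Pi.single j (1 : ℝ) : Ix n → ℝ)
    rw [h, ← Matrix.mulVec_mulVec, ← Matrix.mulVec_mulVec, tPrime_mulVec_vc, hKx, hKx]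
    simp only [Matrix.mulVec_add, Matrix.mulVec_sum, Matrix.mulVec_smul, hXe, hXf, hk, hXv, hXτ,
      skewDiag_mulVec_zero, skewDiag_mulVec_one, skewDiag_mulVec_last]
    have : ∀ i, ζ (.inl (0, i)) • (-a i) • f i + ζ (.inl (1, i)) • a i • e i =
        (a i * ζ (.inl (1, i))) • e i + (-(a i * ζ (.inl (0, i)))) • f i := fun i => by module
    simp only [this]
    module
  have hLor : IsLor K := by
    have hgram : ∀ i j, (Kᵀ * Jm n * K) i j = lor (B i) (B j) := fun i j => by
      rw [Matrix.mul_assoc]; rfl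
    have hne : ∀ i, -a i ^ 2 < 0 := fun i => by have := ha₀ i; nlinarith
    have hc2 : 0 < c ^ 2 := by positivity
    have hinj : ∀ i j, i ≠ j → -a i ^ 2 ≠ -a j ^ 2 := fun i j hij h => by
      have := (pow_left_inj₀ (ha₀ i).le (ha₀ j).le two_ne_zero).1 (neg_injective h)
      exact hij (ha.injective this)
    ext i j
    rw [hgram]
    by_cases hl : lam i = lam j
    · rcases i with (((⟨l, i⟩ | i) | i) | i) <;> rcases j with (((⟨l', j⟩ | j) | j) | j)
      · have hij : i = j := by
          by_contra h
          exact hinj i j h hl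
        subst hij
        fin_cases l <;> fin_cases l' <;>
          simp [B, Jm_eq, hee, hff, hef, lor_comm (f i)]
      all_goals first
        | (exfalso; have := hne i; simp only [lam, Sum.elim_inl, Sum.elim_inr] at hl; linarith)
        | (exfalso; have := hne j; simp only [lam, Sum.elim_inl, Sum.elim_inr] at hl; linarith)
        | (exfalso; simp only [lam, Sum.elim_inl, Sum.elim_inr] at hl; linarith)
        | simp [B, Jm_eq, hkk, hvv, hττ, hvτ, lor_comm τ]
    · have hij : i ≠ j := fun h => hl (by rw [h])
      rw [horth i j hl, Jm_eq, Matrix.diagonal_apply_ne _ hij]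
  have hK0 : 0 < K (.inr ()) (.inr ()) := by
    exact hτr
  have key : ∀ g : SpinG n, (X : Mat n) * rho n g = rho n g * (tPrime a c : Mat n) →
      Ad n g (tPrime a c) = X := fun g hg => Subtype.ext (by
    rw [Ad_coe, ← hg, Matrix.mul_assoc, rho_mul_inv, Matrix.mul_one])
  rcases mul_self_eq_one_iff.1 hLor.det_sq with hd | hd
  · obtain ⟨g, hg⟩ := hLor.exists_rho hK0 hd
    exact ⟨g, key g (by rw [hg, hXK])⟩
  · obtain ⟨g, hg⟩ := (hLor.mul (isLor_mM (sRefl_transpose_mul n))).exists_rho (by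
      obtain ⟨Y, u, v, w, z, a', b', c', d, hX⟩ := exists_blk K
      rw [hX] at hK0 ⊢
      rw [mM, blk_mul]
      simpa [blk] using hK0) (by
      rw [Matrix.det_mul, hd, det_mM, det_sRefl]; norm_num)
    refine ⟨g, key g ?_⟩
    rw [hg, ← Matrix.mul_assoc, hXK, Matrix.mul_assoc, Matrix.mul_assoc,
      mM_mul_tPrime c (sRefl_mul_skewDiag a)]

/-- Eigenvectors for the eigenvalues `±c` span a Lorentzian plane. -/
theorem exists_hyperbolic_pair {n : ℕ} {X : gLie n} {c : ℝ} (hc : 0 < c) {p m : Ix n → ℝ}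
    (hp0 : p ≠ 0) (hm0 : m ≠ 0) (hp : (X : Mat n) *ᵥ p = c • p) (hm : (X : Mat n) *ᵥ m = (-c) • m) :
    ∃ v τ : Ix n → ℝ, (X : Mat n) *ᵥ v = c • τ ∧ (X : Mat n) *ᵥ τ = c • v ∧ lor v v = 1 ∧
      lor τ τ = -1 ∧ lor v τ = 0 ∧ 0 < τ (.inr ()) := by
  -- Skewness makes an eigenvector with nonzero eigenvalue null, so its time coordinate is nonzero
  -- and can be normalized to one.
  have hnull : ∀ {u : Ix n → ℝ} {s : ℝ}, s ≠ 0 → u ≠ 0 → (X : Mat n) *ᵥ u = s • u →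
      ∃ u', (X : Mat n) *ᵥ u' = s • u' ∧ lor u' u' = 0 ∧ u' (.inr ()) = 1 := by
    intro u s hs hu hXu
    have h0 : lor u u = 0 := by
      have := lor_mulVec_gLie X u u
      rw [hXu, smul_lor, lor_smul] at this
      have : s * lor u u = 0 := by linarith
      simpa [hs] using this
    have hr : u (.inr ()) ≠ 0 := fun h => (lor_self_pos h hu).ne' h0
    refine ⟨(u (.inr ()))⁻¹ • u, ?_, ?_, ?_⟩
    · rw [Matrix.mulVec_smul, hXu, smul_comm]
    · rw [smul_lor, lor_smul, h0]; simp
    · simp [hr]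
  obtain ⟨p, hp, hpp, hpr⟩ := hnull hc.ne' hp0 hp
  obtain ⟨m, hm, hmm, hmr⟩ := hnull (neg_ne_zero.2 hc.ne') hm0 hm
  have hpm : lor p m < 0 := by
    have hne : p - m ≠ 0 := fun h => by
      have e := sub_eq_zero.1 h
      rw [← e, hp] at hm
      have := congrFun hm (.inr ())
      simp [hpr] at this
      linarith
    have := lor_self_pos (u := p - m) (by simp [hpr, hmr]) hne
    rw [lor_sub, sub_lor, sub_lor, hpp, hmm, lor_comm m p] at this
    linarith
  obtain ⟨p, hp, hpp, hpr, hpm⟩ : ∃ p' : Ix n → ℝ, (X : Mat n) *ᵥ p' = c • p' ∧ lor p' p' = 0 ∧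
      0 < p' (.inr ()) ∧ lor p' m = -2 := by
    refine ⟨(2 / -lor p m) • p, ?_, ?_, ?_, ?_⟩
    · rw [Matrix.mulVec_smul, hp, smul_comm]
    · rw [smul_lor, lor_smul, hpp]; simp
    · have : 0 < -lor p m := by linarith
      simp only [Pi.smul_apply, hpr, smul_eq_mul]
      positivity
    · rw [smul_lor]
      field_simp
      rw [div_self hpm.ne]
  refine ⟨(1 / 2 : ℝ) • (p - m), (1 / 2 : ℝ) • (p + m), ?_, ?_, ?_, ?_, ?_, ?_⟩
  · rw [Matrix.mulVec_smul, Matrix.mulVec_sub, hp, hm]; module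
  · rw [Matrix.mulVec_smul, Matrix.mulVec_add, hp, hm]; module
  · simp only [smul_lor, lor_smul, lor_sub, sub_lor, lor_comm m p, hpp, hmm, hpm]; norm_num
  · simp only [smul_lor, lor_smul, lor_add, add_lor, lor_comm m p, hpp, hmm, hpm]; norm_num
  · simp only [smul_lor, lor_smul, lor_add, sub_lor, lor_comm m p, hpp, hmm, hpm]; norm_num
  · simp only [Pi.smul_apply, Pi.add_apply, hmr, smul_eq_mul]
    linarith

/-- An element of `𝔤` with the eigenvalues of `tPrime a c` is conjugate to it. -/
theorem exists_Ad_tPrime_eq {n : ℕ} {a : Fin (n - 1) → ℝ} (ha : StrictAnti a) (ha₀ : ∀ i, 0 < a i)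
    {c : ℝ} (hc : 0 < c) {X : gLie n} (h1 : ((X : Mat n) - c • (1 : Mat n)).det = 0)
    (h2 : ∀ i, ((X : Mat n) * (X : Mat n) + a i ^ 2 • (1 : Mat n)).det = 0) :
    ∃ g : SpinG n, Ad n g (tPrime a c) = X := by
  have hJX : (X : Mat n)ᵀ = -(Jm n * (X : Mat n) * Jm n) := by
    have := congrArg (· * Jm n) (mem_gLie.1 X.2)
    simpa only [Matrix.mul_assoc, Jm_mul_Jm, Matrix.mul_one, Matrix.neg_mul] using this
  -- In odd dimension, skewness turns the eigenvalue `c` into `-c` as well, and `s = 0` gives a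
  -- kernel vector.
  have hdet : ∀ s : ℝ, ((X : Mat n) - s • (1 : Mat n)).det = -((X : Mat n) + s • (1 : Mat n)).det := by
    intro s
    have e : ((X : Mat n) - s • (1 : Mat n))ᵀ = -(Jm n * ((X : Mat n) + s • (1 : Mat n)) * Jm n) := by
      rw [Matrix.transpose_sub, hJX, Matrix.mul_add, Matrix.add_mul, Matrix.mul_smul, Matrix.mul_one,
        Matrix.smul_mul, Jm_mul_Jm, Matrix.transpose_smul, Matrix.transpose_one, neg_add, sub_eq_add_neg]
    have hJ := congrArg Matrix.det (Jm_mul_Jm n)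
    rw [Matrix.det_mul, Matrix.det_one] at hJ
    rw [← Matrix.det_transpose, e, Matrix.det_neg, (card_Ix_odd n).neg_one_pow, Matrix.det_mul,
      Matrix.det_mul]
    linear_combination (-((X : Mat n) + s • (1 : Mat n)).det) * hJ
  obtain ⟨p, hp0, hp⟩ := Matrix.exists_mulVec_eq_zero_iff.2 h1
  obtain ⟨m, hm0, hm⟩ := Matrix.exists_mulVec_eq_zero_iff.2
    (by rw [hdet, neg_eq_zero] at h1; exact h1 : ((X : Mat n) + c • (1 : Mat n)).det = 0)
  obtain ⟨k, hk0, hk⟩ := Matrix.exists_mulVec_eq_zero_iff.2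
    (by have := hdet 0; rw [zero_smul, sub_zero, add_zero] at this; linarith : (X : Mat n).det = 0)
  rw [Matrix.sub_mulVec, Matrix.smul_mulVec, Matrix.one_mulVec, sub_eq_zero] at hp
  rw [Matrix.add_mulVec, Matrix.smul_mulVec, Matrix.one_mulVec, ← sub_neg_eq_add, sub_eq_zero,
    ← neg_smul] at hm
  obtain ⟨v, τ, hXv, hXτ, hvv, hττ, hvτ, hτr⟩ := exists_hyperbolic_pair hc hp0 hm0 hp hm
  have hX2τ : (X : Mat n) *ᵥ ((X : Mat n) *ᵥ τ) = c ^ 2 • τ := by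
    rw [hXτ, Matrix.mulVec_smul, hXv, smul_smul, pow_two]
  -- Eigenvectors of `X²` for other eigenvalues are orthogonal to the timelike `τ`, hence spacelike.
  have hunit : ∀ {u : Ix n → ℝ} {s : ℝ}, s ≠ c ^ 2 → u ≠ 0 →
      (X : Mat n) *ᵥ ((X : Mat n) *ᵥ u) = s • u → ∃ κ : ℝ, lor (κ • u) (κ • u) = 1 := by
    intro u s hs hu hXu
    have hpos := lor_self_pos_of_timelike (by rw [hττ]; norm_num)
      (lor_eq_zero_of_eigen X (Ne.symm hs) hX2τ hXu) hu
    refine ⟨(Real.sqrt (lor u u))⁻¹, ?_⟩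
    have h0 := Real.sqrt_pos.2 hpos
    rw [smul_lor, lor_smul]
    nth_rewrite 3 [← Real.mul_self_sqrt hpos.le]
    field_simp
  obtain ⟨k, hk, hkk⟩ : ∃ k', (X : Mat n) *ᵥ k' = 0 ∧ lor k' k' = 1 := by
    obtain ⟨κ, hκ⟩ := hunit (s := 0) (by positivity) hk0 (by rw [hk, Matrix.mulVec_zero, zero_smul])
    exact ⟨κ • k, by rw [Matrix.mulVec_smul, hk, smul_zero], hκ⟩
  have he : ∀ i, ∃ e, (X : Mat n) *ᵥ ((X : Mat n) *ᵥ e) = (-a i ^ 2) • e ∧ lor e e = 1 := by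
    intro i
    obtain ⟨e, he0, he⟩ := Matrix.exists_mulVec_eq_zero_iff.2 (h2 i)
    rw [Matrix.add_mulVec, Matrix.smul_mulVec, Matrix.one_mulVec, ← sub_neg_eq_add, sub_eq_zero,
      ← neg_smul, ← Matrix.mulVec_mulVec] at he
    obtain ⟨κ, hκ⟩ := hunit (by have := ha₀ i; nlinarith [sq_nonneg c, sq_nonneg (a i)]) he0 he
    exact ⟨κ • e, by rw [Matrix.mulVec_smul, Matrix.mulVec_smul, he, smul_comm], hκ⟩
  choose e hX2e hee using he
  refine exists_Ad_tPrime_eq_of_basis (e := e) (f := fun i => (-(a i)⁻¹) • ((X : Mat n) *ᵥ e i)) ha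
    ha₀ hc (fun i => ?_) (fun i => ?_) hk hXv hXτ hee hkk hvv hττ hvτ hτr
  · rw [smul_smul, neg_mul_neg, mul_inv_cancel₀ (ha₀ i).ne', one_smul]
  · have := (ha₀ i).ne'
    rw [Matrix.mulVec_smul, hX2e, smul_smul]
    congr 1
    field_simp

theorem det_Ad_tPrime_sub {n : ℕ} (a : Fin (n - 1) → ℝ) (c : ℝ) (g : SpinG n) :
    (((Ad n g (tPrime a c) : gLie n) : Mat n) - c • (1 : Mat n)).det = 0 := by
  refine Matrix.exists_mulVec_eq_zero_iff.1 ⟨rho n g *ᵥ v₀ n, fun h => ?_, ?_⟩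
  · have := rho_mulVec_inr_pos g
    rw [h] at this
    exact lt_irrefl _ this
  · rw [Ad_coe, Matrix.sub_mulVec, Matrix.mulVec_mulVec, Matrix.mul_assoc, rho_inv_mul,
      Matrix.mul_one, ← Matrix.mulVec_mulVec, tPrime_mulVec_v₀, Matrix.smul_mulVec,
      Matrix.one_mulVec, Matrix.mulVec_smul, sub_self]

theorem det_Ad_tPrime_sq_add {n : ℕ} (a : Fin (n - 1) → ℝ) (c : ℝ) (g : SpinG n)
    (i : Fin (n - 1)) : (((Ad n g (tPrime a c) : gLie n) : Mat n) *
      ((Ad n g (tPrime a c) : gLie n) : Mat n) + a i ^ 2 • (1 : Mat n)).det = 0 := by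
  set w : Ix n → ℝ := vc (Pi.single (.inl (0, i)) 1) 0 0 with hw
  have hTw : (tPrime a c : Mat n) *ᵥ ((tPrime a c : Mat n) *ᵥ w) = (-a i ^ 2) • w := by
    rw [hw, tPrime_mulVec_vc, tPrime_mulVec_vc, smul_vc, vc_inj]
    generalize hδ : (Pi.single (.inl (0, i)) 1 : Tr n → ℝ) = δ
    refine ⟨?_, by simp, by simp⟩
    ext k
    rcases k with ⟨k, j⟩ | k
    · fin_cases k
      · change (skewDiag a *ᵥ (skewDiag a *ᵥ δ)) (.inl (0, j)) = _
        rw [skewDiag_mulVec_zero, skewDiag_mulVec_one, ← hδ]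
        by_cases hij : j = i
        · subst hij
          simp [pow_two]
        · simp [hij]
      · change (skewDiag a *ᵥ (skewDiag a *ᵥ δ)) (.inl (1, j)) = _
        rw [skewDiag_mulVec_one, skewDiag_mulVec_zero, ← hδ]
        simp
    · rw [skewDiag_mulVec_last, ← hδ]
      simp
  refine Matrix.exists_mulVec_eq_zero_iff.1 ⟨rho n g *ᵥ w, fun h => ?_, ?_⟩
  · have h0 : w = 0 := mulVec_rho_inj g (by rw [h, Matrix.mulVec_zero])
    have := congrFun h0 (.inl (.inl (.inl (0, i))))
    simp [hw, vc] at this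
  · have h1 : ∀ x, (rho n g * (tPrime a c : Mat n) * rho n g⁻¹) *ᵥ (rho n g *ᵥ x) =
        rho n g *ᵥ ((tPrime a c : Mat n) *ᵥ x) := fun x => by
      rw [Matrix.mulVec_mulVec, Matrix.mul_assoc, rho_inv_mul, Matrix.mul_one, Matrix.mulVec_mulVec]
    rw [Ad_coe, Matrix.add_mulVec, ← Matrix.mulVec_mulVec, h1, h1, hTw, Matrix.smul_mulVec,
      Matrix.one_mulVec, Matrix.mulVec_smul, neg_smul, neg_add_cancel]

/-! ### Topology of the dual spaces -/

theorem continuous_eval_dual {W : Type*} [AddCommGroup W] [Module ℝ W] (w : W) :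
    Continuous fun φ : Module.Dual ℝ W => φ w :=
  (continuous_apply w).comp continuous_induced_dom

theorem t2Space_dual (W : Type*) [AddCommGroup W] [Module ℝ W] : T2Space (Module.Dual ℝ W) :=
  Topology.IsEmbedding.t2Space (f := fun (φ : Module.Dual ℝ W) w => φ w)
    ⟨⟨rfl⟩, DFunLike.coe_injective⟩

/-- By reflexivity every functional on the dual is an evaluation, and evaluations are continuous for
pointwise convergence. -/
theorem continuous_linear_dual {W : Type*} [AddCommGroup W] [Module ℝ W] [FiniteDimensional ℝ W]
    (L : Module.Dual ℝ W →ₗ[ℝ] ℝ) : Continuous L := by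
  obtain ⟨w, hw⟩ := (Module.evalEquiv ℝ W).surjective L
  have : (L : Module.Dual ℝ W → ℝ) = fun φ => φ w := by
    funext φ
    rw [← hw]
    rfl
  rw [this]
  exact continuous_eval_dual w

theorem continuous_q (n : ℕ) : Continuous (q n) :=
  continuous_induced_rng.2 (continuous_pi fun Z => continuous_eval_dual (Z : gLie n))

theorem iota_injective {n : ℕ} : Function.Injective (iota : gLie n → _) := by
  intro X X' h
  -- `𝔤` is stable under transposition, so the difference can be tested against its own transpose,
  -- which gives its Frobenius norm.
  have hD : ((X : Mat n) - (X' : Mat n))ᵀ ∈ gLie n := by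
    have h1 := mem_gLie.1 (X - X').2
    change ((X : Mat n) - (X' : Mat n))ᵀ * Jm n = -(Jm n * ((X : Mat n) - (X' : Mat n))) at h1
    rw [mem_gLie, Matrix.transpose_transpose]
    have h2 := congrArg (fun M => Jm n * M * Jm n) h1
    simp only [Matrix.mul_assoc, Jm_mul_Jm, Matrix.mul_one, Matrix.mul_neg, Matrix.neg_mul] at h2
    rw [← Matrix.mul_assoc, ← Matrix.mul_assoc, Jm_mul_Jm, Matrix.one_mul] at h2
    rw [h2, neg_neg]
  have h1 := LinearMap.congr_fun h ⟨_, hD⟩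
  change (1 / 2) * ((X : Mat n) * ((X : Mat n) - (X' : Mat n))ᵀ).trace =
    (1 / 2) * ((X' : Mat n) * ((X : Mat n) - (X' : Mat n))ᵀ).trace at h1
  have h2 : (((X : Mat n) - (X' : Mat n)) * ((X : Mat n) - (X' : Mat n))ᴴ).trace = 0 := by
    rw [Matrix.conjTranspose_eq_transpose_of_trivial, Matrix.sub_mul, Matrix.trace_sub]
    linarith
  exact Subtype.ext (sub_eq_zero.1 (Matrix.trace_mul_conjTranspose_self_eq_zero_iff.1 h2))

/-- `iota` as a linear equivalence. -/
def iotaEquiv (n : ℕ) : gLie n ≃ₗ[ℝ] Module.Dual ℝ (gLie n) :=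
  LinearEquiv.ofInjectiveOfFinrankEq
    { toFun := iota
      map_add' := fun X X' => LinearMap.ext fun Z => by
        change (1 / 2) * (((X : Mat n) + (X' : Mat n)) * (Z : Mat n)).trace = (1 / 2) *
          ((X : Mat n) * (Z : Mat n)).trace + (1 / 2) * ((X' : Mat n) * (Z : Mat n)).trace
        rw [Matrix.add_mul, Matrix.trace_add, mul_add]
      map_smul' := fun c X => LinearMap.ext fun Z => by
        change (1 / 2) * ((c • (X : Mat n)) * (Z : Mat n)).trace = c * ((1 / 2) *
          ((X : Mat n) * (Z : Mat n)).trace)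
        rw [Matrix.smul_mul, Matrix.trace_smul, smul_eq_mul]
        ring }
    iota_injective (Subspace.dual_finrank_eq (K := ℝ) (V := gLie n)).symm

theorem iota_iotaEquiv_symm {n : ℕ} (φ : Module.Dual ℝ (gLie n)) :
    iota ((iotaEquiv n).symm φ) = φ := (iotaEquiv n).apply_symm_apply φ

theorem continuous_iotaEquiv_symm (n : ℕ) :
    Continuous fun φ : Module.Dual ℝ (gLie n) => (((iotaEquiv n).symm φ : gLie n) : Mat n) :=
  continuous_matrix fun i j => continuous_linear_dual
    ((LinearMap.proj j ∘ₗ LinearMap.proj i) ∘ₗ (gLie n).toSubmodule.subtype ∘ₗ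
      (iotaEquiv n).symm.toLinearMap)

/-- The orbit is the common zero set of `det (X - c)` and the `det (X² + aᵢ²)`: these eigenvalues
determine the conjugacy class because the spectrum is simple. -/
theorem isClosed_orbit_tPrime {n : ℕ} {a : Fin (n - 1) → ℝ} (ha : StrictAnti a)
    (ha₀ : ∀ i, 0 < a i) {c : ℝ} (hc : 0 < c) :
    IsClosed (orbit (coad n) (iota (tPrime a c : gLie n))) := by
  set m : Module.Dual ℝ (gLie n) → Mat n := fun φ => (((iotaEquiv n).symm φ : gLie n) : Mat n)
  have hm : Continuous m := continuous_iotaEquiv_symm n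
  have h : orbit (coad n) (iota (tPrime a c : gLie n)) =
      {φ | (m φ - c • (1 : Mat n)).det = 0} ∩
        ⋂ i, {φ | (m φ * m φ + a i ^ 2 • (1 : Mat n)).det = 0} := by
    ext φ
    rw [mem_orbit_iota, Set.mem_inter_iff, Set.mem_iInter]
    constructor
    · rintro ⟨g, rfl⟩
      have : m (iota (Ad n g (tPrime a c))) = ((Ad n g (tPrime a c) : gLie n) : Mat n) := by
        change (((iotaEquiv n).symm (iotaEquiv n _) : gLie n) : Mat n) = _
        rw [LinearEquiv.symm_apply_apply]
      refine ⟨?_, fun i => ?_⟩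
      · change (m _ - _).det = 0
        rw [this]
        exact det_Ad_tPrime_sub a c g
      · change (m _ * m _ + _).det = 0
        rw [this]
        exact det_Ad_tPrime_sq_add a c g i
    · rintro ⟨h1, h2⟩
      obtain ⟨g, hg⟩ := exists_Ad_tPrime_eq ha ha₀ hc h1 h2
      exact ⟨g, by rw [hg, iota_iotaEquiv_symm]⟩
  rw [h]
  refine IsClosed.inter ?_ (isClosed_iInter fun i => ?_)
  · exact isClosed_eq (hm.sub continuous_const).matrix_det continuous_const
  · exact isClosed_eq ((hm.matrix_mul hm).add continuous_const).matrix_det continuous_const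

/-! ### The moment map is not proper -/

theorem exists_ParP_rho_eq_nMat {n : ℕ} (α : Tr n → ℝ) : ∃ x : ParP n, rho n x = nMat α :=
  exists_mem_ParP_of_mulVec_v₀ (isLor_nMat α) (det_nMat α) (nMat_mulVec_v₀ α)

/-- The last transversal vector is killed by `skewDiag a`, so translating along it in `N` moves the
base point only by an element of `𝔫`. The fibre through the base point thus contains a line. -/
theorem exists_Ad_eq_tPrime_add {n : ℕ} (a : Fin (n - 1) → ℝ) (c s : ℝ) :
    ∃ x : ParP n, ((Ad n x (tPrime a c) : gLie n) : Mat n) =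
      (tPrime a c : Mat n) + nX ((-(c * s)) • eLast n) := by
  obtain ⟨x, hx⟩ := exists_ParP_rho_eq_nMat (s • eLast n)
  refine ⟨x, ?_⟩
  have h0 : skewDiag a *ᵥ eLast n = 0 := by
    ext k
    rcases k with ⟨k, i⟩ | k
    · fin_cases k
      · exact (skewDiag_mulVec_zero a _ i).trans (by simp [eLast])
      · exact (skewDiag_mulVec_one a _ i).trans (by simp [eLast])
    · exact skewDiag_mulVec_last a _
  have h0' : eLast n ᵥ* skewDiag a = 0 := by
    rw [← Matrix.mulVec_transpose, skewDiag_transpose, Matrix.neg_mulVec, h0, neg_zero]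
  have e2 : (eLast n) ⬝ᵥ (eLast n) = 1 := by simp [eLast]
  have h1 : nMat (s • eLast n) * (tPrime a c : Mat n) =
      ((tPrime a c : Mat n) + nX ((-(c * s)) • eLast n)) * nMat (s • eLast n) := by
    rw [tPrime_coe, gM_add_nX, nMat, gM, gM, blk_mul, blk_mul, blk_inj]
    generalize eLast n = ε at *
    refine ⟨?_, ?_, ?_, ?_, ?_, ?_, ?_, ?_, ?_⟩
    · ext i j
      simp [vecMulVec_apply]
    all_goals
      simp [Matrix.mulVec_smul, Matrix.smul_vecMul, h0, h0', Matrix.mulVec_neg, e2]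
      try first | module | ring
  rw [Ad_coe, hx, h1, ← hx, Matrix.mul_assoc, rho_mul_inv, Matrix.mul_one]

theorem not_isProperMap_q {n : ℕ} {a : Fin (n - 1) → ℝ} {c : ℝ} (hc : 0 < c) :
    ¬ IsProperMap (fun φ : orbit (coad n) (iota (tPrime a c : gLie n)) =>
      q n (φ : Module.Dual ℝ (gLie n))) := by
  intro h
  have hK := h.isCompact_preimage (isCompact_singleton (x := q n (iota (tPrime a c))))
  let Z : gLie n := ⟨gM 0 (eLast n) (eLast n) 0, gM_mem (by simp) _ _ _⟩
  have hb := (hK.image ((continuous_eval_dual Z).comp continuous_subtype_val)).bddAbove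
  obtain ⟨C, hC⟩ := hb
  set τ : ℝ := iota (tPrime a c) Z with hτ
  -- The parameter is chosen so that evaluation at `Z` gives `C + 1`, beyond the supposed bound on
  -- the fibre.
  obtain ⟨x, hx⟩ := exists_Ad_eq_tPrime_add a c (-(C - τ + 1) / (2 * c))
  have hmem : iota (Ad n x (tPrime a c)) ∈ orbit (coad n) (iota (tPrime a c)) :=
    mem_orbit_iota.2 ⟨x, rfl⟩
  have h1 : iota (Ad n x (tPrime a c)) Z ≤ C := by
    refine hC ⟨⟨_, hmem⟩, ?_, rfl⟩
    exact ((q_iota_eq_iff _ _).2 ⟨_, hx⟩).symm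
  have h2 : iota (Ad n x (tPrime a c)) Z = τ + (C - τ + 1) := by
    change (1 / 2) * (((Ad n x (tPrime a c) : gLie n) : Mat n) * (Z : Mat n)).trace =
      (1 / 2) * ((tPrime a c : Mat n) * (Z : Mat n)).trace + _
    rw [hx, Matrix.add_mul, Matrix.trace_add, mul_add]
    congr 1
    change (1 / 2) * (nX _ * gM 0 (eLast n) (eLast n) 0).trace = _
    rw [nX, gM, blk_mul, blk_trace]
    simp [Matrix.trace_vecMulVec, eLast]
    field_simp
    ring
  linarith

/-! ### Regular functionals have depth one -/

theorem exists_ne_zero_mulVec_eq_zero {n : ℕ} {Y : Matrix (Tr n) (Tr n) ℝ} (hY : Yᵀ = -Y) :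
    ∃ β, β ≠ 0 ∧ Y *ᵥ β = 0 := by
  refine Matrix.exists_mulVec_eq_zero_iff.2 ?_
  have h := congrArg Matrix.det hY
  rw [Matrix.det_transpose, Matrix.det_neg, card_Tr, pow_succ, pow_mul] at h
  norm_num at h
  linarith

theorem pElt_lie {n : ℕ} {Y Y' : Matrix (Tr n) (Tr n) ℝ} (hY : Yᵀ = -Y) (hY' : Y'ᵀ = -Y')
    (α α' : Tr n → ℝ) (a a' : ℝ) :
    ∃ h, ⁅pElt Y hY α a, pElt Y' hY' α' a'⁆ = pElt (Y * Y' - Y' * Y) h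
      (α ᵥ* Y' + a • α' - (α' ᵥ* Y + a' • α)) 0 := by
  refine ⟨by rw [Matrix.transpose_sub, Matrix.transpose_mul, Matrix.transpose_mul, hY, hY']; simp,
    Subtype.ext (Subtype.ext ?_)⟩
  have e1 : Y *ᵥ α' = -(α' ᵥ* Y) := by rw [← Matrix.mulVec_transpose, hY, neg_mulVec, neg_neg]
  have e2 : Y' *ᵥ α = -(α ᵥ* Y') := by rw [← Matrix.mulVec_transpose, hY', neg_mulVec, neg_neg]
  change ⁅blk Y (-α) α α α 0 a a 0, blk Y' (-α') α' α' α' 0 a' a' 0⁆ = blk _ _ _ _ _ _ _ _ _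
  rw [LieRing.of_associative_ring_bracket, blk_mul, blk_mul, blk_sub]
  congr 1 <;> simp [e1, e2, Matrix.mulVec_neg, neg_vecMulVec, dotProduct_comm α' α]
  all_goals ring

/-- At depth zero, adding an `𝔫`-component `β` from the kernel of `Y`, which is nonzero in odd
dimension, shrinks the stabilizer strictly: the new one lies in the old one and loses the direction
of `𝔞`. -/
theorem add_ne_zero_of_isRegular {n : ℕ} {X : gLie n} {Y : Matrix (Tr n) (Tr n) ℝ}
    {u v : Tr n → ℝ} {b : ℝ} (hY : Yᵀ = -Y) (hX : (X : Mat n) = gM Y u v b)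
    (hreg : IsRegular (q n (iota X))) : u + v ≠ 0 := by
  intro huv
  obtain ⟨β, hβ, hYβ⟩ := exists_ne_zero_mulVec_eq_zero hY
  set X' : gLie n := ⟨gM Y β 0 b, gM_mem hY _ _ _⟩ with hX'
  have hβ2 : β ⬝ᵥ β ≠ 0 := fun h => hβ (dotProduct_self_eq_zero.1 h)
  have hμ : ∀ (Z : Matrix (Tr n) (Tr n) ℝ) (hZ : Zᵀ = -Z) (α : Tr n → ℝ) (s : ℝ),
      q n (iota X) (pElt Z hZ α s) = (1 / 2) * (Y * Z).trace + b * s := fun Z hZ α s => by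
    rw [q_iota_pElt hX, huv, zero_dotProduct, add_zero]
  have hμ' : ∀ (Z : Matrix (Tr n) (Tr n) ℝ) (hZ : Zᵀ = -Z) (α : Tr n → ℝ) (s : ℝ),
      q n (iota X') (pElt Z hZ α s) = (1 / 2) * (Y * Z).trace + β ⬝ᵥ α + b * s :=
    fun Z hZ α s => by rw [q_iota_pElt (X := X') rfl, add_zero]
  have hstab : ∀ {Z : Matrix (Tr n) (Tr n) ℝ} {hZ : Zᵀ = -Z} {α : Tr n → ℝ} {s : ℝ},
      pElt Z hZ α s ∈ stab (q n (iota X')) → s = 0 ∧ pElt Z hZ α s ∈ stab (q n (iota X)) := by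
    intro Z hZ α s h
    have H : ∀ (Z' : Matrix (Tr n) (Tr n) ℝ) (_ : Z'ᵀ = -Z') (α' : Tr n → ℝ) (s' : ℝ),
        (1 / 2) * (Y * (Z * Z' - Z' * Z)).trace +
          β ⬝ᵥ (α ᵥ* Z' + s • α' - (α' ᵥ* Z + s' • α)) = 0 := fun Z' hZ' α' s' => by
      obtain ⟨h1, h2⟩ := pElt_lie hZ hZ' α α' s s'
      have h3 := h (pElt Z' hZ' α' s')
      rw [h2, hμ'] at h3
      simpa using h3
    have hα' : ∀ α' : Tr n → ℝ, s * (β ⬝ᵥ α') - (Z *ᵥ β) ⬝ᵥ α' = 0 := fun α' => by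
      have h1 := H 0 (by simp) α' 0
      have h2 : β ⬝ᵥ (α' ᵥ* Z) = (Z *ᵥ β) ⬝ᵥ α' := by
        rw [dotProduct_comm, ← Matrix.dotProduct_mulVec, dotProduct_comm]
      simp only [Matrix.zero_mul, sub_zero, Matrix.trace_zero, mul_zero, zero_add,
        Matrix.vecMul_zero, zero_smul, add_zero, dotProduct_sub, dotProduct_smul, smul_eq_mul] at h1
      linarith
    have hZββ : (Z *ᵥ β) ⬝ᵥ β = 0 := by
      have h1 : (Z *ᵥ β) ⬝ᵥ β = -((Z *ᵥ β) ⬝ᵥ β) := by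
        conv_lhs => rw [dotProduct_comm, Matrix.dotProduct_mulVec, ← Matrix.mulVec_transpose, hZ,
          Matrix.neg_mulVec, neg_dotProduct]
      linarith
    have hs : s = 0 := by
      have := hα' β
      rw [hZββ, sub_zero] at this
      exact (mul_eq_zero.1 this).resolve_right hβ2
    have hZβ : Z *ᵥ β = 0 := by
      have := hα' (Z *ᵥ β)
      rw [hs, zero_mul, zero_sub, neg_eq_zero] at this
      exact dotProduct_self_eq_zero.1 this
    have hβα : β ⬝ᵥ α = 0 := by
      have := H 0 (by simp) 0 1
      simpa using this
    have hβZ : β ᵥ* Z = 0 := by rw [← Matrix.mulVec_transpose, hZ, Matrix.neg_mulVec, hZβ, neg_zero]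
    have hβY : β ᵥ* Y = 0 := by rw [← Matrix.mulVec_transpose, hY, Matrix.neg_mulVec, hYβ, neg_zero]
    have hα : α = 0 := by
      -- Testing on `α ∧ β` leaves `|α|² |β|² = 0`, because `β` is killed by `Y` and `Z` and is
      -- orthogonal to `α`.
      have h1 := H (vecMulVec α β - vecMulVec β α)
        (by simp [Matrix.transpose_sub, Matrix.transpose_vecMulVec]) 0 0
      have h2 : (Y * (Z * (vecMulVec α β - vecMulVec β α) -
          (vecMulVec α β - vecMulVec β α) * Z)).trace = 0 := by
        simp only [Matrix.mul_sub, Matrix.sub_mul, Matrix.mul_vecMulVec, Matrix.vecMulVec_mul, hZβ,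
          hβZ, hYβ, Matrix.trace_sub, Matrix.trace_vecMulVec]
        simp only [Matrix.mulVec_zero, zero_dotProduct, dotProduct_zero, sub_zero, sub_self]
        rw [Matrix.mulVec_mulVec, dotProduct_comm, Matrix.dotProduct_mulVec, ← Matrix.vecMul_vecMul,
          hβY, Matrix.zero_vecMul, zero_dotProduct]
      rw [h2] at h1
      have h3 : β ⬝ᵥ (α ᵥ* (vecMulVec α β - vecMulVec β α)) = (α ⬝ᵥ α) * (β ⬝ᵥ β) := by
        rw [Matrix.vecMul_sub, Matrix.vecMul_vecMulVec, Matrix.vecMul_vecMulVec, dotProduct_sub,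
          dotProduct_smul, dotProduct_smul, hβα]
        simp
      simp only [mul_zero, zero_add, smul_zero, add_zero, Matrix.zero_vecMul, zero_smul, sub_zero] at h1
      rw [h3] at h1
      exact dotProduct_self_eq_zero.1 ((mul_eq_zero.1 h1).resolve_right hβ2)
    refine ⟨hs, fun Z'' => ?_⟩
    obtain ⟨Z', hZ', α', s', rfl⟩ := exists_pElt Z''
    obtain ⟨h1, h2⟩ := pElt_lie hZ hZ' α α' s s'
    have h3 := H Z' hZ' 0 0
    rw [h2, hμ]
    rw [hα] at h3
    simpa using h3
  have hlt : stab (q n (iota X')) < stab (q n (iota X)) := by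
    refine lt_of_le_of_ne (fun W hW => ?_) fun heq => ?_
    · obtain ⟨Z, hZ, α, s, rfl⟩ := exists_pElt W
      exact (hstab hW).2
    · have h0 : (0 : Matrix (Tr n) (Tr n) ℝ)ᵀ = -0 := by simp
      have hmem : pElt 0 h0 (0 : Tr n → ℝ) 1 ∈ stab (q n (iota X)) := by
        intro W
        obtain ⟨Z, hZ, α, s, rfl⟩ := exists_pElt W
        obtain ⟨h1, h2⟩ := pElt_lie h0 hZ 0 α 1 s
        rw [h2, hμ]
        simp
      rw [← heq] at hmem
      exact one_ne_zero (hstab hmem).1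
  exact absurd (hreg (q n (iota X'))) (not_le.2 (Submodule.finrank_lt_finrank_of_lt hlt))

/-! ### The moment map is weakly proper -/

theorem gM_mul_self {n : ℕ} {Y : Matrix (Tr n) (Tr n) ℝ} (hY : Yᵀ = -Y) (u v : Tr n → ℝ) (b : ℝ) :
    gM Y u v b * gM Y u v b = blk (Y * Y - vecMulVec u u + vecMulVec v v) (Y *ᵥ u + b • v)
      (Y *ᵥ v + b • u) (Y *ᵥ u + b • v) (-(Y *ᵥ v + b • u)) (b ^ 2 - u ⬝ᵥ u) (-(u ⬝ᵥ v)) (u ⬝ᵥ v)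
      (v ⬝ᵥ v + b ^ 2) := by
  have h : ∀ x : Tr n → ℝ, x ᵥ* Y = -(Y *ᵥ x) := fun x => by
    rw [← Matrix.mulVec_transpose, hY, Matrix.neg_mulVec]
  rw [gM, blk_mul, blk_inj]
  refine ⟨?_, ?_, ?_, ?_, ?_, ?_, ?_, ?_, ?_⟩ <;>
    simp [h, Matrix.mulVec_neg, Matrix.vecMulVec_neg, dotProduct_comm v u, pow_two] <;> abel

theorem trace_gM_pow_four {n : ℕ} {Y : Matrix (Tr n) (Tr n) ℝ} (hY : Yᵀ = -Y) (u v : Tr n → ℝ)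
    (b : ℝ) : (gM Y u v b * gM Y u v b * (gM Y u v b * gM Y u v b)).trace =
      (Y * Y * (Y * Y)).trace + 4 * ((Y *ᵥ u) ⬝ᵥ (Y *ᵥ u) - (Y *ᵥ v) ⬝ᵥ (Y *ᵥ v)) +
        8 * b * ((Y *ᵥ u) ⬝ᵥ v) + 4 * b ^ 2 * (v ⬝ᵥ v - u ⬝ᵥ u) + 2 * b ^ 4 +
        2 * ((u ⬝ᵥ u) ^ 2 + (v ⬝ᵥ v) ^ 2 - 2 * (u ⬝ᵥ v) ^ 2) := by
  have h : ∀ x y : Tr n → ℝ, x ⬝ᵥ (Y *ᵥ y) = -((Y *ᵥ x) ⬝ᵥ y) := fun x y => by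
    rw [Matrix.dotProduct_mulVec, ← Matrix.mulVec_transpose, hY, Matrix.neg_mulVec, neg_dotProduct]
  have h' : ∀ x : Tr n → ℝ, x ᵥ* (Y * Y) = Y *ᵥ (Y *ᵥ x) := fun x => by
    rw [← Matrix.mulVec_transpose, Matrix.transpose_mul, hY, neg_mul_neg,
      Matrix.mulVec_mulVec]
  have hA : ((Y * Y - vecMulVec u u + vecMulVec v v) * (Y * Y - vecMulVec u u + vecMulVec v v)).trace =
      (Y * Y * (Y * Y)).trace + 2 * ((Y *ᵥ u) ⬝ᵥ (Y *ᵥ u) - (Y *ᵥ v) ⬝ᵥ (Y *ᵥ v)) +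
        ((u ⬝ᵥ u) ^ 2 + (v ⬝ᵥ v) ^ 2 - 2 * (u ⬝ᵥ v) ^ 2) := by
    simp only [Matrix.add_mul, Matrix.sub_mul, Matrix.mul_add, Matrix.mul_sub, Matrix.trace_add,
      Matrix.trace_sub, Matrix.mul_vecMulVec, Matrix.vecMulVec_mul, Matrix.trace_vecMulVec, h',
      ← Matrix.mulVec_mulVec, h, Matrix.vecMulVec_mulVec, op_smul_eq_smul,
      smul_dotProduct, smul_eq_mul, dotProduct_comm v u, Matrix.add_mulVec, Matrix.sub_mulVec,
      add_dotProduct, sub_dotProduct]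
    ring
  rw [gM_mul_self hY, blk_mul, blk_trace, Matrix.trace_add, Matrix.trace_add, hA,
    Matrix.trace_vecMulVec, Matrix.trace_vecMulVec]
  have e1 : u ⬝ᵥ (Y *ᵥ v) = -((Y *ᵥ u) ⬝ᵥ v) := h u v
  have e2 : v ⬝ᵥ (Y *ᵥ u) = (Y *ᵥ u) ⬝ᵥ v := dotProduct_comm _ _
  have e3 : (Y *ᵥ v) ⬝ᵥ u = -((Y *ᵥ u) ⬝ᵥ v) := by rw [dotProduct_comm, e1]
  simp only [dotProduct_add, add_dotProduct, dotProduct_smul, smul_dotProduct, smul_eq_mul,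
    dotProduct_neg, neg_dotProduct, e1, e2, e3]
  ring

/-- The fibre coordinate is `δ`. While `tr X²` is only affine in `δ`, the quadratic part of `tr X⁴`
is positive definite when `β ≠ 0`, so its constancy on an orbit bounds `δ`. -/
theorem trace_gM_sub_add_pow_four {n : ℕ} {Y : Matrix (Tr n) (Tr n) ℝ} (hY : Yᵀ = -Y)
    (β δ : Tr n → ℝ) (b : ℝ) :
    (gM Y (β - δ) (β + δ) b * gM Y (β - δ) (β + δ) b *
      (gM Y (β - δ) (β + δ) b * gM Y (β - δ) (β + δ) b)).trace =
      (Y * Y * (Y * Y)).trace + 2 * b ^ 4 + 16 * ((β ⬝ᵥ β) * (δ ⬝ᵥ δ) + (β ⬝ᵥ δ) ^ 2 +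
        (Y *ᵥ (Y *ᵥ β) + b • (Y *ᵥ β) + b ^ 2 • β) ⬝ᵥ δ) := by
  have h : ∀ x y : Tr n → ℝ, x ⬝ᵥ (Y *ᵥ y) = -((Y *ᵥ x) ⬝ᵥ y) := fun x y => by
    rw [Matrix.dotProduct_mulVec, ← Matrix.mulVec_transpose, hY, Matrix.neg_mulVec, neg_dotProduct]
  have hz : ∀ x, (Y *ᵥ x) ⬝ᵥ x = 0 := fun x => by
    have := h x x
    rw [dotProduct_comm] at this
    linarith
  have e1 : (Y *ᵥ δ) ⬝ᵥ β = -((Y *ᵥ β) ⬝ᵥ δ) := by rw [dotProduct_comm, h]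
  have e2 : (Y *ᵥ (Y *ᵥ δ)) ⬝ᵥ β = (Y *ᵥ (Y *ᵥ β)) ⬝ᵥ δ := by
    rw [dotProduct_comm, h, h, neg_neg]
  rw [trace_gM_pow_four hY]
  simp only [Matrix.mulVec_add, Matrix.mulVec_sub, dotProduct_add, add_dotProduct, dotProduct_sub,
    sub_dotProduct, smul_dotProduct, smul_eq_mul, hz, e1, dotProduct_comm δ β, h, e2]
  ring

/-! ### Bounds over compact sets of restrictions -/

/-- Coordinates of an element of `𝔤` that only depend on its restriction to `𝔭`. -/
def yPart {n : ℕ} (M : Mat n) : Matrix (Tr n) (Tr n) ℝ :=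
  M.submatrix (fun i => .inl (.inl i)) fun i => .inl (.inl i)

def betaPart {n : ℕ} (M : Mat n) : Tr n → ℝ := fun i =>
  (1 / 2) * (M (.inl (.inl i)) (.inl (.inr ())) + M (.inl (.inl i)) (.inr ()))

def bPart {n : ℕ} (M : Mat n) : ℝ := M (.inl (.inr ())) (.inr ())

theorem yPart_gM {n : ℕ} (Y : Matrix (Tr n) (Tr n) ℝ) (u v : Tr n → ℝ) (b : ℝ) :
    yPart (gM Y u v b) = Y := rfl

theorem bPart_gM {n : ℕ} (Y : Matrix (Tr n) (Tr n) ℝ) (u v : Tr n → ℝ) (b : ℝ) :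
    bPart (gM Y u v b) = b := rfl

theorem betaPart_gM {n : ℕ} (Y : Matrix (Tr n) (Tr n) ℝ) (u v : Tr n → ℝ) (b : ℝ) :
    betaPart (gM Y u v b) = (1 / 2 : ℝ) • (u + v) := rfl

theorem continuous_yPart (n : ℕ) : Continuous (yPart : Mat n → _) :=
  continuous_id.matrix_submatrix _ _

theorem continuous_betaPart (n : ℕ) : Continuous (betaPart : Mat n → _) :=
  continuous_pi fun _ => continuous_const.mul
    ((continuous_id.matrix_elem _ _).add (continuous_id.matrix_elem _ _))

theorem continuous_bPart (n : ℕ) : Continuous (bPart : Mat n → ℝ) := continuous_id.matrix_elem _ _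

/-- A bound for the entries of `X` in terms of `tr X⁴ = τ` and of the restriction to `𝔭`. -/
def entryBound {n : ℕ} (τ : ℝ) (Y : Matrix (Tr n) (Tr n) ℝ) (β : Tr n → ℝ) (b : ℝ) : ℝ :=
  (Yᵀ * Y).trace + 2 * b ^ 2 + 4 * (β ⬝ᵥ β) + 4 *
    (2 * ((τ - (Y * Y * (Y * Y)).trace - 2 * b ^ 4) / 16 / (β ⬝ᵥ β)) +
      ((Y *ᵥ (Y *ᵥ β) + b • (Y *ᵥ β) + b ^ 2 • β) ⬝ᵥ (Y *ᵥ (Y *ᵥ β) + b • (Y *ᵥ β) + b ^ 2 • β)) /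
        (β ⬝ᵥ β) ^ 2)

theorem trace_transpose_mul_gM {n : ℕ} (Y : Matrix (Tr n) (Tr n) ℝ) (u v : Tr n → ℝ) (b : ℝ) :
    ((gM Y u v b)ᵀ * gM Y u v b).trace =
      (Yᵀ * Y).trace + 2 * (u ⬝ᵥ u) + 2 * (v ⬝ᵥ v) + 2 * b ^ 2 := by
  rw [gM, blk_transpose, blk_mul, blk_trace]
  simp [Matrix.trace_vecMulVec]
  ring

theorem trace_le_entryBound {n : ℕ} {Y : Matrix (Tr n) (Tr n) ℝ} (hY : Yᵀ = -Y) {β δ : Tr n → ℝ}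
    {b τ : ℝ} (hβ : β ≠ 0) (hτ : (gM Y (β - δ) (β + δ) b * gM Y (β - δ) (β + δ) b *
      (gM Y (β - δ) (β + δ) b * gM Y (β - δ) (β + δ) b)).trace = τ) :
    ((gM Y (β - δ) (β + δ) b)ᵀ * gM Y (β - δ) (β + δ) b).trace ≤ entryBound τ Y β b := by
  have hB : 0 < β ⬝ᵥ β := lt_of_le_of_ne (Finset.sum_nonneg fun _ _ => mul_self_nonneg _)
    fun h => hβ (dotProduct_self_eq_zero.1 h.symm)
  rw [trace_gM_sub_add_pow_four hY] at hτ
  rw [trace_transpose_mul_gM, entryBound]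
  set l := Y *ᵥ (Y *ᵥ β) + b • (Y *ᵥ β) + b ^ 2 • β with hl
  set B := β ⬝ᵥ β with hBdef
  -- Completing the square absorbs the linear term: `|δ|² ≤ 2 (|δ|² + l·δ / B) + |l|² / B²`.
  have h1 : 0 ≤ (δ + (1 / B) • l) ⬝ᵥ (δ + (1 / B) • l) :=
    Finset.sum_nonneg fun i _ => mul_self_nonneg _
  have h2 : (δ + (1 / B) • l) ⬝ᵥ (δ + (1 / B) • l) =
      δ ⬝ᵥ δ + 2 * (l ⬝ᵥ δ / B) + l ⬝ᵥ l / B ^ 2 := by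
    simp only [dotProduct_add, add_dotProduct, dotProduct_smul, smul_dotProduct, smul_eq_mul,
      dotProduct_comm δ l]
    field_simp
    ring
  have h3 : δ ⬝ᵥ δ + l ⬝ᵥ δ / B ≤ (τ - (Y * Y * (Y * Y)).trace - 2 * b ^ 4) / 16 / B := by
    rw [le_div_iff₀ hB, add_mul, div_mul_cancel₀ _ hB.ne']
    nlinarith [sq_nonneg (β ⬝ᵥ δ)]
  simp only [dotProduct_add, add_dotProduct, dotProduct_sub, sub_dotProduct, dotProduct_comm δ β]
  linarith

theorem entry_sq_le_trace {n : ℕ} (M : Mat n) (i j : Ix n) : M i j ^ 2 ≤ (Mᵀ * M).trace := by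
  have h : (Mᵀ * M).trace = ∑ l, ∑ k, M k l ^ 2 := by
    simp [Matrix.trace, Matrix.mul_apply, pow_two]
  rw [h]
  exact (Finset.single_le_sum (f := fun k => M k j ^ 2) (fun _ _ => sq_nonneg _)
    (Finset.mem_univ i)).trans (Finset.single_le_sum (f := fun l => ∑ k, M k l ^ 2)
      (fun _ _ => Finset.sum_nonneg fun _ _ => sq_nonneg _) (Finset.mem_univ j))

/-- A linear section lets the entry bound be regarded as a continuous function of the restriction.
-/
theorem exists_section_q (n : ℕ) : ∃ s : Module.Dual ℝ (pLie n) →ₗ[ℝ] gLie n,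
    ∀ μ, q n (iota (s μ)) = μ := by
  have hsurj : Function.Surjective (q n) :=
    LinearMap.dualMap_surjective_of_injective (Submodule.subtype_injective (pLie n).toSubmodule)
  obtain ⟨t, ht⟩ := (q n).exists_rightInverse_of_surjective (LinearMap.range_eq_top.2 hsurj)
  refine ⟨(iotaEquiv n).symm.toLinearMap ∘ₗ t, fun μ => ?_⟩
  change q n (iota ((iotaEquiv n).symm (t μ))) = μ
  rw [iota_iotaEquiv_symm]
  exact LinearMap.congr_fun ht μ

theorem continuousOn_entryBound (n : ℕ) (τ : ℝ) :
    ContinuousOn (fun M : Mat n => entryBound τ (yPart M) (betaPart M) (bPart M))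
      {M | betaPart M ≠ 0} := by
  have cY := continuous_yPart n
  have cβ := continuous_betaPart n
  have cb := continuous_bPart n
  have cB : Continuous fun M : Mat n => betaPart M ⬝ᵥ betaPart M := cβ.dotProduct cβ
  have cl := ((cY.matrix_mulVec (cY.matrix_mulVec cβ)).add (cb.smul (cY.matrix_mulVec cβ))).add
    ((cb.pow 2).smul cβ)
  have hne : ∀ M ∈ {M : Mat n | betaPart M ≠ 0}, betaPart M ⬝ᵥ betaPart M ≠ 0 :=
    fun M hM h => hM (dotProduct_self_eq_zero.1 h)
  have c1 := ((((continuous_const (y := τ)).sub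
    ((cY.matrix_mul cY).matrix_mul (cY.matrix_mul cY)).matrix_trace)).sub
      ((continuous_const (y := (2 : ℝ))).mul (cb.pow 4))).div_const 16
  have c2 := ((cY.matrix_transpose.matrix_mul cY).matrix_trace.add
    ((continuous_const (y := (2 : ℝ))).mul (cb.pow 2))).add
      ((continuous_const (y := (4 : ℝ))).mul cB)
  exact c2.continuousOn.add (continuousOn_const.mul ((continuousOn_const.mul
    (c1.continuousOn.div cB.continuousOn hne)).add ((cl.dotProduct cl).continuousOn.div
      (cB.pow 2).continuousOn fun M hM => pow_ne_zero 2 (hne M hM))))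

theorem trace_Ad_pow_four {n : ℕ} (g : SpinG n) (X : gLie n) :
    (((Ad n g X : gLie n) : Mat n) * ((Ad n g X : gLie n) : Mat n) *
      (((Ad n g X : gLie n) : Mat n) * ((Ad n g X : gLie n) : Mat n))).trace =
    ((X : Mat n) * (X : Mat n) * ((X : Mat n) * (X : Mat n))).trace := by
  have h1 : ∀ A B : Mat n, (rho n g * A * rho n g⁻¹) * (rho n g * B * rho n g⁻¹) =
      rho n g * (A * B) * rho n g⁻¹ := fun A B => by
    calc _ = rho n g * A * (rho n g⁻¹ * rho n g) * B * rho n g⁻¹ := by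
          simp only [Matrix.mul_assoc]
      _ = _ := by rw [rho_inv_mul, Matrix.mul_one]; simp only [Matrix.mul_assoc]
  rw [Ad_coe, h1, h1, Matrix.trace_mul_comm, ← Matrix.mul_assoc, rho_inv_mul, Matrix.one_mul]

theorem trace_le_entryBound_of_q_eq {n : ℕ} {X X' : gLie n} (h : q n (iota X) = q n (iota X'))
    (hX' : betaPart (X' : Mat n) ≠ 0) : ((X : Mat n)ᵀ * (X : Mat n)).trace ≤
      entryBound ((X : Mat n) * (X : Mat n) * ((X : Mat n) * (X : Mat n))).trace
        (yPart (X' : Mat n)) (betaPart (X' : Mat n)) (bPart (X' : Mat n)) := by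
  obtain ⟨Y, u, v, b, hY, hX⟩ := exists_gM X
  obtain ⟨γ, hγ⟩ := (q_iota_eq_iff X X').1 h
  rw [hX, gM_add_nX] at hγ
  have hsum : u - γ + (v + γ) = u + v := by abel
  rw [hγ, betaPart_gM, hsum] at hX'
  rw [hγ, yPart_gM, betaPart_gM, bPart_gM, hsum]
  have hu : u = (1 / 2 : ℝ) • (u + v) - (1 / 2 : ℝ) • (v - u) := by module
  have hv : v = (1 / 2 : ℝ) • (u + v) + (1 / 2 : ℝ) • (v - u) := by module
  have hXe : (X : Mat n) = gM Y ((1 / 2 : ℝ) • (u + v) - (1 / 2 : ℝ) • (v - u))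
      ((1 / 2 : ℝ) • (u + v) + (1 / 2 : ℝ) • (v - u)) b := by rw [hX, ← hu, ← hv]
  rw [hXe]
  exact trace_le_entryBound hY hX' rfl

/-- The functional `Z ↦ ½ tr(MZ)` for an arbitrary matrix `M`. -/
def traceDual {n : ℕ} (M : Mat n) : Module.Dual ℝ (gLie n) where
  toFun Z := (1 / 2) * (M * (Z : Mat n)).trace
  map_add' Z Z' := by simp [mul_add]
  map_smul' r Z := by simp; ring

theorem continuous_traceDual (n : ℕ) : Continuous (traceDual : Mat n → _) :=
  continuous_induced_rng.2 (continuous_pi fun _ =>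
    continuous_const.mul ((continuous_id.matrix_mul continuous_const).matrix_trace))

theorem isCompact_traceDual_trace_le (n : ℕ) (C : ℝ) :
    ∃ K : Set (Module.Dual ℝ (gLie n)), IsCompact K ∧
      ∀ X : gLie n, ((X : Mat n)ᵀ * (X : Mat n)).trace ≤ C → iota X ∈ K := by
  let box : Set (Mat n) := Set.univ.pi fun _ => Set.univ.pi fun _ => Set.Icc (-(|C| + 1)) (|C| + 1)
  have hbox : IsCompact box := isCompact_univ_pi fun _ => isCompact_univ_pi fun _ => isCompact_Icc
  refine ⟨_, hbox.image (continuous_traceDual n), fun X hX => ⟨(X : Mat n), ?_, rfl⟩⟩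
  refine fun i _ j _ => abs_le.1 (abs_le_of_sq_le_sq ?_ (by positivity))
  refine (entry_sq_le_trace _ i j).trans (hX.trans ?_)
  nlinarith [le_abs_self C, abs_nonneg C]

/-- The preimage is closed in the dual, since the orbit is, and the entry bound attains a maximum
over `Ω`, which confines the preimage to a compact box. Of strong regularity only regularity enters,
through `β ≠ 0`. -/
theorem weaklyProper_orbit {n : ℕ} {a : Fin (n - 1) → ℝ} (ha : StrictAnti a) (ha₀ : ∀ i, 0 < a i)
    {c : ℝ} (hc : 0 < c) : WeaklyProper (orbit (coad n) (iota (tPrime a c : gLie n))) := by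
  intro Ω hΩ hsub
  obtain ⟨s, hs⟩ := exists_section_q n
  have hscont : Continuous fun μ => ((s μ : gLie n) : Mat n) :=
    continuous_matrix fun i j => continuous_linear_dual
      ((LinearMap.proj j ∘ₗ LinearMap.proj i) ∘ₗ (gLie n).toSubmodule.subtype ∘ₗ s)
  have hβΩ : ∀ μ ∈ Ω, betaPart ((s μ : gLie n) : Mat n) ≠ 0 := fun μ hμ => by
    obtain ⟨Y, u, v, b, hY, hX⟩ := exists_gM (s μ)
    have := add_ne_zero_of_isRegular hY hX (by rw [hs]; exact (hsub hμ).2.1)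
    rw [hX, betaPart_gM]
    exact smul_ne_zero (by norm_num) this
  generalize hT : (tPrime a c : gLie n) = T
  obtain ⟨C, hC⟩ := (hΩ.image_of_continuousOn ((continuousOn_entryBound n
    ((T : Mat n) * (T : Mat n) * ((T : Mat n) * (T : Mat n))).trace).comp
      hscont.continuousOn hβΩ)).bddAbove
  obtain ⟨K, hK, hKX⟩ := isCompact_traceDual_trace_le n C
  rw [Topology.IsEmbedding.subtypeVal.isCompact_iff]
  have := t2Space_dual (pLie n)
  have hclosed : IsClosed (orbit (coad n) (iota T) ∩ q n ⁻¹' Ω) :=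
    (hT ▸ isClosed_orbit_tPrime ha ha₀ hc).inter (hΩ.isClosed.preimage (continuous_q n))
  have himage : Subtype.val '' {φ : orbit (coad n) (iota T) | q n φ ∈ Ω} =
      orbit (coad n) (iota T) ∩ q n ⁻¹' Ω := by
    ext φ
    constructor
    · rintro ⟨ψ, hψ, rfl⟩
      exact ⟨ψ.2, hψ⟩
    · rintro ⟨h1, h2⟩
      exact ⟨⟨φ, h1⟩, h2, rfl⟩
  rw [himage]
  refine hK.of_isClosed_subset hclosed ?_
  rintro φ ⟨hφ, hφΩ⟩
  obtain ⟨g, rfl⟩ := mem_orbit_iota.1 hφ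
  refine hKX _ ((trace_le_entryBound_of_q_eq (hs _).symm (hβΩ _ hφΩ)).trans ?_)
  rw [trace_Ad_pow_four]
  exact hC ⟨_, hφΩ, rfl⟩

end SpinMoment

end

open SpinMoment in
theorem mainTheorem9 (n : ℕ) (hn : 2 ≤ n) (a : Fin (n - 1) → ℝ) (ha : StrictAnti a)
    (ha₀ : ∀ i, 0 < a i) (c : ℝ) (hc : 0 < c)
    (f : Module.Dual ℝ (gLie n)) (hf : f = iota (tPrime a c))
    (O : Set (Module.Dual ℝ (gLie n))) (hO : O = orbit (coad n) f) :
    -- the image of the moment map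
    (∃ g' : SpinG n, rho n g' = gInfMat n) ∧
    (∀ g' : SpinG n, rho n g' = gInfMat n →
      DepthZero (orbit (coadP n) (q n f)) ∧
      DepthZero (orbit (coadP n) (q n (coad n g' f))) ∧
      orbit (coadP n) (q n f) ≠ orbit (coadP n) (q n (coad n g' f)) ∧
      q n '' O = orbit (coadP n) (q n f) ∪ orbit (coadP n) (q n (coad n g' f)) ∪
        {μ | ¬ DepthZero (orbit (coadP n) μ) ∧
          ∃ x : Fin (n - 1) → ℝ, HasSingularValues (orbit (coadP n) μ) x ∧
            (∀ i, x i ≤ a i) ∧ (∀ i j : Fin (n - 1), (j : ℕ) = i + 1 → a j ≤ x i)}) ∧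
    -- different `P`-orbits in `O` are mapped to different `P`-orbits
    (∀ φ ∈ O, ∀ ψ ∈ O, orbit (coadP n) (q n φ) = orbit (coadP n) (q n ψ) →
      orbit (coadGP n) φ = orbit (coadGP n) ψ) ∧
    -- the reduced spaces are singletons
    (∀ g : SpinG n, Nonempty (Unique (ReducedSpace O (q n (coad n g f))))) ∧
    WeaklyProper O ∧
    ¬ IsProperMap (fun φ : O => q n (φ : Module.Dual ℝ (gLie n))) := by
  subst hO
  subst hf
  exact ⟨exists_rho_eq_gInfMat n,
    fun g' hg' => ⟨depthZero_q_iota_tPrime a c, depthZero_q_coad_gInf a c hg',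
      orbit_q_tPrime_ne a hc hg', image_q ha ha₀ hc hg'⟩,
    fun φ hφ ψ hψ h => orbit_coadGP_eq_of_orbit_q_eq ha ha₀ hc hφ hψ h,
    fun g => nonempty_unique_reducedSpace ha ha₀ hc g,
    weaklyProper_orbit ha ha₀ hc,
    not_isProperMap_q hc⟩
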